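/- \textbf{Setting.} Let $K\supseteq\mathbb C$ be a field (for instance the algebraic closure $\overline{\mathbb C(\xi)}$ of a field of rational functions in parameters $\xi$) and let $W=K\langle x,\partial\rangle/(\partial x-x\partial=1)$ be the Weyl algebra. Write $P\in W$ uniquely as $P=\sum_k p_k(x)\partial^k$; $\operatorname{ord}P$ is the largest $k$ with $p_k\ne0$, and $\deg P=\max_k\deg p_k$. The Fourier--Laplace transform $\mathcal L$ is the algebra automorphism $x\mapsto-\partial$, $\partial\mapsto x$; $\mathrm{Ade}(p(x))$ is the automorphism $x\mapsto x$, $\partial\mapsto\partial-p'(x)$; and $\mathrm RP$ denotes a nonzero element of $K(x)P\cap W$ of minimal degree (unique up to a nonzero constant). Write $[\mu]_m=\{\mu,\mu+1,\dots,\mu+m-1\}$. \textbf{Semi-simple exponents.} Let $n=\operatorname{ord}P$. (a) At a regular singular point $x=c$, put $f_c(x,\nu)=\sum_k\frac{(x-c)^{n-k}p_k(x)}{p_n(x)}\nu(\nu-1)\cdots(\nu-k+1)=\sum_{k\ge0}f_k(\nu)(x-c)^k$. Then $P$ has semi-simple exponents $\{[\mu_1]_{m_1},\dots,[\mu_l]_{m_l}\}$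 at $c$ if $\sum m_i=n$, $\mu_i-\mu_j\notin\mathbb Z$ for $i\ne j$, and $f_k(\mu_i+j)=0$ for $0\le j<m_i$, $0\le k<m_i-j$. (b) At $x=\infty$, write $P=\sum_{s\ge0}x^{\rho-s}P_s(\partial)$ with $\rho=\deg P$, and $p_k(\lambda)=\sum_{i=0}^k(\lambda+i+1)(\lambda+i+2)\cdots(\lambda+k)\,P_i^{(k-i)}(0)/(k-i)!$. Then $P$ has semi-simple exponents $\{[\mu_1]_{m_1},\dots,[\mu_l]_{m_l}\}$ at $\infty$, with $m=\sum m_i$, if $P_i^{(j)}(0)=0$ for $i+j<m$, $P_0^{(m)}(0)\neq0$, $\mu_i-\mu_j\notin\mathbb Z$ for $i\neq j$, and $p_k(-\mu_i-j-k)=0$ for $0\le j<m_i$, $m\le k<m+m_i-j$. They are $e^{p(x)}$-twisted exponents of $P$ if they are exponents at $\infty$ of $P(x,\partial+p'(x))$. \textbf{Table of local data.} Data: distinct $c_1,\dots,c_p\in\mathbb C$ with sets $[\mu^i;m^i]=\{[\mu^i_1]_{m^i_1},\dots,[\mu^i_{s_i}]_{m^i_{s_i}}\}$; distinct $\alpha_1,\dots,\alpha_r\in\mathbb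 C$; and for each $i$ distinct $\beta^i_1,\dots,\beta^i_{l_i}\in\mathbb C$ with sets $[\nu^{ij};n^{ij}]=\{[\nu^{ij}_1]_{n^{ij}_1},\dots,[\nu^{ij}_{t_{ij}}]_{n^{ij}_{t_{ij}}}\}$ (any of these lists may be empty). All multiplicities are positive integers, all exponents $\mu^i_j,\nu^{ij}_k\in K$ are non-integers, and different exponents in one set do not differ by an integer. Put $n^i_j=\sum_kn^{ij}_k$ and $n_i=\sum_jn^i_j$. These data are the table of local data of a nonzero $P\in W$ of order $n$ if: (1) the only singular points of $P$ in $\mathbb C$, up to left multiplication by rational functions, are regular singular points among $c_1,\dots,c_p$ (i.e. $\prod_j(x-c_j)^{n-k}\,p_k/p_n\in K[x]$ for all $k$), and $P$ has semi-simple exponents $\{[0]_{m^i_0},[\mu^i_1]_{m^i_1},\dots,[\mu^i_{s_i}]_{m^i_{s_i}}\}$ at $c_i$, where $m_0^i=n-\sum_{j\ge1}m^i_j\ge0$; (2) the rank of irregularity of $P$ at $\infty$ is at most $2$; (3) $P$ is normal at $\infty$: with the Newton polygon at $\infty$ of $\sum_ka_k\partial^k$ defined as the convex hull of the quadrants $\{x\le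 k,\ y\ge k-\deg a_k\}$, $a_k\neq0$, the polygon of $P(x,\partial+\alpha_ix)$ has only slopes $0,1$ of total length $n_i$ and slope $2$ of length $n-n_i$, and the polygon of $P(x,\partial+\alpha_ix+\beta^i_j)$ has slopes $0,1,2$ of lengths $n^i_j$, $n_i-n^i_j$, $n-n_i$ (lengths may be $0$); (4) $P$ has $e^{\frac{\alpha_i}2x^2+\beta^i_jx}$-twisted semi-simple exponents $[\nu^{ij};n^{ij}]$ at $\infty$, and $\sum_in_i=n$. \textbf{Theorem.} Let $P\in W$ have order $n$ and the above table of local data, and let $i_0\in\{1,\dots,r\}$. (i) $\mathrm{Ade}(-\frac{\alpha_{i_0}}2x^2)P$ has the same table with every $\alpha_i$ replaced by $\alpha_i-\alpha_{i_0}$. Hence, after reordering, one may normalize $\alpha_{1}=0$. (ii) If $\alpha_{i_0}=0$ (say $i_0=1$), then $$\operatorname{ord}\mathcal L(\mathrm RP)=\sum_{i=1}^p\sum_{j=1}^{s_i}m^i_j+(n-n_1),$$ and $\mathcal L(\mathrm RP)$ has the following table of local data: the finite singular points are $\beta^1_1,\dots,\beta^1_{l_1}$, and $\beta^1_j$ carries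 $\{[\nu^{1j}_k-1]_{n^{1j}_k}\}_{k}$; the column for $0$ has the points $-c_1,\dots,-c_p$, and $-c_i$ carries $\{[\mu^i_j+1]_{m^i_j}\}_{j}$; and for each $i=2,\dots,r$ there is a column for $-\frac1{\alpha_i}$ with the points $\frac{\beta^i_1}{\alpha_i},\dots,\frac{\beta^i_{l_i}}{\alpha_i}$, and $\frac{\beta^i_j}{\alpha_i}$ carries the unchanged set $[\nu^{ij};n^{ij}]$. -/

import Mathlib

open Polynomial

/-! ## The Weyl algebra -/

section WeylAlgebra

/-- The defining relation `∂ x = x ∂ + 1`; the generator `0` is `x`, the generator `1` is `∂`. -/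
inductive WeylRel (K : Type*) [Field K] :
    FreeAlgebra K (Fin 2) → FreeAlgebra K (Fin 2) → Prop
  | comm : WeylRel K (FreeAlgebra.ι K 1 * FreeAlgebra.ι K 0)
      (FreeAlgebra.ι K 0 * FreeAlgebra.ι K 1 + 1)

/-- The Weyl algebra `W[x] = K⟨x, ∂⟩ / (∂ x - x ∂ = 1)` over the field `K`. -/
def Weyl (K : Type*) [Field K] : Type _ := RingQuot (WeylRel K)

noncomputable instance instRingWeyl (K : Type*) [Field K] : Ring (Weyl K) :=
  inferInstanceAs (Ring (RingQuot (WeylRel K)))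

noncomputable instance instAlgebraWeyl (K : Type*) [Field K] : Algebra K (Weyl K) :=
  inferInstanceAs (Algebra K (RingQuot (WeylRel K)))

namespace Weyl

variable {K : Type*} [Field K]

/-- The projection from the free algebra. -/
noncomputable def mk : FreeAlgebra K (Fin 2) →ₐ[K] Weyl K := RingQuot.mkAlgHom K (WeylRel K)

theorem mk_surjective : Function.Surjective (mk (K := K)) :=
  RingQuot.mkAlgHom_surjective K (WeylRel K)

/-- The generator `x`. -/
noncomputable def x : Weyl K := mk (FreeAlgebra.ι K 0)

/-- The generator `∂`. -/
noncomputable def d : Weyl K := mk (FreeAlgebra.ι K 1)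

theorem d_mul_x : (d : Weyl K) * x = x * d + 1 := by
  have h : mk (FreeAlgebra.ι K 1 * FreeAlgebra.ι K 0)
      = mk (FreeAlgebra.ι K 0 * FreeAlgebra.ι K 1 + 1) :=
    RingQuot.mkAlgHom_rel K (WeylRel.comm (K := K))
  simp only [map_mul, map_add, map_one] at h
  exact h

/-- The universal property: two elements `a`, `b` of a `K`-algebra with `b a = a b + 1`
determine the algebra map `x ↦ a`, `∂ ↦ b`. -/
noncomputable def lift {A : Type*} [Ring A] [Algebra K A] (a b : A) (h : b * a = a * b + 1) :
    Weyl K →ₐ[K] A :=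
  RingQuot.liftAlgHom K ⟨FreeAlgebra.lift K ![a, b], by
    intro u v huv
    cases huv
    simp [h]⟩

theorem lift_x {A : Type*} [Ring A] [Algebra K A] (a b : A) (h : b * a = a * b + 1) :
    lift (K := K) a b h x = a := by
  unfold lift x mk
  erw [RingQuot.liftAlgHom_mkAlgHom_apply]
  simp

theorem lift_d {A : Type*} [Ring A] [Algebra K A] (a b : A) (h : b * a = a * b + 1) :
    lift (K := K) a b h d = b := by
  unfold lift d mk
  erw [RingQuot.liftAlgHom_mkAlgHom_apply]
  simp

theorem algHom_ext {A : Type*} [Ring A] [Algebra K A] {f g : Weyl K →ₐ[K] A}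
    (hx : f x = g x) (hd : f d = g d) : f = g := by
  refine RingQuot.ringQuot_ext' (S := K) (s := WeylRel K) f g ?_
  ext i
  fin_cases i
  · exact hx
  · exact hd

/-- The function `p(x)` as an element of the Weyl algebra (multiplication operator). -/
noncomputable def fn (p : K[X]) : Weyl K := aeval x p

theorem d_mul_fn (p : K[X]) : (d : Weyl K) * fn p = fn p * d + fn (derivative p) := by
  unfold fn
  induction p using Polynomial.induction_on' with
  | add p q hp hq => simp only [map_add, mul_add, add_mul, hp, hq]; abel
  | monomial n a =>
    induction n with
    | zero =>
      simp only [monomial_zero_left, aeval_C, derivative_C, map_zero, add_zero]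
      exact (Algebra.commutes a d).symm
    | succ n ih =>
      have e : (monomial (n + 1) a : K[X]) = monomial n a * X := by
        rw [monomial_mul_X]
      rw [e]
      simp only [map_mul, aeval_X, derivative_mul, derivative_X, mul_one, map_add]
      rw [← mul_assoc, ih, add_mul, mul_assoc, d_mul_x, mul_add, mul_one, mul_assoc]
      abel

/-! ### The normal form `P = ∑ pₖ(x) ∂ᵏ` -/

/-- The operator `∑ₖ pₖ(x) ∂ᵏ`, where `pₖ` is the `k`-th coefficient of `f ∈ K[X][Y]`. -/
noncomputable def ofCoeffs (f : K[X][X]) : Weyl K := f.sum fun k p => fn p * d ^ k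

theorem ofCoeffs_add (f g : K[X][X]) : ofCoeffs (f + g) = ofCoeffs f + ofCoeffs g := by
  unfold ofCoeffs fn
  exact sum_add_index f g _ (by simp) (by intros; simp [add_mul])

theorem ofCoeffs_monomial (k : ℕ) (p : K[X]) : ofCoeffs (monomial k p) = fn p * d ^ k := by
  unfold ofCoeffs fn
  exact sum_monomial_index p _ (by simp)

/-- Differentiation `p Yᵏ ↦ p' Yᵏ` of the coefficients on `K[X][Y]`. -/
noncomputable def coeffDeriv : K[X][X] →ₗ[K] K[X][X] :=
  lsum fun k => ((monomial k : K[X] →ₗ[K[X]] K[X][X]).restrictScalars K) ∘ₗ derivative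

theorem coeffDeriv_monomial (k : ℕ) (p : K[X]) :
    coeffDeriv (monomial k p) = monomial k (derivative p) := by
  simp [coeffDeriv, lsum_apply, sum_monomial_index]

/-- The left regular action of the Weyl algebra on normally ordered symbols in `K[X][Y]`
(`p Yᵏ` stands for `p(x) ∂ᵏ`): `x` acts by `p Yᵏ ↦ X p Yᵏ`, and `∂` acts by
`p Yᵏ ↦ p Yᵏ⁺¹ + p' Yᵏ`. -/
noncomputable def symbolAction : Weyl K →ₐ[K] Module.End K K[X][X] :=
  lift (A := Module.End K K[X][X]) (LinearMap.mulLeft K (C (X : K[X])))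
    (LinearMap.mulLeft K (X : K[X][X]) + coeffDeriv) (by
    ext1 f
    induction f using Polynomial.induction_on' with
    | add p q hp hq => simp only [map_add, hp, hq]
    | monomial k p =>
      simp only [Module.End.mul_apply, LinearMap.add_apply, LinearMap.mulLeft_apply,
        C_mul_monomial, X_mul_monomial, coeffDeriv_monomial, derivative_mul, derivative_X,
        one_mul, map_add, Module.End.one_apply, mul_add]
      abel)

/-- The symbol `∑ₖ pₖ Yᵏ ∈ K[X][Y]` of `P = ∑ₖ pₖ(x) ∂ᵏ`. -/
noncomputable def symbol (P : Weyl K) : K[X][X] := symbolAction P 1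

theorem symbolAction_fn (p : K[X]) (f : K[X][X]) : symbolAction (fn p) f = C p * f := by
  unfold fn
  induction p using Polynomial.induction_on' generalizing f with
  | add p q hp hq => simp only [map_add, LinearMap.add_apply, hp, hq, add_mul]
  | monomial n a =>
    induction n generalizing f with
    | zero =>
      simp only [monomial_zero_left, aeval_C, AlgHom.commutes, Module.algebraMap_end_apply]
      ext k
      simp [coeff_C_mul, smul_eq_C_mul]
    | succ n ih =>
      rw [← monomial_mul_X, map_mul, map_mul, Module.End.mul_apply, aeval_X, ih]
      have : symbolAction (x : Weyl K) f = C X * f := by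
        unfold symbolAction; rw [lift_x]; rfl
      rw [this, C_mul, mul_assoc]

theorem symbolAction_d (f : K[X][X]) : symbolAction (d : Weyl K) f = X * f + coeffDeriv f := by
  unfold symbolAction; rw [lift_d]; rfl

theorem symbol_d_pow (k : ℕ) : symbol ((d : Weyl K) ^ k) = X ^ k := by
  unfold symbol
  induction k with
  | zero => simp
  | succ k ih =>
    rw [pow_succ', map_mul, Module.End.mul_apply, ih, symbolAction_d]
    have : (X ^ k : K[X][X]) = monomial k 1 := (monomial_one_right_eq_X_pow k).symm
    rw [this, coeffDeriv_monomial]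
    simp [monomial_one_right_eq_X_pow, pow_succ']

/-- The coefficients of a normal form are uniquely determined. -/
theorem symbol_ofCoeffs (f : K[X][X]) : symbol (ofCoeffs f) = f := by
  induction f using Polynomial.induction_on' with
  | add p q hp hq =>
    rw [ofCoeffs_add]
    unfold symbol at *
    rw [map_add, LinearMap.add_apply, hp, hq]
  | monomial k p =>
    have h := symbol_d_pow (K := K) k
    unfold symbol at *
    rw [ofCoeffs_monomial, map_mul, Module.End.mul_apply, h, symbolAction_fn,
      C_mul_X_pow_eq_monomial]

theorem x_mul_ofCoeffs (f : K[X][X]) : x * ofCoeffs f = ofCoeffs (C X * f) := by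
  induction f using Polynomial.induction_on' with
  | add p q hp hq => rw [ofCoeffs_add, mul_add, mul_add, ofCoeffs_add, hp, hq]
  | monomial k p =>
    rw [C_mul_monomial, ofCoeffs_monomial, ofCoeffs_monomial, ← mul_assoc]
    simp [fn]

theorem d_mul_ofCoeffs (f : K[X][X]) : d * ofCoeffs f = ofCoeffs (X * f + coeffDeriv f) := by
  induction f using Polynomial.induction_on' with
  | add p q hp hq =>
    rw [ofCoeffs_add, mul_add, hp, hq, ← ofCoeffs_add, map_add]
    congr 1; ring
  | monomial k p =>
    rw [X_mul_monomial, coeffDeriv_monomial, ofCoeffs_add, ofCoeffs_monomial, ofCoeffs_monomial,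
      ofCoeffs_monomial, ← mul_assoc, d_mul_fn, add_mul, mul_assoc, ← pow_succ']

/-- Every element of the Weyl algebra has a normal form. -/
theorem ofCoeffs_symbol (P : Weyl K) : ofCoeffs (symbol P) = P := by
  have key : ∀ (a : FreeAlgebra K (Fin 2)) (f : K[X][X]),
      ofCoeffs (symbolAction (mk a) f) = mk a * ofCoeffs f := by
    intro a
    induction a using FreeAlgebra.induction with
    | grade0 r =>
      intro f
      have e : (mk (algebraMap K _ r) : Weyl K) = fn (C r) := by
        rw [AlgHom.commutes]; simp only [fn, aeval_C]
      rw [e, symbolAction_fn]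
      induction f using Polynomial.induction_on' with
      | add p q hp hq => rw [mul_add, ofCoeffs_add, ofCoeffs_add, mul_add, hp, hq]
      | monomial k p =>
        rw [C_mul_monomial, ofCoeffs_monomial, ofCoeffs_monomial, ← mul_assoc]
        simp only [fn, map_mul]
    | grade1 i =>
      intro f
      fin_cases i
      · have h : symbolAction (x : Weyl K) f = C X * f := by
          unfold symbolAction; rw [lift_x]; rfl
        exact (congrArg ofCoeffs h).trans (x_mul_ofCoeffs f).symm
      · exact (congrArg ofCoeffs (symbolAction_d f)).trans (d_mul_ofCoeffs f).symm
    | mul a b ha hb =>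
      intro f
      rw [map_mul, map_mul, Module.End.mul_apply, ha, hb, mul_assoc]
    | add a b ha hb =>
      intro f
      rw [map_add, map_add, LinearMap.add_apply, ofCoeffs_add, ha, hb, add_mul]
  obtain ⟨a, rfl⟩ := mk_surjective P
  have h := key a 1
  have e : ofCoeffs (1 : K[X][X]) = 1 := by
    rw [← monomial_zero_one, ofCoeffs_monomial]; simp [fn]
  rw [e, mul_one] at h
  exact h

/-- The coefficient `pₖ` of `P = ∑ₖ pₖ(x) ∂ᵏ`. -/
noncomputable def coeff (P : Weyl K) (k : ℕ) : K[X] := (symbol P).coeff k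

/-- The order of `P`: the largest `k` with `pₖ ≠ 0`. -/
noncomputable def ord (P : Weyl K) : ℕ := (symbol P).natDegree

/-- The degree of `P`: the maximum of the degrees of the `pₖ` as polynomials in `x`. -/
noncomputable def deg (P : Weyl K) : ℕ :=
  (Finset.range (ord P + 1)).sup fun k => (coeff P k).natDegree

/-! ### Operations on the Weyl algebra -/

/-- The Fourier-Laplace transform: the algebra isomorphism `x ↦ -∂`, `∂ ↦ x`. -/
noncomputable def laplace : Weyl K ≃ₐ[K] Weyl K :=
  AlgEquiv.ofAlgHom
    (lift (-d) x (by rw [mul_neg, neg_mul, d_mul_x]; abel))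
    (lift d (-x) (by rw [mul_neg, neg_mul, d_mul_x]; abel))
    (algHom_ext (by simp [lift_x, lift_d]) (by simp [lift_x, lift_d]))
    (algHom_ext (by simp [lift_x, lift_d]) (by simp [lift_x, lift_d]))

/-- The `e^{p(x)}`-twisting `Ade(p)`: the algebra map `x ↦ x`, `∂ ↦ ∂ - p'(x)`.
In particular `ade (-p) P = P(x, ∂ + p'(x))`. -/
noncomputable def ade (p : K[X]) : Weyl K →ₐ[K] Weyl K :=
  lift x (d - fn (derivative p)) (by
    have h : fn (derivative p) * x = x * fn (derivative p) := by
      have hx : (x : Weyl K) = fn X := by simp [fn]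
      rw [hx]; unfold fn; rw [← map_mul, ← map_mul, mul_comm]
    rw [sub_mul, mul_sub, d_mul_x, h]; abel)

/-- `P ∼ Q`: `Q = f(x) P` for a nonzero rational function `f = h / g`. -/
def Equivalent (P Q : Weyl K) : Prop :=
  ∃ g h : K[X], g ≠ 0 ∧ h ≠ 0 ∧ fn g * Q = fn h * P

/-- `Q` is a reduced representative `R P` of `P ≠ 0`: a nonzero element of
`K(x) P ∩ W[x]` of minimal degree.  (It is unique up to a nonzero constant factor.) -/
def IsReduced (P Q : Weyl K) : Prop :=
  Q ≠ 0 ∧ Equivalent P Q ∧ ∀ Q' : Weyl K, Q' ≠ 0 → Equivalent P Q' → deg Q ≤ deg Q'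

/-- A reduced representative exists. -/
theorem exists_isReduced (P : Weyl K) (hP : P ≠ 0) : ∃ Q, IsReduced P Q := by
  have hne : {Q : Weyl K | Q ≠ 0 ∧ Equivalent P Q}.Nonempty :=
    ⟨P, hP, 1, 1, one_ne_zero, one_ne_zero, rfl⟩
  refine ⟨Function.argminOn deg _ hne, (Function.argminOn_mem deg _ hne).1,
    (Function.argminOn_mem deg _ hne).2, fun Q' a b => ?_⟩
  exact Function.argminOn_le deg _ (show Q' ∈ {Q : Weyl K | Q ≠ 0 ∧ Equivalent P Q} from ⟨a, b⟩)

end Weyl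

end WeylAlgebra

/-! ## Semi-simple exponents -/

section LocalData

/-- A set of exponents `{[e₁]_{m₁}, …, [eₜ]_{mₜ}}`, where `[e]_m = {e, e + 1, …, e + m - 1}`. -/
structure Exponents (K : Type*) where
  len : ℕ
  exp : Fin len → K
  mult : Fin len → ℕ

namespace Exponents

variable {K : Type*} [Field K]

/-- The total multiplicity `m₁ + ⋯ + mₜ`. -/
def total (E : Exponents K) : ℕ := ∑ i, E.mult i

/-- Apply `f` to every `eᵢ`, keeping the multiplicities. -/
def map (f : K → K) (E : Exponents K) : Exponents K where
  len := E.len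
  exp := fun i => f (E.exp i)
  mult := E.mult

/-- The set `{[0]_{m₀}, [e₁]_{m₁}, …, [eₜ]_{mₜ}}`. -/
def consZero (m₀ : ℕ) (E : Exponents K) : Exponents K where
  len := E.len + 1
  exp := Fin.cons 0 E.exp
  mult := Fin.cons m₀ E.mult

/-- `eᵢ - eⱼ ∉ ℤ` for `i ≠ j`. -/
def NonIntegralDifferences (E : Exponents K) : Prop :=
  ∀ i j, i ≠ j → ∀ z : ℤ, E.exp i - E.exp j ≠ (z : K)

/-- The conditions on the sets `[μⁱ; mⁱ]` and `[νⁱʲ; nⁱʲ]` of a table of local data: positive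
multiplicities, and exponents that are neither integers nor differ by integers. -/
def IsGeneric (E : Exponents K) : Prop :=
  (∀ i, 0 < E.mult i) ∧ (∀ i, ∀ z : ℤ, E.exp i ≠ (z : K)) ∧ E.NonIntegralDifferences

end Exponents

namespace Weyl

variable {K : Type*} [Field K]

/-! ### Finite singular points -/

/-- With `n = ord P`, the polynomial `∑ₖ ν(ν-1)⋯(ν-k+1) (x-c)ⁿ⁻ᵏ pₖ(x)`.  Divided by the leading
coefficient `pₙ` it is the function `f_c(x, ν)` with `P (x-c)^ν = pₙ (x-c)^(ν-n) f_c(x, ν)`. -/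
noncomputable def indicial (P : Weyl K) (c ν : K) : K[X] :=
  ∑ k ∈ Finset.range (ord P + 1),
    C ((descPochhammer K k).eval ν) * (X - C c) ^ (ord P - k) * coeff P k

/-- `P` has (at most) a regular singularity at `x = c`: every `(x-c)ⁿ⁻ᵏ pₖ / pₙ` is holomorphic
at `c`. -/
def RegularAt (P : Weyl K) (c : K) : Prop :=
  ∀ k ≤ ord P, (X - C c) ^ rootMultiplicity c (coeff P (ord P)) ∣
    (X - C c) ^ (ord P - k) * coeff P k

/-- `P` has semi-simple exponents `{[μ₁]_{m₁}, …, [μₗ]_{mₗ}}`, `∑ mᵢ = ord P`, at the regular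
singular point `x = c`: the Taylor expansion `f_c(x, ν) = ∑ₖ fₖ(ν) (x-c)ᵏ` satisfies
`fₖ(μᵢ + j) = 0` for `0 ≤ j < mᵢ` and `0 ≤ k < mᵢ - j`.  Since `f_c = indicial / pₙ`, this says
that `indicial` is divisible by `(x-c)` to the power `mᵢ - j` plus the order of `pₙ` at `c`. -/
def HasExponentsAt (P : Weyl K) (c : K) (E : Exponents K) : Prop :=
  RegularAt P c ∧ E.total = ord P ∧ E.NonIntegralDifferences ∧
  ∀ i, ∀ j < E.mult i,
    (X - C c) ^ (rootMultiplicity c (coeff P (ord P)) + (E.mult i - j)) ∣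
      indicial P c (E.exp i + (j : K))

/-- `P` has no singular points in the finite plane other than the regular singular points
`c₁, …, cₚ`: in `∂ⁿ + ∑_{k<n} (pₖ/pₙ) ∂ᵏ`, every `∏ⱼ (x - cⱼ)ⁿ⁻ᵏ · pₖ/pₙ` is a polynomial. -/
def OnlySingularAt (P : Weyl K) {p : ℕ} (c : Fin p → K) : Prop :=
  ∀ k ≤ ord P, coeff P (ord P) ∣ (∏ j, (X - C (c j))) ^ (ord P - k) * coeff P k

/-! ### The point at infinity -/

/-- Write `P = ∑ₛ x^(ρ-s) Pₛ(∂)` with `ρ = deg P`; this is the coefficient of `∂ᵏ` in `Pₛ(∂)`,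
that is `Pₛ⁽ᵏ⁾(0) / k!`. -/
noncomputable def infCoeff (P : Weyl K) (s k : ℕ) : K :=
  if s ≤ deg P then (coeff P k).coeff (deg P - s) else 0

/-- The polynomial function
`pₖ(lam, 0) = ∑_{i ≤ k} (lam + i + 1)_{k-i} Pᵢ⁽ᵏ⁻ⁱ⁾(0) / (k-i)!`, with the rising factorial
`(a)_l = a(a+1)⋯(a+l-1)`.  It is the coefficient of `x^(lam+ρ)` in `P x^(lam+k)`. -/
noncomputable def infPoly (P : Weyl K) (k : ℕ) (lam : K) : K :=
  ∑ i ∈ Finset.range (k + 1),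
    (ascPochhammer K (k - i)).eval (lam + (i : K) + 1) * infCoeff P i (k - i)

/-- `P` has semi-simple exponents `{[μ₁]_{m₁}, …, [μₗ]_{mₗ}}` at `x = ∞`: with `m = ∑ mᵢ`,
`Pᵢ⁽ʲ⁾(0) = 0` for `i + j < m`, `P₀⁽ᵐ⁾(0) ≠ 0`, the `μᵢ` do not differ by integers, and
`pₖ(-μᵢ - j - k, 0) = 0` for `0 ≤ j < mᵢ` and `m ≤ k < m + mᵢ - j`. -/
def HasExponentsAtInfinity (P : Weyl K) (E : Exponents K) : Prop :=
  (∀ i j, i + j < E.total → infCoeff P i j = 0) ∧ infCoeff P 0 E.total ≠ 0 ∧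
  E.NonIntegralDifferences ∧
  ∀ i, ∀ j < E.mult i, ∀ k, E.total ≤ k → k < E.total + (E.mult i - j) →
    infPoly P k (-E.exp i - (j : K) - (k : K)) = 0

/-- `P` has `e^{p(x)}`-twisted semi-simple exponents `E` at `x = ∞`: the operator
`P(x, ∂ + p'(x))` has semi-simple exponents `E` there. -/
def HasTwistedExponents (P : Weyl K) (p : K[X]) (E : Exponents K) : Prop :=
  HasExponentsAtInfinity (ade (-p) P) E

/-- The rank of irregularity of `P` at infinity is at most `2`: for
`(xⁿ/pₙ) P = xⁿ∂ⁿ + ∑ᵢ aᵢ(x) xⁿ⁻ⁱ∂ⁿ⁻ⁱ` and `mᵢ = deg aᵢ`, one has `mᵢ / i ≤ 2` for all `i`. -/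
def IrregularRankLeTwo (P : Weyl K) : Prop :=
  ∀ i, 1 ≤ i → i ≤ ord P → coeff P (ord P - i) ≠ 0 →
    (i : ℤ) + (coeff P (ord P - i)).natDegree - (coeff P (ord P)).natDegree ≤ 2 * i

/-- The quadrant `{x ≤ a, y ≥ b}`. -/
def quadrant (a b : ℝ) : Set (ℝ × ℝ) := {q | q.1 ≤ a ∧ b ≤ q.2}

/-- The Newton polygon of `P` at infinity: the convex hull of the quadrants with corners
`(i, i - deg pᵢ)` for `pᵢ ≠ 0`. -/
noncomputable def newtonPolygon (P : Weyl K) : Set (ℝ × ℝ) :=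
  convexHull ℝ (⋃ i ∈ {i : ℕ | coeff P i ≠ 0},
    quadrant (i : ℝ) ((i : ℝ) - ((coeff P i).natDegree : ℝ)))

/-- The vertices of the Newton polygon are `(0, v)`, `(a, v)`, `(a + b, v + b)` and
`(a + b + c, v + b + 2c)`: its edges have slopes `0`, `1`, `2` and lengths `a`, `b`, `c`
(a length may be zero). -/
def NewtonSlopes (P : Weyl K) (a b c : ℕ) : Prop :=
  ∃ v : ℝ, newtonPolygon P = convexHull ℝ
    (quadrant 0 v ∪ quadrant a v ∪ quadrant (a + b) (v + b) ∪
      quadrant (a + b + c) (v + b + 2 * c))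

end Weyl

/-! ## Tables of local data -/

/-- A list of points of `ℂ`, each with a set of exponents. -/
structure Rows (K : Type*) where
  len : ℕ
  pt : Fin len → ℂ
  exps : Fin len → Exponents K

namespace Rows

variable {K : Type*} [Field K]

/-- The sum of the multiplicities of all exponents. -/
def total (R : Rows K) : ℕ := ∑ j, (R.exps j).total

/-- Apply `f` to the points and `g` to the exponents. -/
def map (f : ℂ → ℂ) (g : K → K) (R : Rows K) : Rows K where
  len := R.len
  pt := fun j => f (R.pt j)
  exps := fun j => (R.exps j).map g

end Rows

/-- The entries of a table of local data: the finite singular points `cᵢ` with the sets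
`[μⁱ; mⁱ]`, and for each of the `r` columns `αᵢ` the points `βⁱⱼ` with the sets `[νⁱʲ; nⁱʲ]`. -/
structure LocalTable (K : Type*) (r : ℕ) where
  reg : Rows K
  α : Fin r → ℂ
  col : Fin r → Rows K

namespace LocalTable

variable {K : Type*} [Field K] {r : ℕ}

/-- Replace every `αᵢ` by `αᵢ - a`. -/
noncomputable def subAlpha (a : ℂ) (T : LocalTable K r) : LocalTable K r where
  reg := T.reg
  α := fun i => T.α i - a
  col := T.col

/-- The table obtained from `T` (with `α_{i₀} = 0`) by exchanging the finite singular points with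
the column `i₀`: the new finite points are the `β^{i₀}_j` with exponents `ν - 1`; the column `i₀`
has `α = 0`, points `-cᵢ` and exponents `μ + 1`; a column `i ≠ i₀` has `-1/αᵢ`, points
`βⁱⱼ / αᵢ` and unchanged exponents. -/
noncomputable def laplace (T : LocalTable K r) (i₀ : Fin r) : LocalTable K r where
  reg := (T.col i₀).map id (fun ν => ν - 1)
  α := fun i => if i = i₀ then 0 else -1 / T.α i
  col := fun i =>
    if i = i₀ then T.reg.map (fun c => -c) (fun μ => μ + 1)
    else (T.col i).map (fun β => β / T.α i) id

end LocalTable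

/-- The polynomial `(α/2) x² + β x`. -/
noncomputable def quadraticPoly (K : Type*) [Field K] [Algebra ℂ K] (α β : ℂ) : K[X] :=
  C (algebraMap ℂ K (α / 2)) * X ^ 2 + C (algebraMap ℂ K β) * X

/-- `P` is normal at infinity with respect to the `αᵢ`, `βⁱⱼ` and the numbers
`nᵢ = ∑ⱼ nⁱⱼ`, `nⁱⱼ` of the table: the Newton polygon of `P(x, ∂ + αᵢ x)` has slope `2` with length
`n - nᵢ` and below it only slopes `0` and `1`, of total length `nᵢ`; the Newton polygon of
`P(x, ∂ + αᵢ x + βⁱⱼ)` has slopes `0`, `1`, `2` with lengths `nⁱⱼ`, `nᵢ - nⁱⱼ`, `n - nᵢ`. -/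
def NormalAtInfinity {K : Type*} [Field K] [Algebra ℂ K] {r : ℕ} (P : Weyl K)
    (T : LocalTable K r) : Prop :=
  (∀ i, ∃ a ≤ (T.col i).total,
    Weyl.NewtonSlopes (Weyl.ade (-quadraticPoly K (T.α i) 0) P)
      a ((T.col i).total - a) (Weyl.ord P - (T.col i).total)) ∧
  ∀ i j, Weyl.NewtonSlopes (Weyl.ade (-quadraticPoly K (T.α i) ((T.col i).pt j)) P)
    ((T.col i).exps j).total ((T.col i).total - ((T.col i).exps j).total)
    (Weyl.ord P - (T.col i).total)

/-- `T` is the table of local data of `P`. -/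
structure HasTable {K : Type*} [Field K] [Algebra ℂ K] {r : ℕ} (P : Weyl K)
    (T : LocalTable K r) : Prop where
  ne_zero : P ≠ 0
  c_injective : Function.Injective T.reg.pt
  α_injective : Function.Injective T.α
  β_injective : ∀ i, Function.Injective (T.col i).pt
  /-- the finite singular points are regular and among the `cᵢ` -/
  only_singular : Weyl.OnlySingularAt P fun i => algebraMap ℂ K (T.reg.pt i)
  irregular_rank : Weyl.IrregularRankLeTwo P
  normal : NormalAtInfinity P T
  reg_generic : ∀ i, (T.reg.exps i).IsGeneric
  reg_total : ∀ i, (T.reg.exps i).total ≤ Weyl.ord P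
  /-- exponents `{[0]_{m₀}, [μ₁]_{m₁}, …}` at `cᵢ`, with `m₀ = n - m₁ - ⋯` -/
  reg_exps : ∀ i, Weyl.HasExponentsAt P (algebraMap ℂ K (T.reg.pt i))
    ((T.reg.exps i).consZero (Weyl.ord P - (T.reg.exps i).total))
  inf_generic : ∀ i j, ((T.col i).exps j).IsGeneric
  /-- `e^{αᵢ x²/2 + βⁱⱼ x}`-twisted exponents `[νⁱʲ; nⁱʲ]` at infinity -/
  inf_exps : ∀ i j, Weyl.HasTwistedExponents P (quadraticPoly K (T.α i) ((T.col i).pt j))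
    ((T.col i).exps j)
  inf_total : ∑ i, (T.col i).total = Weyl.ord P

end LocalData

/-!
The theorem is a statement about three kinds of data of an operator `P = ∑ cₐᵦ xᵃ ∂ᵇ`: the weights
`u a + v b` occurring in its support, the coefficients at the corners of the support, and its action
on powers of `x`.

*Weights.* `filt u v t` consists of the operators all of whose monomials have weight at most `t`. For
`u + v ≥ 0` this is a multiplicative filtration, so an algebra map respects such filtrations as soon
as it does so on the generators (`map_mem_filt`), and it preserves coefficients of top weight if it
changes the generators by lower terms only (`cf_map_eq`). The Fourier-Laplace transform exchanges `u`
and `v`, and on coefficients of top weight it is `xᵃ ∂ᵇ ↦ (-1)ᵃ xᵇ ∂ᵃ` (`cf_laplace`). A Newton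
polygon with slopes `0`, `1`, `2` amounts to bounds for the weights `(1, 0)`, `(0, 1)`, `(1, -1)`,
`(1, 1)` together with three nonzero corners (`newtonSlopes_iff`).

*Powers.* Let `phi ν n P` be the coefficient of `x^(ν+n)` in `P x^ν`. Both kinds of semi-simple
exponents say that some of these coefficients vanish (`hasExponentsAt_zero_iff`,
`hasExponentsAtInfinity_iff`). For `ν ∉ ℤ` the transform is intertwined with
`x^(ν+n) ↦ cₙ x^(-ν-1-n)`, `cₙ ≠ 0`, hence `phi (-ν-1) (-n) (laplace P) = 0` if and only if
`phi ν n P = 0` (`phi_laplace_eq_zero_iff`). This exchanges exponents at finite points and at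
infinity, with the shift by `1`. Exponents at a finite point are invariant under twisting, as the
operators mapping `x^e K[x]` into `x^(e+m+l) K[x, 1/x]` form a bimodule over `K[x]`, and by Taylor's
formula for `P(x, ∂ - p')` such bimodules are stable under twisting (`ade_mem_of_bimodule`).

For the first claim this invariance suffices. For the second, tables do not change under left
multiplication by functions (`hasTable_fn_mul`), so `P` may be replaced by its reduced representative
`Q`. As `Q` is primitive, its leading coefficient vanishes at `cᵢ` to the order `∑ⱼ mⁱⱼ` exactly
and nowhere else (`rootMultiplicity_eq_total`, `natDegree_coeff_ord`), and the corner of the Newton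
polygon where slope `2` begins gives `deg Q`, the order of the transform. The column with `α = 0` and
the finite points are exchanged by the comparison above. For a column with `α ≠ 0` the twisted
transform of `Q` arises from the twisted `Q` by a map `x ↦ x + a ∂ + b`, `∂ ↦ ∂` and a dilation
(`ade_laplace_quadraticPoly`); the former is conjugate by the transform to a twisting, so it
preserves exponents at infinity.
-/

namespace Weyl

variable {K : Type*} [Field K]

/-! ### Coefficients of the normal form -/

theorem symbol_mul (P Q : Weyl K) : symbol (P * Q) = symbolAction P (symbol Q) := by
  unfold symbol; rw [map_mul, Module.End.mul_apply]

/-- The coefficient of `xᵃ ∂ᵇ` in the normal form of an operator, as a linear functional. -/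
noncomputable def cf (a b : ℕ) : Weyl K →ₗ[K] K where
  toFun P := (coeff P b).coeff a
  map_add' P Q := by simp [coeff, symbol]
  map_smul' r P := by simp [coeff, symbol]

theorem cf_apply (a b : ℕ) (P : Weyl K) : cf a b P = (coeff P b).coeff a := rfl

theorem coeff_fn_mul (h : K[X]) (P : Weyl K) (k : ℕ) : coeff (fn h * P) k = h * coeff P k := by
  unfold coeff; rw [symbol_mul, symbolAction_fn, coeff_C_mul]

theorem fn_add (p q : K[X]) : fn (p + q) = fn p + fn q := map_add _ _ _

theorem fn_mul (p q : K[X]) : fn (p * q) = fn p * fn q := map_mul _ _ _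

theorem fn_one : fn (1 : K[X]) = 1 := map_one _

theorem fn_C (r : K) : fn (C r) = algebraMap K (Weyl K) r := aeval_C _ _

theorem fn_X : fn (X : K[X]) = x := aeval_X _

theorem fn_X_pow (a : ℕ) : fn (X ^ a : K[X]) = x ^ a := by simp [fn]

theorem fn_monomial (a : ℕ) (r : K) : fn (monomial a r) = r • x ^ a := by
  rw [← C_mul_X_pow_eq_monomial, fn_mul, fn_C, fn_X_pow, Algebra.smul_def]

theorem coeff_fn_mul_d_pow (p : K[X]) (b k : ℕ) :
    coeff (fn p * d ^ b) k = if b = k then p else 0 := by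
  rw [← ofCoeffs_monomial, coeff, symbol_ofCoeffs, coeff_monomial]

theorem cf_monomial (a b a' b' : ℕ) :
    cf a b (x ^ a' * d ^ b' : Weyl K) = if a' = a ∧ b' = b then 1 else 0 := by
  rw [cf_apply, ← fn_X_pow, coeff_fn_mul_d_pow]
  by_cases h : b' = b
  · simp [h, coeff_X_pow, eq_comm]
  · simp [h]

theorem eq_sum (P : Weyl K) : P = ∑ b ∈ (symbol P).support, fn (coeff P b) * d ^ b :=
  (ofCoeffs_symbol P).symm

theorem fn_eq_sum (p : K[X]) : fn p = ∑ a ∈ p.support, p.coeff a • (x : Weyl K) ^ a := by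
  conv_lhs => rw [p.as_sum_support]
  unfold fn
  rw [map_sum]
  exact Finset.sum_congr rfl fun a _ => fn_monomial a _

/-- An operator is the combination of the monomials `xᵃ ∂ᵇ` with nonzero coefficient. -/
theorem mem_of_monomials (N : Submodule K (Weyl K)) (P : Weyl K)
    (h : ∀ a b, cf a b P ≠ 0 → (x : Weyl K) ^ a * d ^ b ∈ N) : P ∈ N := by
  rw [eq_sum P]
  refine N.sum_mem fun b _ => ?_
  rw [fn_eq_sum, Finset.sum_mul]
  refine N.sum_mem fun a ha => ?_
  rw [smul_mul_assoc]
  exact N.smul_mem _ (h a b (mem_support_iff.1 ha))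

/-- Induction on the left multiplication by the generators. -/
theorem induction_mul_left {p : Weyl K → Prop} (P : Weyl K) (one : p 1)
    (add : ∀ P Q, p P → p Q → p (P + Q)) (smul : ∀ (r : K) P, p P → p (r • P))
    (x_mul : ∀ P, p P → p (x * P)) (d_mul : ∀ P, p P → p (d * P)) : p P := by
  let N : Submodule K (Weyl K) :=
    { carrier := {P | p P}
      add_mem' := fun hP hQ => add _ _ hP hQ
      zero_mem' := by simpa using smul 0 1 one
      smul_mem' := fun r P hP => smul r P hP }
  refine mem_of_monomials N P fun a b h0 => ?_
  clear h0
  have hd : p (d ^ b) := by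
    induction b with
    | zero => simpa using one
    | succ b ih => rw [pow_succ']; exact d_mul _ ih
  change p _
  induction a with
  | zero => simpa using hd
  | succ a ih => rw [pow_succ', mul_assoc]; exact x_mul _ ih

theorem coeff_eq_zero_of_ord_lt {P : Weyl K} {k : ℕ} (h : ord P < k) : coeff P k = 0 :=
  coeff_eq_zero_of_natDegree_lt h

theorem symbol_ne_zero {P : Weyl K} (h : P ≠ 0) : symbol P ≠ 0 := by
  intro h0
  apply h
  rw [← ofCoeffs_symbol P, h0]
  simp [ofCoeffs]

theorem coeff_ord_ne_zero {P : Weyl K} (h : P ≠ 0) : coeff P (ord P) ≠ 0 := by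
  unfold coeff ord
  rw [coeff_natDegree]
  exact leadingCoeff_ne_zero.2 (symbol_ne_zero h)

theorem le_ord {P : Weyl K} {k : ℕ} (h : coeff P k ≠ 0) : k ≤ ord P := le_natDegree_of_ne_zero h

theorem ord_eq {P : Weyl K} {n : ℕ} (h : coeff P n ≠ 0) (h' : ∀ k, coeff P k ≠ 0 → k ≤ n) :
    ord P = n := by
  have hP : P ≠ 0 := by
    rintro rfl
    simp [coeff, symbol] at h
  exact le_antisymm (h' _ (coeff_ord_ne_zero hP)) (le_ord h)

theorem natDegree_coeff_le_deg (P : Weyl K) (k : ℕ) : (coeff P k).natDegree ≤ deg P := by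
  by_cases hk : k ≤ ord P
  · exact Finset.le_sup (f := fun k => (coeff P k).natDegree) (Finset.mem_range_succ_iff.2 hk)
  · rw [coeff_eq_zero_of_ord_lt (not_le.1 hk)]; simp

theorem deg_eq {P : Weyl K} {D : ℕ} (h : ∃ k, cf D k P ≠ 0)
    (h' : ∀ k, (coeff P k).natDegree ≤ D) : deg P = D := by
  obtain ⟨k, hk⟩ := h
  refine le_antisymm (Finset.sup_le fun k _ => h' k) ?_
  exact (le_natDegree_of_ne_zero hk).trans (natDegree_coeff_le_deg P k)

theorem fn_mul_ne_zero {h : K[X]} {P : Weyl K} (hh : h ≠ 0) (hP : P ≠ 0) : fn h * P ≠ 0 := by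
  intro h0
  have := coeff_fn_mul h P (ord P)
  rw [h0] at this
  have h1 : coeff (0 : Weyl K) (ord P) = 0 := by simp [coeff, symbol]
  rw [h1] at this
  exact mul_ne_zero hh (coeff_ord_ne_zero hP) this.symm

theorem ord_fn_mul {h : K[X]} (hh : h ≠ 0) (P : Weyl K) : ord (fn h * P) = ord P := by
  unfold ord
  rw [symbol_mul, symbolAction_fn, natDegree_C_mul hh]

theorem ne_zero_of_cf {P : Weyl K} {a b : ℕ} (h : cf a b P ≠ 0) : P ≠ 0 := by
  rintro rfl; simp at h

theorem coeff_ne_zero_of_cf {P : Weyl K} {a b : ℕ} (h : cf a b P ≠ 0) : coeff P b ≠ 0 := by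
  intro h0; rw [cf_apply, h0] at h; simp at h

theorem le_natDegree_coeff {P : Weyl K} {a b : ℕ} (h : cf a b P ≠ 0) :
    a ≤ (coeff P b).natDegree := le_natDegree_of_ne_zero h

/-! ### Weight filtrations -/

/-- The operators all of whose monomials `xᵃ ∂ᵇ` have weight `u a + v b ≤ t`. -/
def filt (u v t : ℤ) : Submodule K (Weyl K) where
  carrier := {P | ∀ a b : ℕ, cf a b P ≠ 0 → u * a + v * b ≤ t}
  add_mem' := by
    intro P Q hP hQ a b hab
    by_cases h : cf a b P = 0
    · refine hQ a b fun h' => hab ?_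
      rw [map_add, h, h', add_zero]
    · exact hP a b h
  zero_mem' := by intro a b h; simp at h
  smul_mem' := by
    intro r P hP a b hab
    refine hP a b fun h' => hab ?_
    rw [map_smul, h', smul_zero]

theorem mem_filt {u v t : ℤ} {P : Weyl K} :
    P ∈ filt u v t ↔ ∀ a b : ℕ, cf a b P ≠ 0 → u * a + v * b ≤ t := Iff.rfl

theorem cf_eq_zero {u v t : ℤ} {P : Weyl K} (hP : P ∈ filt u v t) {a b : ℕ}
    (h : t < u * a + v * b) : cf a b P = 0 := by
  by_contra h'
  exact absurd (hP a b h') (not_le.2 h)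

theorem filt_mono {u v s t : ℤ} (h : s ≤ t) {P : Weyl K} (hP : P ∈ filt u v s) :
    P ∈ filt u v t := fun a b hab => (hP a b hab).trans h

theorem monomial_mem_filt {u v t : ℤ} {a b : ℕ} (h : u * a + v * b ≤ t) :
    (x : Weyl K) ^ a * d ^ b ∈ filt u v t := by
  intro a' b' hab
  rw [cf_monomial] at hab
  split_ifs at hab with h'
  · rw [← h'.1, ← h'.2]; exact h
  · exact absurd rfl hab

theorem x_mem_filt {u v t : ℤ} (h : u ≤ t) : (x : Weyl K) ∈ filt u v t := by
  simpa using monomial_mem_filt (K := K) (u := u) (v := v) (t := t) (a := 1) (b := 0) (by simpa)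

theorem d_mem_filt {u v t : ℤ} (h : v ≤ t) : (d : Weyl K) ∈ filt u v t := by
  simpa using monomial_mem_filt (K := K) (u := u) (v := v) (t := t) (a := 0) (b := 1) (by simpa)

theorem one_mem_filt {u v t : ℤ} (h : 0 ≤ t) : (1 : Weyl K) ∈ filt u v t := by
  simpa using monomial_mem_filt (K := K) (u := u) (v := v) (t := t) (a := 0) (b := 0) (by simpa)

theorem algebraMap_mem_filt {u v t : ℤ} (h : 0 ≤ t) (r : K) :
    algebraMap K (Weyl K) r ∈ filt u v t := by
  rw [Algebra.algebraMap_eq_smul_one]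
  exact Submodule.smul_mem _ _ (one_mem_filt h)

/-- A submodule that contains the monomials of weight at most `t` contains `filt u v t`. -/
theorem filt_le {u v t : ℤ} {N : Submodule K (Weyl K)}
    (h : ∀ a b : ℕ, u * a + v * b ≤ t → (x : Weyl K) ^ a * d ^ b ∈ N) : filt u v t ≤ N :=
  fun P hP => mem_of_monomials N P fun a b hab => h a b (hP a b hab)

theorem x_mul_mem_filt {u v t : ℤ} {P : Weyl K} (hP : P ∈ filt u v t) :
    x * P ∈ filt u v (u + t) := by
  have : filt u v t ≤ (filt u v (u + t)).comap (LinearMap.mulLeft K (x : Weyl K)) := by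
    refine filt_le fun a b h => ?_
    rw [Submodule.mem_comap, LinearMap.mulLeft_apply, ← mul_assoc, ← pow_succ']
    apply monomial_mem_filt
    push_cast; linarith
  exact this hP

theorem d_mul_x_pow (a : ℕ) :
    (d : Weyl K) * x ^ a = x ^ a * d + (a : K) • x ^ (a - 1) := by
  rw [← fn_X_pow, d_mul_fn, derivative_X_pow, fn_mul, fn_C, fn_X_pow, fn_X_pow,
    Algebra.smul_def]

theorem d_mul_mem_filt {u v t : ℤ} (huv : 0 ≤ u + v) {P : Weyl K} (hP : P ∈ filt u v t) :
    d * P ∈ filt u v (v + t) := by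
  have : filt u v t ≤ (filt u v (v + t)).comap (LinearMap.mulLeft K (d : Weyl K)) := by
    refine filt_le fun a b h => ?_
    rw [Submodule.mem_comap, LinearMap.mulLeft_apply, ← mul_assoc, d_mul_x_pow, add_mul,
      mul_assoc, ← pow_succ', smul_mul_assoc]
    refine Submodule.add_mem _ (monomial_mem_filt (by push_cast; linarith)) ?_
    rcases Nat.eq_zero_or_pos a with rfl | ha
    · simp
    · refine Submodule.smul_mem _ _ (monomial_mem_filt ?_)
      rw [Nat.cast_sub ha]
      push_cast; linarith
  exact this hP

theorem mul_mem_filt {u v s t : ℤ} (huv : 0 ≤ u + v) {P Q : Weyl K} (hP : P ∈ filt u v s)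
    (hQ : Q ∈ filt u v t) : P * Q ∈ filt u v (s + t) := by
  have : filt u v s ≤ (filt u v (s + t)).comap (LinearMap.mulRight K Q) := by
    refine filt_le fun a b h => ?_
    rw [Submodule.mem_comap, LinearMap.mulRight_apply]
    have hd : d ^ b * Q ∈ filt u v (v * b + t) := by
      clear h
      induction b with
      | zero => simpa using hQ
      | succ b ih =>
        rw [pow_succ', mul_assoc]
        exact filt_mono (by push_cast; linarith) (d_mul_mem_filt huv ih)
    have hx : x ^ a * (d ^ b * Q) ∈ filt u v (u * a + (v * b + t)) := by
      clear h
      induction a with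
      | zero => simpa using hd
      | succ a ih =>
        rw [pow_succ', mul_assoc]
        exact filt_mono (by push_cast; linarith) (x_mul_mem_filt ih)
    rw [mul_assoc]
    exact filt_mono (by linarith) hx
  exact this hP

theorem pow_mem_filt {u v s : ℤ} (huv : 0 ≤ u + v) {P : Weyl K} (hP : P ∈ filt u v s) (k : ℕ) :
    P ^ k ∈ filt u v (s * k) := by
  induction k with
  | zero => simpa using one_mem_filt le_rfl
  | succ k ih =>
    rw [pow_succ]
    exact filt_mono (by push_cast; linarith) (mul_mem_filt huv ih hP)

/-- An algebra map whose values on the generators have the right weights respects the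
filtrations. -/
theorem map_mem_filt {u v u' v' t : ℤ} (huv : 0 ≤ u' + v') (σ : Weyl K →ₐ[K] Weyl K)
    (hx : σ x ∈ filt u' v' u) (hd : σ d ∈ filt u' v' v) {P : Weyl K} (hP : P ∈ filt u v t) :
    σ P ∈ filt u' v' t := by
  have : filt u v t ≤ (filt u' v' t).comap σ.toLinearMap := by
    refine filt_le fun a b h => ?_
    rw [Submodule.mem_comap, AlgHom.toLinearMap_apply, map_mul, map_pow, map_pow]
    exact filt_mono h (mul_mem_filt huv (pow_mem_filt huv hx a) (pow_mem_filt huv hd b))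
  exact this hP

/-- If an algebra map changes the generators by terms of lower weight, then it changes every
operator by terms of lower weight. -/
theorem map_sub_mem_filt {u v t : ℤ} (huv : 0 ≤ u + v) (σ : Weyl K →ₐ[K] Weyl K)
    (hx : σ x - x ∈ filt u v (u - 1)) (hd : σ d - d ∈ filt u v (v - 1)) {P : Weyl K}
    (hP : P ∈ filt u v t) : σ P - P ∈ filt u v (t - 1) := by
  have hmul : ∀ {s t : ℤ} {A B : Weyl K}, A ∈ filt u v s → B ∈ filt u v t →
      σ A - A ∈ filt u v (s - 1) → σ B - B ∈ filt u v (t - 1) →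
      σ (A * B) - A * B ∈ filt u v (s + t - 1) := by
    intro s t A B hA hB hA' hB'
    have e : σ (A * B) - A * B = (σ A - A) * (σ B - B) + (σ A - A) * B + A * (σ B - B) := by
      rw [map_mul]; noncomm_ring
    rw [e]
    refine Submodule.add_mem _ (Submodule.add_mem _ ?_ ?_) ?_
    · exact filt_mono (by linarith) (mul_mem_filt huv hA' hB')
    · exact filt_mono (by linarith) (mul_mem_filt huv hA' hB)
    · exact filt_mono (by linarith) (mul_mem_filt huv hA hB')
  have hpow : ∀ {s : ℤ} {A : Weyl K}, A ∈ filt u v s → σ A - A ∈ filt u v (s - 1) → ∀ k : ℕ,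
      σ (A ^ k) - A ^ k ∈ filt u v (s * k - 1) := by
    intro s A hA hA' k
    induction k with
    | zero => simp
    | succ k ih =>
      rw [pow_succ]
      exact filt_mono (by push_cast; linarith) (hmul (pow_mem_filt huv hA k) hA ih hA')
  have : filt u v t ≤ (filt u v (t - 1)).comap (σ.toLinearMap - LinearMap.id) := by
    refine filt_le fun a b h => ?_
    rw [Submodule.mem_comap, LinearMap.sub_apply, AlgHom.toLinearMap_apply, LinearMap.id_apply]
    have hxa := x_mem_filt (K := K) (v := v) (le_refl u)
    have hdb := d_mem_filt (K := K) (u := u) (le_refl v)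
    exact filt_mono (by linarith) (hmul (pow_mem_filt huv hxa a) (pow_mem_filt huv hdb b)
      (hpow hxa hx a) (hpow hdb hd b))
  exact this hP

/-- Coefficients of top weight are unchanged under such an algebra map. -/
theorem cf_map_eq {u v t : ℤ} (huv : 0 ≤ u + v) (σ : Weyl K →ₐ[K] Weyl K)
    (hx : σ x - x ∈ filt u v (u - 1)) (hd : σ d - d ∈ filt u v (v - 1)) {P : Weyl K}
    (hP : P ∈ filt u v t) {a b : ℕ} (hab : t ≤ u * a + v * b) : cf a b (σ P) = cf a b P := by
  have h := cf_eq_zero (map_sub_mem_filt huv σ hx hd hP) (a := a) (b := b) (by linarith)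
  rwa [map_sub, sub_eq_zero] at h

theorem natDegree_coeff_le_of_filt {t : ℤ} {v : ℤ} {P : Weyl K} (hP : P ∈ filt 1 v t) {b D : ℕ}
    (h : t ≤ D + v * b) : (coeff P b).natDegree ≤ D := by
  rw [natDegree_le_iff_coeff_eq_zero]
  intro a ha
  exact cf_eq_zero hP (a := a) (b := b) (by omega)

theorem mem_filt_ord {P : Weyl K} : P ∈ filt 0 1 (ord P) := by
  intro a b h
  have := le_ord (coeff_ne_zero_of_cf h)
  omega

theorem mem_filt_deg {P : Weyl K} : P ∈ filt 1 0 (deg P) := by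
  intro a b h
  have := (le_natDegree_of_ne_zero h).trans (natDegree_coeff_le_deg P b)
  omega

theorem ord_eq_of_filt {P : Weyl K} {n a : ℕ} (hP : P ∈ filt 0 1 n) (h : cf a n P ≠ 0) :
    ord P = n := by
  refine ord_eq (coeff_ne_zero_of_cf h) fun k hk => ?_
  obtain ⟨a, ha⟩ : ∃ a, (coeff P k).coeff a ≠ 0 := by
    by_contra! h'
    exact hk (by ext a; simpa using h' a)
  have := hP a k ha
  omega

theorem deg_eq_of_filt {P : Weyl K} {D b : ℕ} (hP : P ∈ filt 1 0 D) (h : cf D b P ≠ 0) :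
    deg P = D :=
  deg_eq ⟨b, h⟩ fun _ => natDegree_coeff_le_of_filt hP (by simp)

/-! ### Automorphisms of the Weyl algebra -/

theorem commute_x_fn (p : K[X]) : (x : Weyl K) * fn p = fn p * x := by
  rw [← fn_X, ← fn_mul, ← fn_mul, mul_comm]

/-- The translation `x ↦ x + c`, `∂ ↦ ∂`. -/
noncomputable def translate (c : K) : Weyl K →ₐ[K] Weyl K :=
  lift (x + algebraMap K _ c) d (by
    rw [mul_add, add_mul, d_mul_x, Algebra.commutes c (d : Weyl K)]; abel)

/-- The dilation `x ↦ a⁻¹ x`, `∂ ↦ a ∂`. -/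
noncomputable def dilate (a : Kˣ) : Weyl K →ₐ[K] Weyl K :=
  lift ((a⁻¹ : K) • x) ((a : K) • d) (by
    simp only [smul_mul_smul_comm, d_mul_x, smul_add]; simp)

theorem translate_x (c : K) : translate c (x : Weyl K) = x + algebraMap K _ c := lift_x _ _ _

theorem translate_d (c : K) : translate c (d : Weyl K) = d := lift_d _ _ _

theorem dilate_x (a : Kˣ) : dilate a (x : Weyl K) = (a⁻¹ : K) • x := lift_x _ _ _

theorem dilate_d (a : Kˣ) : dilate a (d : Weyl K) = (a : K) • d := lift_d _ _ _

theorem ade_x (p : K[X]) : ade p (x : Weyl K) = x := lift_x _ _ _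

theorem ade_d (p : K[X]) : ade p (d : Weyl K) = d - fn (derivative p) := lift_d _ _ _

theorem laplace_x : laplace (x : Weyl K) = -d := lift_x _ _ _

theorem laplace_d : laplace (d : Weyl K) = x := lift_d _ _ _

theorem laplace_symm_x : laplace.symm (x : Weyl K) = d := lift_x _ _ _

theorem laplace_symm_d : laplace.symm (d : Weyl K) = -x := lift_d _ _ _

theorem algHom_fn {σ : Weyl K →ₐ[K] Weyl K} (p : K[X]) : σ (fn p) = aeval (σ x) p := by
  unfold fn; rw [aeval_algHom_apply]

theorem ade_fn (p q : K[X]) : ade p (fn q) = fn q := by rw [algHom_fn, ade_x]; rfl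

theorem translate_fn (c : K) (q : K[X]) : translate c (fn q) = fn (q.comp (X + C c)) := by
  rw [algHom_fn, translate_x, fn, aeval_comp]; simp

theorem ade_ade (p q : K[X]) (P : Weyl K) : ade p (ade q P) = ade (p + q) P := by
  rw [← AlgHom.comp_apply]
  congr 1
  apply algHom_ext
  · simp [ade_x]
  · simp [ade_d, ade_fn, fn_add]; abel

theorem ade_zero (P : Weyl K) : ade 0 P = P := by
  conv_rhs => rw [← AlgHom.id_apply (R := K) P]
  congr 1
  apply algHom_ext
  · simp [ade_x]
  · simp [ade_d, fn]

theorem translate_translate (a b : K) (P : Weyl K) :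
    translate a (translate b P) = translate (a + b) P := by
  rw [← AlgHom.comp_apply]
  congr 1
  apply algHom_ext
  · simp [translate_x, add_assoc]
  · simp [translate_d]

theorem translate_ade (c : K) (p : K[X]) (P : Weyl K) :
    translate c (ade p P) = ade (p.comp (X + C c)) (translate c P) := by
  rw [← AlgHom.comp_apply, ← AlgHom.comp_apply]
  congr 1
  apply algHom_ext
  · simp [ade_x, translate_x]
  · simp [ade_d, translate_d, translate_fn, derivative_comp]

theorem coeff_sum (s : Finset ℕ) (f : ℕ → Weyl K) (k : ℕ) :
    coeff (∑ b ∈ s, f b) k = ∑ b ∈ s, coeff (f b) k := by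
  ext a
  have := map_sum (cf (K := K) a k) f s
  simp only [cf_apply] at this
  rw [this, finsetSum_coeff]

theorem coeff_translate (c : K) (P : Weyl K) (k : ℕ) :
    coeff (translate c P) k = (coeff P k).comp (X + C c) := by
  conv_lhs => rw [eq_sum P]
  rw [map_sum]
  have h : ∀ b, translate c (fn (coeff P b) * d ^ b) = fn ((coeff P b).comp (X + C c)) * d ^ b := by
    intro b; rw [map_mul, map_pow, translate_d, translate_fn]
  simp only [h]
  rw [coeff_sum]
  simp only [coeff_fn_mul_d_pow, Finset.sum_ite_eq']
  split_ifs with hk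
  · rfl
  · have : coeff P k = 0 := notMem_support_iff.1 hk
    rw [this, zero_comp]

theorem comp_X_add_C_eq_zero_iff {p : K[X]} {c : K} : p.comp (X + C c) = 0 ↔ p = 0 := by
  rw [← taylor_apply]; simp

theorem ord_translate (c : K) (P : Weyl K) : ord (translate c P) = ord P := by
  by_cases hP : P = 0
  · rw [hP, map_zero]
  · refine ord_eq ?_ fun k hk => ?_
    · rw [coeff_translate]
      exact fun h => coeff_ord_ne_zero hP (comp_X_add_C_eq_zero_iff.1 h)
    · rw [coeff_translate] at hk
      exact le_ord fun h => hk (comp_X_add_C_eq_zero_iff.2 h)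

theorem translate_mem_filt {u v t : ℤ} (huv : 0 ≤ u + v) (hu : 0 ≤ u) (c : K) {P : Weyl K}
    (hP : P ∈ filt u v t) : translate c P ∈ filt u v t := by
  refine map_mem_filt huv _ ?_ ?_ hP
  · rw [translate_x]
    exact Submodule.add_mem _ (x_mem_filt le_rfl) (algebraMap_mem_filt hu c)
  · rw [translate_d]; exact d_mem_filt le_rfl

theorem cf_translate {u v t : ℤ} (huv : 0 ≤ u + v) (hu : 1 ≤ u) (c : K) {P : Weyl K}
    (hP : P ∈ filt u v t) {a b : ℕ} (hab : t ≤ u * a + v * b) :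
    cf a b (translate c P) = cf a b P := by
  refine cf_map_eq huv _ ?_ ?_ hP hab
  · rw [translate_x, add_sub_cancel_left]
    exact algebraMap_mem_filt (by linarith) c
  · rw [translate_d, sub_self]; exact Submodule.zero_mem _

theorem fn_mem_filt {u v t : ℤ} {q : K[X]} (h : ∀ a : ℕ, q.coeff a ≠ 0 → u * a ≤ t) :
    fn q ∈ filt u v t := by
  rw [fn_eq_sum]
  refine Submodule.sum_mem _ fun a ha => Submodule.smul_mem _ _ ?_
  have := monomial_mem_filt (K := K) (u := u) (v := v) (t := t) (a := a) (b := 0)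
    (by simpa using h a (mem_support_iff.1 ha))
  simpa using this

theorem ade_mem_filt {u v t : ℤ} (huv : 0 ≤ u + v) (q : K[X])
    (hq : ∀ a : ℕ, (derivative q).coeff a ≠ 0 → u * a ≤ v) {P : Weyl K}
    (hP : P ∈ filt u v t) : ade q P ∈ filt u v t := by
  refine map_mem_filt huv _ ?_ ?_ hP
  · rw [ade_x]; exact x_mem_filt le_rfl
  · rw [ade_d]; exact Submodule.sub_mem _ (d_mem_filt le_rfl) (fn_mem_filt hq)

theorem cf_ade {u v t : ℤ} (huv : 0 ≤ u + v) (q : K[X])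
    (hq : ∀ a : ℕ, (derivative q).coeff a ≠ 0 → u * a ≤ v - 1) {P : Weyl K}
    (hP : P ∈ filt u v t) {a b : ℕ} (hab : t ≤ u * a + v * b) :
    cf a b (ade q P) = cf a b P := by
  refine cf_map_eq huv _ ?_ ?_ hP hab
  · rw [ade_x, sub_self]; exact Submodule.zero_mem _
  · rw [ade_d, sub_sub_cancel_left]
    exact Submodule.neg_mem _ (fn_mem_filt hq)

theorem coeff_ade_ord (q : K[X]) (P : Weyl K) :
    coeff (ade q P) (ord P) = coeff P (ord P) := by
  ext a
  exact cf_ade (u := 0) (v := 1) (by simp) q (by simp) mem_filt_ord (by simp)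

theorem ord_ade (q : K[X]) (P : Weyl K) : ord (ade q P) = ord P := by
  by_cases hP : P = 0
  · rw [hP, map_zero]
  · have h := coeff_ord_ne_zero hP
    have : ∃ a, cf a (ord P) P ≠ 0 := by
      by_contra! h'
      exact h (by ext a; rw [coeff_zero]; exact h' a)
    obtain ⟨a, ha⟩ := this
    refine ord_eq_of_filt (a := a) (ade_mem_filt (by simp) q (by simp) mem_filt_ord) ?_
    rwa [cf_apply, coeff_ade_ord]

/-! ### The Fourier-Laplace transform and the weight filtrations -/

theorem laplace_mem_filt {u v t : ℤ} (huv : 0 ≤ u + v) {P : Weyl K} (hP : P ∈ filt u v t) :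
    laplace P ∈ filt v u t := by
  refine map_mem_filt (by linarith) (laplace : Weyl K ≃ₐ[K] Weyl K).toAlgHom ?_ ?_ hP
  · change laplace x ∈ _
    rw [laplace_x]; exact Submodule.neg_mem _ (d_mem_filt le_rfl)
  · change laplace d ∈ _
    rw [laplace_d]; exact x_mem_filt le_rfl

theorem d_pow_mul_x_pow_sub_mem_filt {u v : ℤ} (huv : 1 ≤ u + v) (m k : ℕ) :
    (d : Weyl K) ^ m * x ^ k - x ^ k * d ^ m ∈ filt u v (u * k + v * m - 1) := by
  induction m with
  | zero => simp
  | succ m ih =>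
    have e : (d : Weyl K) ^ (m + 1) * x ^ k - x ^ k * d ^ (m + 1)
        = d * (d ^ m * x ^ k - x ^ k * d ^ m) + (k : K) • (x ^ (k - 1) * d ^ m) := by
      rw [mul_sub, ← mul_assoc d (x ^ k), d_mul_x_pow, add_mul, smul_mul_assoc, pow_succ']
      noncomm_ring
    rw [e]
    refine Submodule.add_mem _ ?_ ?_
    · exact filt_mono (by push_cast; linarith) (d_mul_mem_filt (by linarith) ih)
    · rcases Nat.eq_zero_or_pos k with rfl | hk
      · simp
      · refine Submodule.smul_mem _ _ (monomial_mem_filt ?_)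
        rw [Nat.cast_sub hk]
        push_cast; linarith

/-- On coefficients of top weight the Fourier-Laplace transform is `xᵃ ∂ᵇ ↦ (-1)ᵃ xᵇ ∂ᵃ`. -/
theorem cf_laplace {u v t : ℤ} (huv : 1 ≤ u + v) {P : Weyl K} (hP : P ∈ filt u v t) {a b : ℕ}
    (hab : t ≤ u * a + v * b) : cf b a (laplace P) = (-1) ^ a * cf a b P := by
  have : filt u v t ≤ LinearMap.eqLocus
      ((cf (K := K) b a) ∘ₗ (laplace : Weyl K ≃ₐ[K] Weyl K).toLinearMap)
      ((-1 : K) ^ a • cf (K := K) a b) := by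
    refine filt_le fun a' b' h => ?_
    rw [LinearMap.mem_eqLocus, LinearMap.comp_apply, AlgEquiv.toLinearMap_apply, map_mul, map_pow,
      map_pow, laplace_x, laplace_d, LinearMap.smul_apply, cf_monomial, neg_pow, mul_assoc]
    have e : (-1 : Weyl K) ^ a' = algebraMap K _ ((-1) ^ a') := by simp
    rw [e, ← Algebra.smul_def, map_smul]
    have h1 := cf_eq_zero (a := b) (b := a)
      (d_pow_mul_x_pow_sub_mem_filt (K := K) (u := v) (v := u) (by linarith) a' b') (by linarith)
    rw [map_sub, sub_eq_zero] at h1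
    rw [h1, cf_monomial]
    by_cases hh : a' = a ∧ b' = b
    · simp [hh.1, hh.2]
    · rw [if_neg hh, if_neg (fun h => hh h.symm)]; simp
  simpa using this hP

theorem laplace_ade_linear (β : K) (P : Weyl K) :
    laplace (ade (-(C β * X)) P) = translate β (laplace P) := by
  have : (laplace : Weyl K ≃ₐ[K] Weyl K).toAlgHom.comp (ade (-(C β * X)))
      = (translate β).comp (laplace : Weyl K ≃ₐ[K] Weyl K).toAlgHom := by
    apply algHom_ext
    · change laplace (ade _ x) = translate β (laplace x)
      simp [ade_x, laplace_x, translate_d]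
    · change laplace (ade _ d) = translate β (laplace d)
      simp [ade_d, laplace_d, translate_x, fn]
  exact DFunLike.congr_fun this P

theorem ade_laplace (c : K) (P : Weyl K) :
    ade (C c * X) (laplace P) = laplace (translate c P) := by
  have : (ade (C c * X)).comp (laplace : Weyl K ≃ₐ[K] Weyl K).toAlgHom
      = (laplace : Weyl K ≃ₐ[K] Weyl K).toAlgHom.comp (translate c) := by
    apply algHom_ext
    · change ade _ (laplace x) = laplace (translate c x)
      simp [ade_d, laplace_x, translate_x, fn]
      abel
    · change ade _ (laplace d) = laplace (translate c d)
      simp [ade_x, laplace_d, translate_d]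
  exact DFunLike.congr_fun this P

/-- Conjugation of the twisting `ade p` by the Fourier-Laplace transform. -/
noncomputable def coAde (p : K[X]) : Weyl K →ₐ[K] Weyl K :=
  ((laplace : Weyl K ≃ₐ[K] Weyl K).toAlgHom.comp (ade p)).comp
    (laplace : Weyl K ≃ₐ[K] Weyl K).symm.toAlgHom

theorem coAde_apply (p : K[X]) (P : Weyl K) : coAde p P = laplace (ade p (laplace.symm P)) := rfl

theorem coAde_x (p : K[X]) : coAde p (x : Weyl K) = x - aeval (-d) (derivative p) := by
  rw [coAde_apply, laplace_symm_x, ade_d, map_sub, laplace_d]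
  have := algHom_fn (σ := (laplace : Weyl K ≃ₐ[K] Weyl K).toAlgHom) (derivative p)
  change laplace _ = aeval (laplace x) _ at this
  rw [this, laplace_x]

theorem coAde_d (p : K[X]) : coAde p (d : Weyl K) = d := by
  rw [coAde_apply, laplace_symm_d, map_neg, ade_x, map_neg, laplace_x, neg_neg]

theorem cf_dilate (a : Kˣ) (i j : ℕ) (P : Weyl K) :
    cf i j (dilate a P) = (a⁻¹ : K) ^ i * (a : K) ^ j * cf i j P := by
  have : P ∈ LinearMap.eqLocus ((cf (K := K) i j) ∘ₗ (dilate a).toLinearMap)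
      (((a⁻¹ : K) ^ i * (a : K) ^ j) • cf (K := K) i j) := by
    refine mem_of_monomials _ P fun i' j' _ => ?_
    rw [LinearMap.mem_eqLocus, LinearMap.comp_apply, AlgHom.toLinearMap_apply, map_mul, map_pow,
      map_pow, dilate_x, dilate_d, LinearMap.smul_apply, _root_.smul_pow, _root_.smul_pow, smul_mul_smul_comm,
      map_smul, cf_monomial]
    split_ifs with h
    · rw [h.1, h.2]
    · simp
  simpa using this

theorem cf_dilate_ne_zero {a : Kˣ} {i j : ℕ} {P : Weyl K} :
    cf i j (dilate a P) ≠ 0 ↔ cf i j P ≠ 0 := by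
  rw [cf_dilate]
  simp

theorem dilate_mem_filt {u v t : ℤ} {a : Kˣ} {P : Weyl K} (hP : P ∈ filt u v t) :
    dilate a P ∈ filt u v t := fun i j h => hP i j (cf_dilate_ne_zero.1 h)

/-! ### Stability of bimodules under twisting -/

/-- The iterated commutators `D₀ = id`, `(j + 1) Dⱼ₊₁(P) = [Dⱼ(P), x]`: the divided powers of the
formal derivation with respect to `∂`. -/
noncomputable def comm : ℕ → Weyl K → Weyl K
  | 0, P => P
  | j + 1, P => ((j : K) + 1)⁻¹ • (comm j P * x - x * comm j P)

/-- The polynomials `Hⱼ` with `(e^{-p})⁽ʲ⁾ = Hⱼ e^{-p}`. -/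
noncomputable def expPoly (p : K[X]) : ℕ → K[X]
  | 0 => 1
  | j + 1 => derivative (expPoly p j) - derivative p * expPoly p j

theorem comm_zero (P : Weyl K) : comm 0 P = P := rfl

theorem comm_add (j : ℕ) (P Q : Weyl K) : comm j (P + Q) = comm j P + comm j Q := by
  induction j with
  | zero => rfl
  | succ j ih => simp only [comm, ih, ← smul_add]; congr 1; noncomm_ring

theorem comm_smul (j : ℕ) (r : K) (P : Weyl K) : comm j (r • P) = r • comm j P := by
  induction j with
  | zero => rfl
  | succ j ih =>
    simp only [comm, ih, smul_mul_assoc, mul_smul_comm, ← smul_sub]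
    rw [smul_comm]

theorem comm_x_mul (j : ℕ) (P : Weyl K) : comm j (x * P) = x * comm j P := by
  induction j with
  | zero => rfl
  | succ j ih => simp only [comm, ih, mul_smul_comm]; congr 1; noncomm_ring

theorem comm_d_mul [CharZero K] (j : ℕ) (P : Weyl K) :
    comm (j + 1) (d * P) = d * comm (j + 1) P + comm j P := by
  have key : ∀ A : Weyl K, d * A * x - x * (d * A) = d * (A * x - x * A) + A := by
    intro A
    have : (d : Weyl K) * (x * A) = x * (d * A) + A := by
      rw [← mul_assoc, d_mul_x, add_mul, one_mul, mul_assoc]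
    rw [mul_sub, this]; noncomm_ring
  induction j with
  | zero => simp [comm, key]
  | succ j ih =>
    have h1 : (j : K) + 1 ≠ 0 := by exact_mod_cast j.succ_ne_zero
    have h2 : ((j + 1 : ℕ) : K) + 1 ≠ 0 := by exact_mod_cast (j + 1).succ_ne_zero
    have h3 : comm j P * x - x * comm j P = ((j : K) + 1) • comm (j + 1) P := by
      rw [comm, smul_smul, mul_inv_cancel₀ h1, one_smul]
    have h4 : ∀ B : Weyl K, comm (j + 1 + 1) B
        = (((j + 1 : ℕ) : K) + 1)⁻¹ • (comm (j + 1) B * x - x * comm (j + 1) B) := fun B => rfl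
    rw [h4, h4, ih, mul_smul_comm]
    have h5 : (d * comm (j + 1) P + comm j P) * x - x * (d * comm (j + 1) P + comm j P)
        = d * (comm (j + 1) P * x - x * comm (j + 1) P)
          + (((j + 1 : ℕ) : K) + 1) • comm (j + 1) P := by
      rw [add_mul, mul_add, add_sub_add_comm, key, h3]
      push_cast
      module
    rw [h5, smul_add, smul_smul, inv_mul_cancel₀ h2, one_smul]

/-- Taylor's formula `P(x, ∂ - p') = ∑ⱼ Hⱼ Dⱼ(P)`. -/
theorem exists_ade_eq_sum [CharZero K] (p : K[X]) (P : Weyl K) :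
    ∃ N₀ : ℕ, ∀ N ≥ N₀, comm N P = 0 ∧
      ade p P = ∑ j ∈ Finset.range N, fn (expPoly p j) * comm j P := by
  induction P using induction_mul_left with
  | one =>
    have h1 : ∀ j : ℕ, comm (j + 1) (1 : Weyl K) = 0 := by
      intro j
      induction j with
      | zero => simp [comm]
      | succ j ih => rw [comm, ih]; simp
    refine ⟨1, fun N hN => ?_⟩
    obtain ⟨N, rfl⟩ := Nat.exists_eq_add_of_le' hN
    refine ⟨h1 N, ?_⟩
    rw [Finset.sum_range_succ']
    have h0 : expPoly p 0 = 1 := rfl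
    simp [h1, h0, fn_one, comm_zero]
  | add P Q hP hQ =>
    obtain ⟨N₁, h₁⟩ := hP
    obtain ⟨N₂, h₂⟩ := hQ
    refine ⟨max N₁ N₂, fun N hN => ⟨?_, ?_⟩⟩
    · rw [comm_add, (h₁ N (le_of_max_le_left hN)).1, (h₂ N (le_of_max_le_right hN)).1, add_zero]
    · rw [map_add, (h₁ N (le_of_max_le_left hN)).2, (h₂ N (le_of_max_le_right hN)).2,
        ← Finset.sum_add_distrib]
      simp only [comm_add, mul_add]
  | smul r P hP =>
    obtain ⟨N₁, h₁⟩ := hP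
    refine ⟨N₁, fun N hN => ⟨by rw [comm_smul, (h₁ N hN).1, smul_zero], ?_⟩⟩
    rw [map_smul, (h₁ N hN).2, Finset.smul_sum]
    simp only [comm_smul, mul_smul_comm]
  | x_mul P hP =>
    obtain ⟨N₁, h₁⟩ := hP
    refine ⟨N₁, fun N hN => ⟨by rw [comm_x_mul, (h₁ N hN).1, mul_zero], ?_⟩⟩
    rw [map_mul, ade_x, (h₁ N hN).2, Finset.mul_sum]
    simp only [comm_x_mul, ← mul_assoc, commute_x_fn]
  | d_mul P hP =>
    obtain ⟨N₁, h₁⟩ := hP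
    refine ⟨N₁ + 1, fun N hN => ?_⟩
    obtain ⟨N, rfl⟩ := Nat.exists_eq_add_of_le' (Nat.one_le_of_lt hN)
    have hN' : N₁ ≤ N := by omega
    refine ⟨by rw [comm_d_mul, (h₁ _ (by omega)).1, (h₁ _ hN').1, mul_zero, add_zero], ?_⟩
    have hd : ∀ j, (d - fn (derivative p)) * (fn (expPoly p j) * comm j P)
        = fn (expPoly p j) * (d * comm j P) + fn (expPoly p (j + 1)) * comm j P := by
      intro j
      have e : expPoly p (j + 1) = derivative (expPoly p j) - derivative p * expPoly p j := rfl
      have e' : fn (expPoly p (j + 1))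
          = fn (derivative (expPoly p j)) - fn (derivative p) * fn (expPoly p j) := by
        rw [e, fn, map_sub, map_mul]; rfl
      rw [e', sub_mul, ← mul_assoc, d_mul_fn]
      noncomm_ring
    rw [map_mul, ade_d, (h₁ (N + 1) (by omega)).2, Finset.mul_sum]
    simp only [hd]
    rw [Finset.sum_add_distrib, Finset.sum_range_succ (fun j => fn (expPoly p (j + 1)) * comm j P),
      (h₁ N hN').1, mul_zero, add_zero, Finset.sum_range_succ', Finset.sum_range_succ' _ N]
    simp only [comm_d_mul, mul_add, Finset.sum_add_distrib, comm_zero]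
    abel

/-- A space of operators that is stable under left and right multiplication by `x` is stable
under twisting. -/
theorem ade_mem_of_bimodule [CharZero K] {I : Submodule K (Weyl K)} (hl : ∀ P ∈ I, x * P ∈ I)
    (hr : ∀ P ∈ I, P * x ∈ I) (p : K[X]) {P : Weyl K} (hP : P ∈ I) : ade p P ∈ I := by
  obtain ⟨N, hN⟩ := exists_ade_eq_sum p P
  rw [(hN N le_rfl).2]
  have hc : ∀ j, comm j P ∈ I := by
    intro j
    induction j with
    | zero => exact hP
    | succ j ih => exact I.smul_mem _ (I.sub_mem (hr _ ih) (hl _ ih))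
  have hx : ∀ a : ℕ, ∀ Q ∈ I, x ^ a * Q ∈ I := by
    intro a Q hQ
    induction a with
    | zero => simpa using hQ
    | succ a ih => rw [pow_succ', mul_assoc]; exact hl _ ih
  refine I.sum_mem fun j _ => ?_
  rw [fn_eq_sum, Finset.sum_mul]
  refine I.sum_mem fun a _ => ?_
  rw [smul_mul_assoc]
  exact I.smul_mem _ (hx _ _ (hc j))

/-! ### The action on powers of `x` -/

/-- The action of the Weyl algebra on formal sums `∑ₙ f(n) x^(ν+n)`. -/
noncomputable def powAct (ν : K) : Weyl K →ₐ[K] Module.End K (ℤ → K) :=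
  lift (A := Module.End K (ℤ → K))
    { toFun := fun f n => f (n - 1)
      map_add' := fun _ _ => rfl
      map_smul' := fun _ _ => rfl }
    { toFun := fun f n => (ν + n + 1) * f (n + 1)
      map_add' := fun f g => by ext n; simp [mul_add]
      map_smul' := fun r f => by ext n; simp [mul_left_comm] }
    (by
      ext f n
      simp
      ring)

/-- `phi ν n P` is the coefficient of `x^(ν+n)` in `P x^ν`. -/
noncomputable def phi (ν : K) (n : ℤ) : Weyl K →ₗ[K] K where
  toFun P := powAct ν P (Pi.single 0 1) n
  map_add' P Q := by simp
  map_smul' r P := by simp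

theorem phi_one (ν : K) (n : ℤ) : phi ν n (1 : Weyl K) = if n = 0 then 1 else 0 := by
  simp [phi, Pi.single_apply]

theorem phi_x_mul (ν : K) (n : ℤ) (P : Weyl K) : phi ν n (x * P) = phi ν (n - 1) P := by
  simp only [phi, LinearMap.coe_mk, AddHom.coe_mk, map_mul, Module.End.mul_apply]
  conv_lhs => rw [powAct, lift_x]
  rfl

theorem phi_d_mul (ν : K) (n : ℤ) (P : Weyl K) :
    phi ν n (d * P) = (ν + n + 1) * phi ν (n + 1) P := by
  simp only [phi, LinearMap.coe_mk, AddHom.coe_mk, map_mul, Module.End.mul_apply]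
  conv_lhs => rw [powAct, lift_d]
  rfl

theorem phi_mul_x (ν : K) (n : ℤ) (P : Weyl K) : phi ν n (P * x) = phi (ν + 1) (n - 1) P := by
  induction P using induction_mul_left generalizing n with
  | one =>
    have := phi_x_mul ν n 1
    rw [mul_one, phi_one] at this
    rw [one_mul, this, phi_one]
  | add P Q hP hQ => rw [add_mul, map_add, map_add, hP, hQ]
  | smul r P hP => rw [smul_mul_assoc, map_smul, map_smul, hP]
  | x_mul P hP => rw [mul_assoc, phi_x_mul, phi_x_mul, hP]
  | d_mul P hP =>
    rw [mul_assoc, phi_d_mul, phi_d_mul, hP]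
    have e : n + 1 - 1 = n - 1 + 1 := by ring
    rw [e]
    push_cast
    ring

theorem phi_monomial (ν : K) (n : ℤ) (a b : ℕ) :
    phi ν n (x ^ a * d ^ b : Weyl K) = if n = a - b then (descPochhammer K b).eval ν else 0 := by
  have hd : ∀ n : ℤ, phi ν n (d ^ b : Weyl K)
      = if n = -b then (descPochhammer K b).eval ν else 0 := by
    induction b with
    | zero => intro n; simp [phi_one]
    | succ b ih =>
      intro n
      rw [pow_succ', phi_d_mul, ih, descPochhammer_succ_eval]
      by_cases h : n + 1 = -(b : ℤ)
      · have h' : n = -((b + 1 : ℕ) : ℤ) := by push_cast; linarith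
        rw [if_pos h, if_pos h', h']
        push_cast; ring
      · have h' : ¬ n = -((b + 1 : ℕ) : ℤ) := fun h' => h (by rw [h']; push_cast; ring)
        rw [if_neg h, if_neg h', mul_zero]
  induction a generalizing n with
  | zero => rw [pow_zero, one_mul, hd]; simp
  | succ a ih =>
    rw [pow_succ', mul_assoc, phi_x_mul, ih]
    have : n - 1 = (a : ℤ) - b ↔ n = ((a + 1 : ℕ) : ℤ) - b := by push_cast; constructor <;> intro <;> linarith
    simp only [this]

theorem phi_eq_zero_of_filt_neg {l : ℤ} {P : Weyl K} (hP : P ∈ filt (-1) 1 (-l)) {n : ℤ}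
    (hn : n < l) (ν : K) : phi ν n P = 0 := by
  have : filt (-1) 1 (-l) ≤ LinearMap.ker (phi (K := K) ν n) := by
    refine filt_le fun a b h => ?_
    rw [LinearMap.mem_ker, phi_monomial, if_neg]
    intro h'; linarith
  exact this hP

theorem phi_eq_zero_of_filt_pos {t : ℤ} {P : Weyl K} (hP : P ∈ filt 1 (-1) t) {n : ℤ}
    (hn : t < n) (ν : K) : phi ν n P = 0 := by
  have : filt 1 (-1) t ≤ LinearMap.ker (phi (K := K) ν n) := by
    refine filt_le fun a b h => ?_
    rw [LinearMap.mem_ker, phi_monomial, if_neg]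
    intro h'; linarith
  exact this hP

theorem phi_fn_mul_d_pow (ν : K) (n : ℤ) (p : K[X]) (b : ℕ) :
    phi ν n (fn p * d ^ b : Weyl K)
      = (descPochhammer K b).eval ν * if 0 ≤ n + b then p.coeff (n + b).toNat else 0 := by
  rw [fn_eq_sum, Finset.sum_mul, map_sum]
  simp only [smul_mul_assoc, map_smul, phi_monomial, smul_eq_mul]
  split_ifs with h
  · rw [Finset.sum_eq_single (n + b).toNat]
    · rw [if_pos (by omega)]; ring
    · intro a _ ha
      rw [if_neg (by omega), mul_zero]
    · intro ha
      rw [notMem_support_iff.1 ha, zero_mul]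
  · rw [mul_zero]
    refine Finset.sum_eq_zero fun a _ => ?_
    rw [if_neg (by omega), mul_zero]

theorem phi_eq_sum (ν : K) (n : ℤ) (P : Weyl K) {N : ℕ} (hN : ord P < N) :
    phi ν n P = ∑ b ∈ Finset.range N, (descPochhammer K b).eval ν *
      if 0 ≤ n + b then cf (n + b).toNat b P else 0 := by
  conv_lhs => rw [eq_sum P]
  rw [map_sum]
  simp only [phi_fn_mul_d_pow]
  refine Finset.sum_subset ?_ ?_
  · intro b hb
    rw [Finset.mem_range]
    exact (le_natDegree_of_mem_supp b hb).trans_lt hN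
  · intro b _ hb
    have : coeff P b = 0 := notMem_support_iff.1 hb
    simp [this]

/-- `P x^ν = x^(ν-n) g(x)`, where `n = ord P` and `g` is the indicial polynomial at `0`. -/
theorem coeff_indicial (P : Weyl K) (ν : K) (e : ℕ) :
    (indicial P 0 ν).coeff e = phi ν (e - ord P) P := by
  rw [phi_eq_sum ν _ P (Nat.lt_succ_self _), indicial, finsetSum_coeff]
  refine Finset.sum_congr rfl fun b hb => ?_
  have hb' : b ≤ ord P := Finset.mem_range_succ_iff.1 hb
  rw [C_0, sub_zero, mul_assoc, coeff_C_mul, coeff_X_pow_mul']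
  congr 1
  by_cases h : ord P - b ≤ e
  · rw [if_pos h, if_pos (by omega), cf_apply]
    congr 1; omega
  · rw [if_neg h, if_neg (by omega)]

theorem phi_eq_coeff_indicial (P : Weyl K) (ν : K) {n : ℤ} (hn : 0 ≤ n + ord P) :
    phi ν n P = (indicial P 0 ν).coeff (n + ord P).toNat := by
  rw [coeff_indicial, Int.toNat_of_nonneg hn, add_sub_cancel_right]

theorem phi_eq_zero_of_lt (P : Weyl K) (ν : K) {n : ℤ} (hn : n + ord P < 0) :
    phi ν n P = 0 := by
  rw [phi_eq_sum ν n P (Nat.lt_succ_self _)]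
  refine Finset.sum_eq_zero fun b hb => ?_
  have hb' : b ≤ ord P := Finset.mem_range_succ_iff.1 hb
  rw [if_neg (by omega), mul_zero]

theorem infPoly_eq_phi (P : Weyl K) (k : ℕ) (lam : K) :
    infPoly P k lam = phi (lam + k) (deg P - k) P := by
  rw [phi_eq_sum _ _ P (N := ord P + 1 + (k + 1)) (by omega), infPoly, ← Finset.sum_range_reflect]
  symm
  refine Finset.sum_subset_zero_on_sdiff ?_ ?_ ?_ |>.symm
  · intro b hb
    rw [Finset.mem_range] at hb ⊢; omega
  · intro b hb
    rw [Finset.mem_sdiff, Finset.mem_range, Finset.mem_range] at hb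
    rw [if_pos (by omega), cf_apply, coeff_eq_zero_of_natDegree_lt, mul_zero]
    have := natDegree_coeff_le_deg P b
    omega
  · intro b hb
    rw [Finset.mem_range] at hb
    have e : k - (k + 1 - 1 - b) = b := by omega
    rw [e, descPochhammer_eval_eq_ascPochhammer]
    congr 2
    · rw [show k + 1 - 1 - b = k - b by omega, Nat.cast_sub (by omega)]; ring
    · rw [infCoeff]
      by_cases h : k + 1 - 1 - b ≤ deg P
      · rw [if_pos h, if_pos (by omega), cf_apply]
        congr 1; omega
      · rw [if_neg h, if_neg (by omega)]

/-- The Mellin-type comparison behind the Fourier-Laplace transform: for `ν ∉ ℤ` the transform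
maps `x^(ν+n)` to a nonzero multiple of `x^(-ν-1-n)`. -/
theorem exists_phi_laplace {ν : K} (hν : ∀ z : ℤ, ν ≠ z) : ∃ c : ℤ → K, (∀ n, c n ≠ 0) ∧
    ∀ (P : Weyl K) (n : ℤ), phi (-ν - 1) (-n) (laplace P) = c n * phi ν n P := by
  let c : ℤ → K := fun n => match n with
    | Int.ofNat n => ∏ i ∈ Finset.range n, (ν + 1 + i)
    | Int.negSucc n => ∏ i ∈ Finset.range (n + 1), (ν - i)⁻¹
  have hν' : ∀ z : ℤ, ν + z ≠ 0 := by
    intro z h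
    exact hν (-z) (by push_cast; linear_combination h)
  have hrec : ∀ n : ℤ, c n = (ν + n) * c (n - 1) := by
    intro n
    rcases n with n | n
    · cases n with
      | zero =>
        change ∏ i ∈ Finset.range 0, (ν + 1 + (i : K))
          = (ν + ((0 : ℤ) : K)) * ∏ i ∈ Finset.range 1, (ν - (i : K))⁻¹
        have := hν' 0
        simp only [Int.cast_zero, add_zero] at this
        simp [this]
      | succ n =>
        have e : Int.ofNat (n + 1) - 1 = Int.ofNat n := by simp
        rw [e]
        change ∏ i ∈ Finset.range (n + 1), (ν + 1 + (i : K))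
          = (ν + (((n + 1 : ℕ) : ℤ) : K)) * ∏ i ∈ Finset.range n, (ν + 1 + (i : K))
        rw [Finset.prod_range_succ]
        push_cast; ring
    · have e : Int.negSucc n - 1 = Int.negSucc (n + 1) := by
        rw [Int.negSucc_eq, Int.negSucc_eq]; push_cast; ring
      rw [e]
      change ∏ i ∈ Finset.range (n + 1), (ν - (i : K))⁻¹
        = (ν + ((Int.negSucc n : ℤ) : K)) * ∏ i ∈ Finset.range (n + 1 + 1), (ν - (i : K))⁻¹
      rw [Finset.prod_range_succ _ (n + 1)]
      have h := hν' (Int.negSucc n)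
      have e2 : ν + ((Int.negSucc n : ℤ) : K) = ν - ((n + 1 : ℕ) : K) := by
        rw [Int.negSucc_eq]; push_cast; ring
      rw [e2] at h ⊢
      field_simp
  have hne : ∀ n, c n ≠ 0 := by
    intro n
    rcases n with n | n
    · refine Finset.prod_ne_zero_iff.2 fun i _ => ?_
      have := hν' (1 + i); push_cast at this; rwa [add_assoc]
    · refine Finset.prod_ne_zero_iff.2 fun i _ => inv_ne_zero ?_
      have := hν' (-i); push_cast at this; rwa [sub_eq_add_neg]
  refine ⟨c, hne, fun P => ?_⟩
  induction P using induction_mul_left with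
  | one =>
    intro n
    rw [map_one, phi_one, phi_one]
    by_cases h : n = 0
    · subst h
      have : c 0 = 1 := by change ∏ i ∈ Finset.range 0, (ν + 1 + (i : K)) = 1; simp
      simp [this]
    · simp [h]
  | add P Q hP hQ => intro n; rw [map_add, map_add, map_add, hP, hQ, mul_add]
  | smul r P hP => intro n; rw [map_smul, map_smul, map_smul, hP, smul_eq_mul, smul_eq_mul]; ring
  | x_mul P hP =>
    intro n
    have e : -n + 1 = -(n - 1) := by ring
    rw [map_mul, laplace_x, neg_mul, map_neg, phi_d_mul, phi_x_mul, e, hP, hrec n]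
    push_cast; ring
  | d_mul P hP =>
    intro n
    have e : -n - 1 = -(n + 1) := by ring
    rw [map_mul, laplace_d, phi_x_mul, phi_d_mul, e, hP, hrec (n + 1), add_sub_cancel_right]
    push_cast; ring

theorem phi_laplace_eq_zero_iff {ν : K} (hν : ∀ z : ℤ, ν ≠ z) (n : ℤ) (P : Weyl K) :
    phi (-ν - 1) (-n) (laplace P) = 0 ↔ phi ν n P = 0 := by
  obtain ⟨c, hc, h⟩ := exists_phi_laplace hν
  rw [h]; simp [hc]

theorem phi_dilate (a : Kˣ) (ν : K) (n : ℤ) (P : Weyl K) :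
    phi ν n (dilate a P) = (a : K) ^ (-n) * phi ν n P := by
  have ha : (a : K) ≠ 0 := a.ne_zero
  induction P using induction_mul_left generalizing n with
  | one =>
    rw [map_one, phi_one]
    split_ifs with h
    · simp [h]
    · simp
  | add P Q hP hQ => rw [map_add, map_add, map_add, hP, hQ, mul_add]
  | smul r P hP => rw [map_smul, map_smul, map_smul, hP, smul_eq_mul, smul_eq_mul]; ring
  | x_mul P hP =>
    rw [map_mul, dilate_x, smul_mul_assoc, map_smul, phi_x_mul, phi_x_mul, hP, smul_eq_mul,
      neg_sub, sub_eq_add_neg, zpow_add₀ ha, zpow_one]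
    field_simp
  | d_mul P hP =>
    rw [map_mul, dilate_d, smul_mul_assoc, map_smul, phi_d_mul, phi_d_mul, hP, smul_eq_mul,
      neg_add, zpow_add₀ ha, zpow_neg_one]
    field_simp

/-! ### Exponents in terms of the action on powers -/

/-- `P x^(e+j)` has no term of degree below `e + m + l`, for all `[e]_m` in `E` and `j < m`: the
exponent condition at the point `0` for an operator of weight at least `l`. -/
def ExpCond (P : Weyl K) (l : ℤ) (E : Exponents K) : Prop :=
  ∀ i, ∀ j < E.mult i, ∀ n : ℤ, n + j < l + E.mult i → phi (E.exp i + (j : K)) n P = 0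

/-- `P x^(-e-j)` has no term of degree above `-e - m + t`, for all `[e]_m` in `E` and `j < m`: the
exponent condition at infinity for an operator of weight at most `t`. -/
def InfExpCond (P : Weyl K) (t : ℤ) (E : Exponents K) : Prop :=
  ∀ i, ∀ j < E.mult i, ∀ n : ℤ, t - E.mult i < n - j → phi (-E.exp i - (j : K)) n P = 0

theorem ExpCond.ade [CharZero K] {P : Weyl K} {l : ℤ} {E : Exponents K} (h : ExpCond P l E)
    (hP : P ∈ filt (-1) 1 (-l)) (p : K[X]) : ExpCond (ade p P) l E := by
  intro i
  -- the operators that map `x^e K[x]` into `x^(e+m+l) K[x, 1/x]` form a bimodule over `K[x]`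
  let I : Submodule K (Weyl K) :=
    ⨅ (j : ℕ) (n : ℤ) (_ : n + j < l + E.mult i), LinearMap.ker (phi (E.exp i + (j : K)) n)
  have hI : ∀ Q, Q ∈ I ↔ ∀ (j : ℕ) (n : ℤ), n + j < l + E.mult i →
      phi (E.exp i + (j : K)) n Q = 0 := by
    intro Q; simp [I, Submodule.mem_iInf]
  have hPI : P ∈ I := by
    rw [hI]
    intro j n hn
    by_cases hj : j < E.mult i
    · exact h i j hj n hn
    · exact phi_eq_zero_of_filt_neg hP (by omega) _
  have := ade_mem_of_bimodule (I := I) ?_ ?_ p hPI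
  · rw [hI] at this
    exact fun j _ n hn => this j n hn
  · intro Q hQ
    rw [hI] at hQ ⊢
    intro j n hn
    rw [phi_x_mul]
    exact hQ j (n - 1) (by omega)
  · intro Q hQ
    rw [hI] at hQ ⊢
    intro j n hn
    rw [phi_mul_x, add_assoc]
    have := hQ (j + 1) (n - 1) (by push_cast; omega)
    push_cast at this; exact this

theorem infExpCond_laplace {P : Weyl K} {l : ℤ} {E : Exponents K}
    (hE : ∀ i, ∀ z : ℤ, E.exp i ≠ z) :
    InfExpCond (laplace P) (-l) (E.map fun e => e + 1) ↔ ExpCond P l E := by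
  have key : ∀ (i : Fin E.len) (j : ℕ) (n : ℤ), phi (-(E.exp i + 1) - (j : K)) (-n) (laplace P) = 0
      ↔ phi (E.exp i + (j : K)) n P = 0 := by
    intro i j n
    rw [← phi_laplace_eq_zero_iff (ν := E.exp i + (j : K))]
    · have : -(E.exp i + 1) - (j : K) = -(E.exp i + (j : K)) - 1 := by ring
      rw [this]
    · intro z hz
      exact hE i (z - j) (by push_cast; linear_combination hz)
  constructor
  · intro h i j hj n hn
    rw [← key]
    exact h i j hj (-n) (by simp only [Exponents.map]; omega)
  · intro h i j hj n hn
    have := (key i j (-n)).2 (h i j hj (-n) (by simp only [Exponents.map] at hn; omega))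
    rwa [neg_neg] at this

theorem expCond_laplace {P : Weyl K} {t : ℤ} {E : Exponents K}
    (hE : ∀ i, ∀ z : ℤ, E.exp i ≠ z) :
    ExpCond (laplace P) (-t) (E.map fun e => e - 1) ↔ InfExpCond P t E := by
  have key : ∀ (i : Fin E.len) (j : ℕ) (n : ℤ), phi ((E.exp i - 1) + (j : K)) (-n) (laplace P) = 0
      ↔ phi (-E.exp i - (j : K)) n P = 0 := by
    intro i j n
    rw [← phi_laplace_eq_zero_iff (ν := -E.exp i - (j : K))]
    · have : (E.exp i - 1) + (j : K) = -(-E.exp i - (j : K)) - 1 := by ring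
      rw [this]
    · intro z hz
      exact hE i (-z - j) (by push_cast; linear_combination -hz)
  constructor
  · intro h i j hj n hn
    rw [← key]
    exact h i j hj (-n) (by simp only [Exponents.map]; omega)
  · intro h i j hj n hn
    have := (key i j (-n)).2 (h i j hj (-n) (by simp only [Exponents.map] at hn; omega))
    rwa [neg_neg] at this

/-- Twisting on the Fourier-Laplace side preserves the exponent condition at infinity. -/
theorem InfExpCond.coAde [CharZero K] {P : Weyl K} {t : ℤ} {E : Exponents K}
    (hE : ∀ i, ∀ z : ℤ, E.exp i ≠ z) (h : InfExpCond P t E) (hP : P ∈ filt 1 (-1) t) (p : K[X]) :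
    InfExpCond (coAde p P) t E := by
  have hE' : ∀ i, ∀ z : ℤ, (E.map fun e => e - 1).exp i ≠ z := by
    intro i z hz
    change E.exp i - 1 = z at hz
    refine hE i (z + 1) ?_
    push_cast; linear_combination hz
  have hEE : (E.map fun e => e - 1).map (fun e => e + 1) = E := by simp [Exponents.map]
  have h1 : ExpCond (laplace.symm P) (-t) (E.map fun e => e - 1) := by
    rw [← infExpCond_laplace hE', hEE, AlgEquiv.apply_symm_apply, neg_neg]; exact h
  have h2 : laplace.symm P ∈ filt (-1) 1 (-(-t)) := by
    rw [neg_neg]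
    refine map_mem_filt (by simp) (laplace : Weyl K ≃ₐ[K] Weyl K).symm.toAlgHom ?_ ?_ hP
    · change laplace.symm x ∈ _
      rw [laplace_symm_x]; exact d_mem_filt le_rfl
    · change laplace.symm d ∈ _
      rw [laplace_symm_d]; exact Submodule.neg_mem _ (x_mem_filt le_rfl)
  have h3 := (infExpCond_laplace hE').2 (h1.ade h2 p)
  rwa [hEE, neg_neg, ← coAde_apply] at h3

theorem InfExpCond.dilate {P : Weyl K} {t : ℤ} {E : Exponents K} (h : InfExpCond P t E) (a : Kˣ) :
    InfExpCond (dilate a P) t E := by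
  intro i j hj n hn
  rw [phi_dilate, h i j hj n hn, mul_zero]

theorem hasExponentsAt_zero_iff {P : Weyl K} {E : Exponents K} {l : ℤ}
    (hl : l = (rootMultiplicity 0 (coeff P (ord P)) : ℤ) - ord P) :
    HasExponentsAt P 0 E ↔ P ∈ filt (-1) 1 (-l) ∧ E.total = ord P ∧ E.NonIntegralDifferences ∧
      ExpCond P l E := by
  set N := rootMultiplicity 0 (coeff P (ord P)) with hN
  subst hl
  have h1 : RegularAt P 0 ↔ P ∈ filt (-1) 1 (-((N : ℤ) - ord P)) := by
    unfold RegularAt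
    simp only [C_0, sub_zero, ← hN, X_pow_dvd_iff, coeff_X_pow_mul']
    constructor
    · intro h a b hab
      by_contra h'
      have hb := le_ord (coeff_ne_zero_of_cf hab)
      have := h b hb (a + (ord P - b)) (by omega)
      rw [if_pos (by omega), Nat.add_sub_cancel] at this
      exact hab this
    · intro h k hk e he
      split_ifs with h'
      · exact cf_eq_zero h (a := e - (ord P - k)) (b := k) (by omega)
      · rfl
  have h2 : (∀ i, ∀ j < E.mult i, (X - C (0 : K)) ^ (N + (E.mult i - j)) ∣
      indicial P 0 (E.exp i + (j : K))) ↔ ExpCond P ((N : ℤ) - ord P) E := by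
    simp only [C_0, sub_zero, X_pow_dvd_iff, coeff_indicial]
    constructor
    · intro h i j hj n hn
      by_cases hn0 : n + ord P < 0
      · exact phi_eq_zero_of_lt P _ hn0
      · have := h i j hj (n + ord P).toNat (by omega)
        rwa [Int.toNat_of_nonneg (by omega), add_sub_cancel_right] at this
    · intro h i j hj e he
      exact h i j hj _ (by omega)
  rw [HasExponentsAt, h1, h2]

theorem indicial_translate (P : Weyl K) (c ν : K) :
    indicial (translate c P) 0 ν = (indicial P c ν).comp (X + C c) := by
  simp only [indicial, ord_translate, coeff_translate]
  rw [← coe_compRingHom_apply, map_sum]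
  refine Finset.sum_congr rfl fun k _ => ?_
  simp

theorem hasExponentsAt_translate {P : Weyl K} {c : K} {E : Exponents K} :
    HasExponentsAt (translate c P) 0 E ↔ HasExponentsAt P c E := by
  have hd : ∀ (p : K[X]) (n : ℕ), (X - C (0 : K)) ^ n ∣ p.comp (X + C c) ↔ (X - C c) ^ n ∣ p := by
    intro p n
    rw [X_sub_C_pow_dvd_iff (t := c)]; simp
  have hr : rootMultiplicity 0 (coeff (translate c P) (ord P))
      = rootMultiplicity c (coeff P (ord P)) := by
    rw [coeff_translate, rootMultiplicity_eq_rootMultiplicity (t := c)]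
  unfold HasExponentsAt RegularAt
  simp only [ord_translate, hr, indicial_translate, hd]
  refine and_congr_left fun _ => forall₂_congr fun k _ => ?_
  rw [← hd _ (rootMultiplicity c (coeff P (ord P))), coeff_translate]
  simp

theorem HasExponentsAt.ade [CharZero K] {P : Weyl K} {c : K} {E : Exponents K}
    (h : HasExponentsAt P c E) (p : K[X]) : HasExponentsAt (ade p P) c E := by
  rw [← hasExponentsAt_translate] at h ⊢
  rw [translate_ade]
  set Q := translate c P
  obtain ⟨h1, h2, h3, h4⟩ := (hasExponentsAt_zero_iff rfl).1 h
  refine (hasExponentsAt_zero_iff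
    (l := (rootMultiplicity 0 (coeff Q (ord Q)) : ℤ) - ord Q) ?_).2 ⟨?_, ?_, h3, h4.ade h1 _⟩
  · rw [ord_ade, coeff_ade_ord]
  · exact ade_mem_filt (by simp) _ (fun a _ => by omega) h1
  · rw [ord_ade]; exact h2

theorem hasExponentsAtInfinity_iff {P : Weyl K} {E : Exponents K} {t : ℤ}
    (ht : t = (deg P : ℤ) - E.total) :
    HasExponentsAtInfinity P E ↔ P ∈ filt 1 (-1) t ∧ cf (deg P) E.total P ≠ 0 ∧
      E.NonIntegralDifferences ∧ InfExpCond P t E := by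
  subst ht
  have h1 : (∀ i j, i + j < E.total → infCoeff P i j = 0)
      ↔ P ∈ filt 1 (-1) ((deg P : ℤ) - E.total) := by
    constructor
    · intro h a b hab
      by_contra h'
      have ha := (le_natDegree_of_ne_zero hab).trans (natDegree_coeff_le_deg P b)
      have := h (deg P - a) b (by omega)
      rw [infCoeff, if_pos (by omega), show deg P - (deg P - a) = a by omega] at this
      exact hab this
    · intro h i j hij
      unfold infCoeff
      split_ifs with hi
      · exact cf_eq_zero h (a := deg P - i) (b := j) (by omega)
      · rfl
  have h2 : infCoeff P 0 E.total ≠ 0 ↔ cf (deg P) E.total P ≠ 0 := by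
    simp [infCoeff, cf_apply]
  rw [HasExponentsAtInfinity, h1, h2]
  refine and_congr_right fun h1 => and_congr_right fun _ => and_congr_right fun _ => ?_
  simp only [infPoly_eq_phi, sub_add_cancel]
  constructor
  · intro h i j hj n hn
    by_cases h' : (deg P : ℤ) - E.total < n
    · exact phi_eq_zero_of_filt_pos h1 h' _
    · have := h i j hj (deg P - n).toNat (by omega) (by omega)
      rwa [Int.toNat_of_nonneg (by omega), sub_sub_cancel] at this
  · intro h i j hj k hk hk'
    exact h i j hj _ (by omega)

/-! ### Newton polygons -/

/-- The region above the polygonal line with slopes `0`, `1`, `2` of lengths `a`, `b`, `c`. -/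
def slopeRegion (v a b c : ℝ) : Set (ℝ × ℝ) :=
  {q | q.1 ≤ a + b + c ∧ v ≤ q.2 ∧ v + (q.1 - a) ≤ q.2 ∧ v + b + 2 * (q.1 - a - b) ≤ q.2}

theorem convex_slopeRegion (v a b c : ℝ) : Convex ℝ (slopeRegion v a b c) := by
  rintro p ⟨h1, h2, h3, h4⟩ q ⟨k1, k2, k3, k4⟩ s t hs ht hst
  obtain rfl : t = 1 - s := by linarith
  simp only [slopeRegion, Set.mem_ofPred_eq, Prod.fst_add, Prod.snd_add, Prod.smul_fst,
    Prod.smul_snd, smul_eq_mul]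
  refine ⟨?_, ?_, ?_, ?_⟩ <;> nlinarith

theorem convexHull_quadrants {v a b c : ℝ} (ha : 0 ≤ a) (hb : 0 ≤ b) (hc : 0 ≤ c) :
    convexHull ℝ (quadrant 0 v ∪ quadrant a v ∪ quadrant (a + b) (v + b) ∪
      quadrant (a + b + c) (v + b + 2 * c)) = slopeRegion v a b c := by
  apply subset_antisymm
  · refine convexHull_min ?_ (convex_slopeRegion v a b c)
    rintro ⟨p, q⟩ (((⟨h1, h2⟩ | ⟨h1, h2⟩) | ⟨h1, h2⟩) | ⟨h1, h2⟩) <;> simp only at h1 h2 <;>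
      refine ⟨?_, ?_, ?_, ?_⟩ <;> simp only <;> linarith
  · rintro ⟨p, q⟩ ⟨h1, h2, h3, h4⟩
    simp only at h1 h2 h3 h4
    set S := quadrant 0 v ∪ quadrant a v ∪ quadrant (a + b) (v + b) ∪
      quadrant (a + b + c) (v + b + 2 * c)
    have hS := subset_convexHull ℝ S
    have hconv := convex_convexHull ℝ S
    -- a point above the segment from `(e, w)` to `(e + l, w + k l)` is a convex combination
    have seg : ∀ e w l k : ℝ, 0 ≤ l → quadrant e w ⊆ S → quadrant (e + l) (w + k * l) ⊆ S →
        e ≤ p → p ≤ e + l → w + k * (p - e) ≤ q → (p, q) ∈ convexHull ℝ S := by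
      intro e w l k hl hS1 hS2 h1 h2 h3
      rcases hl.eq_or_lt with rfl | hl
      · refine hS (hS1 ⟨by simpa using h2, ?_⟩)
        obtain rfl : p = e := by linarith
        simpa using h3
      · set s := q - (w + k * (p - e))
        have m1 : (e, w + s) ∈ convexHull ℝ S := hS (hS1 ⟨le_rfl, by simp only; linarith⟩)
        have m2 : (e + l, w + k * l + s) ∈ convexHull ℝ S :=
          hS (hS2 ⟨le_rfl, by simp only; linarith⟩)
        have hθ : 0 ≤ (p - e) / l := div_nonneg (by linarith) hl.le
        have hθ' : (p - e) / l ≤ 1 := (div_le_one hl).2 (by linarith)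
        have := hconv m1 m2 (a := 1 - (p - e) / l) (b := (p - e) / l) (by linarith) hθ (by ring)
        convert this using 1
        ext
        · simp; field_simp; ring
        · simp [s]; field_simp; ring
    rcases le_total p a with hp | hp
    · exact hS (Or.inl (Or.inl (Or.inr ⟨hp, h2⟩)))
    · rcases le_total p (a + b) with hp' | hp'
      · refine seg a v b 1 hb ?_ ?_ hp hp' (by linarith)
        · exact fun z hz => Or.inl (Or.inl (Or.inr hz))
        · rw [one_mul]; exact fun z hz => Or.inl (Or.inr hz)
      · refine seg (a + b) (v + b) c 2 hc ?_ ?_ hp' h1 (by linarith)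
        · exact fun z hz => Or.inl (Or.inr hz)
        · exact fun z hz => Or.inr hz

theorem extreme_slopeRegion {v a b c : ℝ} (hb : 0 ≤ b) (hc : 0 ≤ c) :
    ((a, v) : ℝ × ℝ) ∈ (slopeRegion v a b c).extremePoints ℝ ∧
    ((a + b, v + b) : ℝ × ℝ) ∈ (slopeRegion v a b c).extremePoints ℝ ∧
    ((a + b + c, v + b + 2 * c) : ℝ × ℝ) ∈ (slopeRegion v a b c).extremePoints ℝ := by
  have aux : ∀ {s t f g w : ℝ}, 0 < s → 0 < t → s + t = 1 → w ≤ f → w ≤ g → s * f + t * g = w →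
      f = w ∧ g = w := by
    intro s t f g w hs ht hst hf hg h
    obtain rfl : t = 1 - s := by linarith
    constructor
    · by_contra hne
      have : w < f := lt_of_le_of_ne hf (Ne.symm hne)
      nlinarith
    · by_contra hne
      have : w < g := lt_of_le_of_ne hg (Ne.symm hne)
      nlinarith
  refine ⟨⟨?_, ?_⟩, ⟨?_, ?_⟩, ⟨?_, ?_⟩⟩
  · refine ⟨?_, ?_, ?_, ?_⟩ <;> simp only <;> linarith
  · rintro ⟨p1, q1⟩ ⟨h1, h2, h3, h4⟩ ⟨p2, q2⟩ ⟨k1, k2, k3, k4⟩ ⟨s, t, hs, ht, hst, hz⟩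
    simp only [Prod.smul_mk, Prod.mk_add_mk, smul_eq_mul, Prod.mk.injEq] at *
    obtain ⟨e1, e2⟩ := aux hs ht hst h2 k2 hz.2
    obtain ⟨e3, e4⟩ := aux (f := -p1) (g := -p2) (w := -a) hs ht hst (by linarith) (by linarith)
      (by linarith [hz.1])
    exact ⟨by linarith, e1⟩
  · refine ⟨?_, ?_, ?_, ?_⟩ <;> simp only <;> linarith
  · rintro ⟨p1, q1⟩ ⟨h1, h2, h3, h4⟩ ⟨p2, q2⟩ ⟨k1, k2, k3, k4⟩ ⟨s, t, hs, ht, hst, hz⟩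
    simp only [Prod.smul_mk, Prod.mk_add_mk, smul_eq_mul, Prod.mk.injEq] at *
    obtain ⟨e1, e2⟩ := aux (f := q1 - 2 * p1) (g := q2 - 2 * p2) (w := v + b - 2 * (a + b))
      hs ht hst (by linarith) (by linarith) (by linarith [hz.1, hz.2])
    obtain ⟨e3, e4⟩ := aux (f := p1) (g := p2) (w := a + b) hs ht hst (by linarith) (by linarith)
      (by linarith [hz.1])
    exact ⟨by linarith, by linarith⟩
  · refine ⟨?_, ?_, ?_, ?_⟩ <;> simp only <;> linarith
  · rintro ⟨p1, q1⟩ ⟨h1, h2, h3, h4⟩ ⟨p2, q2⟩ ⟨k1, k2, k3, k4⟩ ⟨s, t, hs, ht, hst, hz⟩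
    simp only [Prod.smul_mk, Prod.mk_add_mk, smul_eq_mul, Prod.mk.injEq] at *
    obtain ⟨e1, e2⟩ := aux (f := -p1) (g := -p2) (w := -(a + b + c)) hs ht hst (by linarith)
      (by linarith) (by linarith [hz.1])
    obtain ⟨e3, e4⟩ := aux (f := q1) (g := q2) (w := v + b + 2 * c) hs ht hst (by linarith)
      (by linarith) (by linarith [hz.2])
    exact ⟨by linarith, by linarith⟩

theorem corner_mem_newtonPolygon {P : Weyl K} {k : ℕ} (h : coeff P k ≠ 0) :
    quadrant (k : ℝ) ((k : ℝ) - ((coeff P k).natDegree : ℝ)) ⊆ newtonPolygon P := fun _ hq =>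
  subset_convexHull ℝ _ (Set.mem_biUnion (show k ∈ {i : ℕ | coeff P i ≠ 0} from h) hq)

/-- The Newton polygon in terms of weights: the support of `P` lies below four lines, and the
three corners on these lines carry nonzero coefficients. -/
theorem newtonSlopes_iff {P : Weyl K} {a b c : ℕ} : NewtonSlopes P a b c ↔
    ∃ D : ℕ, c ≤ D ∧ P ∈ filt 1 0 D ∧ P ∈ filt 0 1 (a + b + c : ℕ) ∧ P ∈ filt 1 (-1) (D - a) ∧
      P ∈ filt 1 1 (D + a + b) ∧ cf D a P ≠ 0 ∧ cf D (a + b) P ≠ 0 ∧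
      cf (D - c) (a + b + c) P ≠ 0 := by
  have ha : (0 : ℝ) ≤ a := Nat.cast_nonneg a
  have hb : (0 : ℝ) ≤ b := Nat.cast_nonneg b
  have hc : (0 : ℝ) ≤ c := Nat.cast_nonneg c
  unfold NewtonSlopes
  constructor
  · rintro ⟨v, hv⟩
    rw [convexHull_quadrants ha hb hc] at hv
    have hin : ∀ k, coeff P k ≠ 0 →
        ((k : ℝ), (k : ℝ) - ((coeff P k).natDegree : ℝ)) ∈ slopeRegion v a b c := by
      intro k hk
      rw [← hv]
      exact corner_mem_newtonPolygon hk ⟨le_rfl, le_rfl⟩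
    have hext : ∀ z ∈ (slopeRegion v a b c).extremePoints ℝ, ∃ k, coeff P k ≠ 0 ∧
        z.1 ≤ k ∧ (k : ℝ) - ((coeff P k).natDegree : ℝ) ≤ z.2 := by
      intro z hz
      rw [← hv] at hz
      have := extremePoints_convexHull_subset hz
      simp only [Set.mem_iUnion] at this
      obtain ⟨k, hk, h⟩ := this
      exact ⟨k, hk, h⟩
    obtain ⟨e1, e2, e3⟩ := extreme_slopeRegion (v := v) (a := a) hb hc
    obtain ⟨k1, hk1, u1, w1⟩ := hext _ e1
    obtain ⟨k2, hk2, u2, w2⟩ := hext _ e2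
    obtain ⟨k3, hk3, u3, w3⟩ := hext _ e3
    obtain ⟨r1, r2, r3, r4⟩ := hin _ hk1
    obtain ⟨s1, s2, s3, s4⟩ := hin _ hk2
    obtain ⟨t1, t2, t3, t4⟩ := hin _ hk3
    simp only at *
    obtain rfl : k1 = a := by exact_mod_cast (by linarith : (k1 : ℝ) = a)
    obtain rfl : k2 = k1 + b := by exact_mod_cast (by push_cast; linarith : (k2 : ℝ) = (k1 + b : ℕ))
    obtain rfl : k3 = k1 + b + c := by
      exact_mod_cast (by push_cast; linarith : (k3 : ℝ) = (k1 + b + c : ℕ))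
    push_cast at *
    set D := (coeff P k1).natDegree with hD
    have hD2 : (coeff P (k1 + b)).natDegree = D := by
      exact_mod_cast (by linarith : ((coeff P (k1 + b)).natDegree : ℝ) = D)
    have hD3 : (coeff P (k1 + b + c)).natDegree + c = D := by
      exact_mod_cast (by linarith : ((coeff P (k1 + b + c)).natDegree : ℝ) + c = D)
    have hin' : ∀ α β : ℕ, cf α β P ≠ 0 → (α : ℝ) ≤ D ∧ (β : ℝ) ≤ k1 + b + c ∧
        (α : ℝ) - β ≤ D - k1 ∧ (α : ℝ) + β ≤ D + k1 + b := by
      intro α β h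
      obtain ⟨m1, m2, m3, m4⟩ := hin β (coeff_ne_zero_of_cf h)
      have m5 : (α : ℝ) ≤ (coeff P β).natDegree := by exact_mod_cast le_natDegree_of_ne_zero h
      simp only at *
      refine ⟨?_, ?_, ?_, ?_⟩ <;> linarith
    refine ⟨D, by omega, ?_, ?_, ?_, ?_, ?_, ?_, ?_⟩
    · intro α β h
      have : α ≤ D := by exact_mod_cast (hin' α β h).1
      omega
    · intro α β h
      have : β ≤ k1 + b + c := by exact_mod_cast (hin' α β h).2.1
      omega
    · intro α β h
      have : (α : ℤ) - β ≤ D - k1 := by exact_mod_cast (hin' α β h).2.2.1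
      linarith
    · intro α β h
      have : α + β ≤ D + k1 + b := by exact_mod_cast (hin' α β h).2.2.2
      omega
    · rw [cf_apply, hD, coeff_natDegree]; exact leadingCoeff_ne_zero.2 hk1
    · rw [cf_apply, ← hD2, coeff_natDegree]; exact leadingCoeff_ne_zero.2 hk2
    · rw [cf_apply, ← hD3, Nat.add_sub_cancel, coeff_natDegree]; exact leadingCoeff_ne_zero.2 hk3
  · rintro ⟨D, hcD, h1, h2, h3, h4, c1, c2, c3⟩
    refine ⟨(a : ℝ) - D, ?_⟩
    have hle : ∀ {α β : ℕ}, cf α β P ≠ 0 → (α : ℝ) ≤ (coeff P β).natDegree := by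
      intro α β h
      exact_mod_cast le_natDegree_of_ne_zero h
    apply subset_antisymm
    · rw [convexHull_quadrants ha hb hc]
      refine convexHull_min ?_ (convex_slopeRegion _ _ _ _)
      intro q hq
      simp only [Set.mem_iUnion] at hq
      obtain ⟨k, hk, m1, m2⟩ := hq
      have hl : cf (coeff P k).natDegree k P ≠ 0 := leadingCoeff_ne_zero.2 hk
      have i1 := h1 _ _ hl
      have i2 := h2 _ _ hl
      have i3 := h3 _ _ hl
      have i4 := h4 _ _ hl
      have j1 : ((coeff P k).natDegree : ℝ) ≤ D := by
        have : (coeff P k).natDegree ≤ D := by omega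
        exact_mod_cast this
      have j2 : (k : ℝ) ≤ a + b + c := by
        have : k ≤ a + b + c := by omega
        exact_mod_cast this
      have j3 : ((coeff P k).natDegree : ℝ) + a ≤ D + k := by
        have : (coeff P k).natDegree + a ≤ D + k := by omega
        exact_mod_cast this
      have j4 : ((coeff P k).natDegree : ℝ) + k ≤ D + a + b := by
        have : (coeff P k).natDegree + k ≤ D + a + b := by omega
        exact_mod_cast this
      refine ⟨?_, ?_, ?_, ?_⟩ <;> linarith
    · refine convexHull_min ?_ (convex_convexHull ℝ _)
      have q1 := corner_mem_newtonPolygon (coeff_ne_zero_of_cf c1)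
      have q2 := corner_mem_newtonPolygon (coeff_ne_zero_of_cf c2)
      have q3 := corner_mem_newtonPolygon (coeff_ne_zero_of_cf c3)
      have l1 := hle c1
      have l2 := hle c2
      have l3 := hle c3
      rw [Nat.cast_sub hcD] at l3
      push_cast at *
      rintro ⟨p, q⟩ (((⟨m1, m2⟩ | ⟨m1, m2⟩) | ⟨m1, m2⟩) | ⟨m1, m2⟩) <;> simp only at m1 m2
      · exact q1 ⟨by simp only; linarith, by simp only; linarith⟩
      · exact q1 ⟨by simp only; linarith, by simp only; linarith⟩
      · exact q2 ⟨by simp only; linarith, by simp only; linarith⟩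
      · exact q3 ⟨by simp only; linarith, by simp only; linarith⟩

/-! ### Multiplication by functions -/

theorem coeff_le_mul_iff {h : K[X]} (hh : h ≠ 0) (p : K[X]) (t : ℤ) :
    (∀ a : ℕ, (h * p).coeff a ≠ 0 → (a : ℤ) ≤ t + h.natDegree)
      ↔ ∀ a : ℕ, p.coeff a ≠ 0 → (a : ℤ) ≤ t := by
  have key : ∀ (q : K[X]) (s : ℤ), q ≠ 0 →
      ((∀ a : ℕ, q.coeff a ≠ 0 → (a : ℤ) ≤ s) ↔ (q.natDegree : ℤ) ≤ s) := by
    intro q s hq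
    refine ⟨fun h => h _ (leadingCoeff_ne_zero.2 hq), fun h a ha => ?_⟩
    have := le_natDegree_of_ne_zero ha
    omega
  by_cases hp : p = 0
  · simp [hp]
  · rw [key _ _ (mul_ne_zero hh hp), key _ _ hp, natDegree_mul hh hp]
    push_cast
    constructor <;> intro <;> linarith

theorem fn_mul_mem_filt_iff {h : K[X]} (hh : h ≠ 0) {P : Weyl K} {v t : ℤ} :
    fn h * P ∈ filt 1 v (t + h.natDegree) ↔ P ∈ filt 1 v t := by
  have e : ∀ (Q : Weyl K) (s : ℤ), Q ∈ filt 1 v s ↔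
      ∀ b : ℕ, ∀ a : ℕ, (coeff Q b).coeff a ≠ 0 → (a : ℤ) ≤ s - v * b := by
    intro Q s
    rw [mem_filt, forall_comm]
    refine forall₂_congr fun b a => imp_congr Iff.rfl ?_
    constructor <;> intro <;> linarith
  rw [e, e]
  refine forall_congr' fun b => ?_
  rw [coeff_fn_mul, add_sub_right_comm]
  exact coeff_le_mul_iff hh _ _

theorem cf_fn_mul_ne_zero_iff (h : K[X]) (hh : h ≠ 0) {P : Weyl K} {D b : ℕ}
    (hP : (coeff P b).natDegree ≤ D) :
    cf (h.natDegree + D) b (fn h * P) ≠ 0 ↔ cf D b P ≠ 0 := by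
  rw [cf_apply, coeff_fn_mul, coeff_mul_add_eq_of_natDegree_le le_rfl hP, coeff_natDegree, cf_apply,
    mul_ne_zero_iff, and_iff_right (leadingCoeff_ne_zero.2 hh)]

theorem deg_fn_mul {h : K[X]} (hh : h ≠ 0) {P : Weyl K} (hP : P ≠ 0) :
    deg (fn h * P) = h.natDegree + deg P := by
  obtain ⟨k, hk⟩ : ∃ k, cf (deg P) k P ≠ 0 := by
    obtain ⟨k, -, hk⟩ := Finset.exists_mem_eq_sup (Finset.range (ord P + 1)) ⟨0, by simp⟩
      fun k => (coeff P k).natDegree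
    by_cases h0 : deg P = 0
    · refine ⟨ord P, ?_⟩
      have h1 := natDegree_coeff_le_deg P (ord P)
      rw [h0] at h1 ⊢
      rw [cf_apply, ← Nat.le_zero.1 h1, coeff_natDegree]
      exact leadingCoeff_ne_zero.2 (coeff_ord_ne_zero hP)
    · refine ⟨k, ?_⟩
      change deg P = _ at hk
      rw [cf_apply, hk, coeff_natDegree]
      refine leadingCoeff_ne_zero.2 fun h1 => h0 ?_
      rw [hk, h1, natDegree_zero]
  refine deg_eq ⟨k, (cf_fn_mul_ne_zero_iff h hh (natDegree_coeff_le_deg P k)).2 hk⟩ fun b => ?_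
  rw [coeff_fn_mul]
  exact natDegree_mul_le.trans (by have := natDegree_coeff_le_deg P b; omega)

theorem indicial_fn_mul {h : K[X]} (hh : h ≠ 0) (P : Weyl K) (c ν : K) :
    indicial (fn h * P) c ν = h * indicial P c ν := by
  simp only [indicial, ord_fn_mul hh, coeff_fn_mul, Finset.mul_sum]
  exact Finset.sum_congr rfl fun k _ => by ring

theorem phi_fn_mul_iff {h : K[X]} (hh : h ≠ 0) (P : Weyl K) (ν : K) (t : ℤ) :
    (∀ n : ℤ, t + h.natDegree < n → phi ν n (fn h * P) = 0) ↔ ∀ n : ℤ, t < n → phi ν n P = 0 := by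
  have e : ∀ (Q : Weyl K) (s : ℤ), (∀ n : ℤ, s < n → phi ν n Q = 0) ↔
      ∀ a : ℕ, (indicial Q 0 ν).coeff a ≠ 0 → (a : ℤ) ≤ s + ord Q := by
    intro Q s
    constructor
    · intro h a ha
      by_contra h'
      rw [coeff_indicial] at ha
      exact ha (h _ (by omega))
    · intro h n hn
      by_cases hn0 : n + ord Q < 0
      · exact phi_eq_zero_of_lt Q ν hn0
      · rw [phi_eq_coeff_indicial Q ν (not_lt.1 hn0)]
        by_contra h'
        have := h _ h'
        omega
  rw [e, e, indicial_fn_mul hh, ord_fn_mul hh, add_right_comm]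
  exact coeff_le_mul_iff hh _ _

theorem onlySingularAt_fn_mul {h : K[X]} (hh : h ≠ 0) {P : Weyl K} {p : ℕ} {c : Fin p → K} :
    OnlySingularAt (fn h * P) c ↔ OnlySingularAt P c := by
  simp only [OnlySingularAt, ord_fn_mul hh, coeff_fn_mul, mul_left_comm _ h,
    mul_dvd_mul_iff_left hh]

theorem X_sub_C_pow_dvd_mul_iff {h : K[X]} (hh : h ≠ 0) (c : K) (p : K[X]) (n : ℕ) :
    (X - C c) ^ (rootMultiplicity c h + n) ∣ h * p ↔ (X - C c) ^ n ∣ p := by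
  obtain ⟨u, hu, hu'⟩ := exists_eq_pow_rootMultiplicity_mul_and_not_dvd h hh c
  have hc : IsCoprime ((X - C c) ^ n) u :=
    (((irreducible_X_sub_C c).coprime_iff_not_dvd).2 hu').pow_left
  rw [show h * p = (X - C c) ^ rootMultiplicity c h * (u * p) by rw [← mul_assoc, ← hu],
    pow_add, mul_dvd_mul_iff_left (pow_ne_zero _ (X_sub_C_ne_zero c))]
  exact ⟨hc.dvd_of_dvd_mul_left, fun h => h.mul_left u⟩

theorem hasExponentsAt_fn_mul {h : K[X]} (hh : h ≠ 0) {P : Weyl K} (hP : P ≠ 0) {c : K}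
    {E : Exponents K} : HasExponentsAt (fn h * P) c E ↔ HasExponentsAt P c E := by
  simp only [HasExponentsAt, RegularAt, ord_fn_mul hh, coeff_fn_mul, indicial_fn_mul hh,
    rootMultiplicity_mul (mul_ne_zero hh (coeff_ord_ne_zero hP)), mul_left_comm _ h, add_assoc,
    X_sub_C_pow_dvd_mul_iff hh]

theorem hasExponentsAtInfinity_fn_mul {h : K[X]} (hh : h ≠ 0) {P : Weyl K} (hP : P ≠ 0)
    {E : Exponents K} : HasExponentsAtInfinity (fn h * P) E ↔ HasExponentsAtInfinity P E := by
  rw [hasExponentsAtInfinity_iff (t := ((deg P : ℤ) - E.total) + h.natDegree)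
    (by rw [deg_fn_mul hh hP]; push_cast; ring), hasExponentsAtInfinity_iff rfl,
    fn_mul_mem_filt_iff hh, deg_fn_mul hh hP,
    cf_fn_mul_ne_zero_iff h hh (natDegree_coeff_le_deg P _)]
  refine and_congr_right fun _ => and_congr_right fun _ => and_congr_right fun _ => ?_
  refine forall_congr' fun i => forall₂_congr fun j _ => ?_
  have := phi_fn_mul_iff hh P (-E.exp i - (j : K)) ((deg P : ℤ) - E.total - E.mult i + j)
  constructor
  · intro H n hn
    exact this.1 (fun n hn => H n (by linarith)) n (by linarith)
  · intro H n hn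
    exact this.2 (fun n hn => H n (by linarith)) n (by linarith)

theorem irregularRankLeTwo_iff {P : Weyl K} : IrregularRankLeTwo P ↔
    P ∈ filt 1 1 ((coeff P (ord P)).natDegree + ord P) := by
  constructor
  · intro h a b hab
    have hb := le_ord (coeff_ne_zero_of_cf hab)
    have ha : a ≤ (coeff P b).natDegree := le_natDegree_of_ne_zero hab
    rcases hb.eq_or_lt with rfl | hb
    · omega
    · have := h (ord P - b) (by omega) (by omega)
      rw [show ord P - (ord P - b) = b by omega] at this
      have := this (coeff_ne_zero_of_cf hab)
      omega
  · intro h i h1 h2 h3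
    have h4 : cf (coeff P (ord P - i)).natDegree (ord P - i) P ≠ 0 := leadingCoeff_ne_zero.2 h3
    have := h _ _ h4
    omega

theorem irregularRankLeTwo_fn_mul {h : K[X]} (hh : h ≠ 0) {P : Weyl K} (hP : P ≠ 0) :
    IrregularRankLeTwo (fn h * P) ↔ IrregularRankLeTwo P := by
  rw [irregularRankLeTwo_iff, irregularRankLeTwo_iff, ord_fn_mul hh, coeff_fn_mul,
    natDegree_mul hh (coeff_ord_ne_zero hP)]
  have : ((h.natDegree + (coeff P (ord P)).natDegree : ℕ) : ℤ) + ord P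
      = (coeff P (ord P)).natDegree + ord P + h.natDegree := by push_cast; ring
  rw [this]
  exact fn_mul_mem_filt_iff hh

theorem newtonSlopes_fn_mul {h : K[X]} (hh : h ≠ 0) {P : Weyl K} {a b c : ℕ} :
    NewtonSlopes (fn h * P) a b c ↔ NewtonSlopes P a b c := by
  have ho : ∀ t : ℤ, fn h * P ∈ filt 0 1 t ↔ P ∈ filt 0 1 t := by
    intro t
    have e : ∀ Q : Weyl K, Q ∈ filt 0 1 t ↔ ∀ k : ℕ, coeff Q k ≠ 0 → (k : ℤ) ≤ t := by
      intro Q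
      constructor
      · intro H k hk
        simpa using H _ _ (leadingCoeff_ne_zero.2 hk)
      · intro H α β hab
        simpa using H β (coeff_ne_zero_of_cf hab)
    rw [e, e]
    refine forall_congr' fun k => ?_
    rw [coeff_fn_mul, mul_ne_zero_iff, and_iff_right hh]
  rw [newtonSlopes_iff, newtonSlopes_iff]
  set e := h.natDegree
  constructor
  · rintro ⟨D, h1, h2, h3, h4, h5, c1, c2, c3⟩
    have hn := coeff_ne_zero_of_cf c3
    rw [coeff_fn_mul] at hn
    have hd : (h * coeff P (a + b + c)).natDegree ≤ D - c := by
      have := natDegree_coeff_le_of_filt h5 (b := a + b + c) (D := D - c) (by push_cast [h1]; linarith)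
      rwa [coeff_fn_mul] at this
    rw [natDegree_mul hh (mul_ne_zero_iff.1 hn).2] at hd
    obtain ⟨D', rfl⟩ : ∃ D', D = e + D' := ⟨D - e, by omega⟩
    have f1 : P ∈ filt 1 0 D' := (fn_mul_mem_filt_iff hh).1 (by rw [add_comm]; exact_mod_cast h2)
    have f4 : P ∈ filt 1 1 (D' + a + b) := (fn_mul_mem_filt_iff hh).1
      (filt_mono (by push_cast; linarith) h5)
    refine ⟨D', by omega, f1, (ho _).1 h3, (fn_mul_mem_filt_iff hh).1
      (filt_mono (by push_cast; linarith) h4), f4, ?_, ?_, ?_⟩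
    · exact (cf_fn_mul_ne_zero_iff h hh (natDegree_coeff_le_of_filt f1 (by simp))).1 c1
    · exact (cf_fn_mul_ne_zero_iff h hh (natDegree_coeff_le_of_filt f1 (by simp))).1 c2
    · rw [Nat.add_sub_assoc (by omega)] at c3
      exact (cf_fn_mul_ne_zero_iff h hh (by omega)).1 c3
  · rintro ⟨D, h1, h2, h3, h4, h5, c1, c2, c3⟩
    have hd := natDegree_coeff_le_of_filt h5 (b := a + b + c) (D := D - c)
      (by push_cast [h1]; linarith)
    refine ⟨e + D, by omega, ?_, (ho _).2 h3, ?_, ?_, ?_, ?_, ?_⟩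
    · have := (fn_mul_mem_filt_iff hh).2 h2
      rw [add_comm] at this; exact_mod_cast this
    · exact filt_mono (by push_cast; linarith) ((fn_mul_mem_filt_iff hh).2 h4)
    · exact filt_mono (by push_cast; linarith) ((fn_mul_mem_filt_iff hh).2 h5)
    · exact (cf_fn_mul_ne_zero_iff h hh (natDegree_coeff_le_of_filt h2 (by simp))).2 c1
    · exact (cf_fn_mul_ne_zero_iff h hh (natDegree_coeff_le_of_filt h2 (by simp))).2 c2
    · rw [Nat.add_sub_assoc h1]
      exact (cf_fn_mul_ne_zero_iff h hh hd).2 c3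

theorem ade_ne_zero {p : K[X]} {P : Weyl K} : ade p P ≠ 0 ↔ P ≠ 0 := by
  refine not_congr ⟨fun h => ?_, fun h => by rw [h, map_zero]⟩
  have := ade_ade (-p) p P
  rwa [h, map_zero, neg_add_cancel, ade_zero, eq_comm] at this

theorem ade_fn_mul (p h : K[X]) (P : Weyl K) : ade p (fn h * P) = fn h * ade p P := by
  rw [map_mul, ade_fn]

theorem OnlySingularAt.ade {P : Weyl K} {p : ℕ} {c : Fin p → K} (h : OnlySingularAt P c)
    (q : K[X]) : OnlySingularAt (Weyl.ade q P) c := by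
  intro k hk
  rw [ord_ade] at hk ⊢
  rw [coeff_ade_ord]
  have e : coeff (Weyl.ade q P) k
      = ∑ b ∈ (symbol P).support, coeff P b * coeff (Weyl.ade q (d ^ b)) k := by
    conv_lhs => rw [eq_sum P]
    rw [map_sum, coeff_sum]
    exact Finset.sum_congr rfl fun b _ => by rw [ade_fn_mul, coeff_fn_mul]
  rw [e, Finset.mul_sum]
  refine Finset.dvd_sum fun b hb => ?_
  have hbn : b ≤ ord P := le_natDegree_of_mem_supp b hb
  by_cases hkb : k ≤ b
  · have := h b hbn
    rw [show ord P - k = (b - k) + (ord P - b) by omega, pow_add]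
    exact (this.mul_left ((∏ j, (X - C (c j))) ^ (b - k) *
      coeff (Weyl.ade q (d ^ b)) k)).trans (dvd_of_eq (by ring))
  · have : coeff (Weyl.ade q (d ^ b)) k = 0 := by
      have hb := monomial_mem_filt (K := K) (u := 0) (v := 1) (t := b) (a := 0) (b := b) (by simp)
      rw [pow_zero, one_mul] at hb
      have hm := ade_mem_filt (by simp) q (by simp) hb
      ext a
      rw [coeff_zero]
      exact cf_eq_zero hm (a := a) (b := k) (by omega)
    rw [this]; simp

end Weyl

open Weyl

section Tables

variable {K : Type*} [Field K] [Algebra ℂ K] {r : ℕ}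

/-- Tables of local data do not change under left multiplication by functions. -/
theorem hasTable_fn_mul {h : K[X]} (hh : h ≠ 0) {P : Weyl K} {T : LocalTable K r} :
    HasTable (fn h * P) T ↔ HasTable P T := by
  by_cases hP : P = 0
  · rw [hP, mul_zero]
  have hA : ∀ p : K[X], ade p P ≠ 0 := fun p => ade_ne_zero.2 hP
  have e1 : ∀ p : K[X], ∀ E, HasTwistedExponents (fn h * P) p E ↔ HasTwistedExponents P p E := by
    intro p E
    unfold HasTwistedExponents
    rw [ade_fn_mul, hasExponentsAtInfinity_fn_mul hh (hA _)]
  have e2 : NormalAtInfinity (fn h * P) T ↔ NormalAtInfinity P T := by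
    simp only [NormalAtInfinity, ade_fn_mul, newtonSlopes_fn_mul hh, ord_fn_mul hh]
  constructor
  · rintro ⟨h1, h2, h3, h4, h5, h6, h7, h8, h9, h10, h11, h12, h13⟩
    rw [onlySingularAt_fn_mul hh] at h5
    rw [irregularRankLeTwo_fn_mul hh hP] at h6
    rw [e2] at h7
    simp only [ord_fn_mul hh, hasExponentsAt_fn_mul hh hP] at h9 h10 h13
    exact ⟨hP, h2, h3, h4, h5, h6, h7, h8, h9, h10, h11, fun i j => (e1 _ _).1 (h12 i j), h13⟩
  · rintro ⟨h1, h2, h3, h4, h5, h6, h7, h8, h9, h10, h11, h12, h13⟩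
    refine ⟨fn_mul_ne_zero hh hP, h2, h3, h4, (onlySingularAt_fn_mul hh).2 h5,
      (irregularRankLeTwo_fn_mul hh hP).2 h6, e2.2 h7, h8, ?_, ?_, h11,
      fun i j => (e1 _ _).2 (h12 i j), ?_⟩
    · simpa only [ord_fn_mul hh] using h9
    · simpa only [ord_fn_mul hh, hasExponentsAt_fn_mul hh hP] using h10
    · rw [ord_fn_mul hh]; exact h13

/-! ### Twisting -/

theorem quadraticPoly_add (a b a' b' : ℂ) :
    quadraticPoly K a b + quadraticPoly K a' b' = quadraticPoly K (a + a') (b + b') := by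
  simp only [quadraticPoly, add_div, map_add]; ring

theorem derivative_quadraticPoly (a b : ℂ) :
    derivative (quadraticPoly K a b) = C (algebraMap ℂ K a) * X + C (algebraMap ℂ K b) := by
  have h : (C (algebraMap ℂ K (a / 2)) * 2 : K[X]) = C (algebraMap ℂ K a) := by
    have : (2 : K[X]) = C (algebraMap ℂ K 2) := by rw [map_ofNat, map_ofNat]
    rw [this, ← C_mul, ← map_mul, div_mul_cancel₀ _ two_ne_zero]
  have h2 : (C (2 : K) : K[X]) = 2 := map_ofNat C 2
  rw [← h]
  simp only [h2, quadraticPoly, derivative_add, derivative_C_mul, derivative_X, derivative_X_pow,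
    Nat.cast_ofNat, Nat.add_one_sub_one, pow_one, mul_one]
  ring

theorem coeff_derivative_neg_quadraticPoly (a b : ℂ) (k : ℕ)
    (h : (derivative (-quadraticPoly K a b)).coeff k ≠ 0) : k ≤ 1 := by
  rw [derivative_neg, coeff_neg, neg_ne_zero, derivative_quadraticPoly] at h
  by_contra hk
  rw [coeff_add, coeff_C_mul, coeff_X, if_neg (by omega), coeff_C, if_neg (by omega)] at h
  simp at h

theorem charZero_of_complex : CharZero K :=
  charZero_of_injective_algebraMap (algebraMap ℂ K).injective

theorem HasTable.ade {P : Weyl K} {T : LocalTable K r} (hT : HasTable P T) (a : ℂ) :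
    HasTable (ade (-quadraticPoly K a 0) P) (T.subAlpha a) := by
  have := charZero_of_complex (K := K)
  have e : ∀ i (β : ℂ), Weyl.ade (-quadraticPoly K (T.α i - a) β)
      (Weyl.ade (-quadraticPoly K a 0) P) = Weyl.ade (-quadraticPoly K (T.α i) β) P := by
    intro i β
    rw [ade_ade, ← neg_add, quadraticPoly_add, sub_add_cancel, add_zero]
  refine ⟨ade_ne_zero.2 hT.ne_zero, hT.c_injective, ?_, hT.β_injective,
    OnlySingularAt.ade hT.only_singular _, ?_,
    ?_, hT.reg_generic, ?_, ?_, hT.inf_generic, ?_, ?_⟩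
  · intro i j hij
    exact hT.α_injective (sub_left_injective hij)
  · have h := irregularRankLeTwo_iff.1 hT.irregular_rank
    rw [irregularRankLeTwo_iff, ord_ade, coeff_ade_ord]
    refine ade_mem_filt (by simp) _ (fun k hk => ?_) h
    have := coeff_derivative_neg_quadraticPoly _ _ k hk
    omega
  · constructor
    · intro i
      change ∃ a' ≤ (T.col i).total, NewtonSlopes (Weyl.ade (-quadraticPoly K (T.α i - a) 0) _) _
        ((T.col i).total - a') (ord _ - (T.col i).total)
      rw [e, ord_ade]
      exact hT.normal.1 i
    · intro i j
      change NewtonSlopes (Weyl.ade (-quadraticPoly K (T.α i - a) ((T.col i).pt j)) _) _ _ _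
      rw [e, ord_ade]
      exact hT.normal.2 i j
  · intro i; rw [ord_ade]; exact hT.reg_total i
  · intro i; rw [ord_ade]; exact (hT.reg_exps i).ade _
  · intro i j
    change HasExponentsAtInfinity (Weyl.ade (-quadraticPoly K (T.α i - a) ((T.col i).pt j)) _) _
    rw [e]
    exact hT.inf_exps i j
  · rw [ord_ade]; exact hT.inf_total

end Tables

namespace Weyl

variable {K : Type*} [Field K]

/-! ### Reduced representatives -/

/-- A reduced representative is primitive: its coefficients have no common factor. -/
theorem IsReduced.isUnit_of_dvd {P Q : Weyl K} (h : IsReduced P Q) {p : K[X]}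
    (hp : ∀ k, p ∣ coeff Q k) : IsUnit p := by
  obtain ⟨hQ, ⟨g, f, hg, hf, e⟩, hmin⟩ := h
  have hp0 : p ≠ 0 := by
    rintro rfl
    exact coeff_ord_ne_zero hQ (zero_dvd_iff.1 (hp _))
  obtain ⟨s, hs⟩ := (Polynomial.C_dvd_iff_dvd_coeff p (symbol Q)).2 hp
  have hQ' : Q = fn p * ofCoeffs s := by
    have : symbol Q = symbol (fn p * ofCoeffs s) := by
      rw [symbol_mul, symbolAction_fn, symbol_ofCoeffs, hs]
    rw [← ofCoeffs_symbol Q, this, ofCoeffs_symbol]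
  have hs0 : ofCoeffs s ≠ 0 := by
    intro h0; rw [h0, mul_zero] at hQ'; exact hQ hQ'
  have := hmin (ofCoeffs s) hs0 ⟨g * p, f, mul_ne_zero hg hp0, hf, by
    rw [fn_mul, mul_assoc, ← hQ', e]⟩
  rw [hQ', deg_fn_mul hp0 hs0] at this
  exact isUnit_iff_degree_eq_zero.2 ((degree_eq_iff_natDegree_eq hp0).2
    (by change p.natDegree = 0; omega))

theorem phi_natCast_eq_zero (P : Weyl K) {k : ℕ} {n : ℤ} (h : k + n < 0) :
    phi (k : K) n P = 0 := by
  induction P using induction_mul_left generalizing n with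
  | one => rw [phi_one, if_neg (by omega)]
  | add P Q hP hQ => rw [map_add, hP h, hQ h, add_zero]
  | smul r P hP => rw [map_smul, hP h, smul_zero]
  | x_mul P hP => rw [phi_x_mul, hP (by omega)]
  | d_mul P hP =>
    rw [phi_d_mul]
    by_cases h' : k + n + 1 = 0
    · have : (k : K) + n + 1 = 0 := by exact_mod_cast congrArg (Int.cast (R := K)) h'
      rw [this, zero_mul]
    · rw [hP (by omega), mul_zero]

theorem phi_natCast_neg (P : Weyl K) (k : ℕ) :
    phi (k : K) (-k) P = (k.factorial : K) * cf 0 k P := by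
  rw [phi_eq_sum _ _ P (N := max (ord P) k + 1) (by omega),
    Finset.sum_eq_single_of_mem k (Finset.mem_range.2 (by omega))]
  · simp [descPochhammer_eval_eq_descFactorial, Nat.descFactorial_self]
  · intro b _ hb
    rw [descPochhammer_eval_eq_descFactorial]
    rcases lt_or_gt_of_ne hb with hb | hb
    · rw [if_neg (by omega), mul_zero]
    · rw [Nat.descFactorial_eq_zero_iff_lt.2 hb]; simp

/-- On the line `a - b = n` of the support, the coefficient of `x^(ν+n)` in `P x^ν` is a polynomial
in `ν`, whose degree is the largest `b` that occurs. -/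
theorem exists_polynomial_phi (P : Weyl K) {a m : ℕ} {n : ℤ} (ha : (a : ℤ) - m = n)
    (h : ∀ a b : ℕ, m < b → (a : ℤ) - b = n → cf a b P = 0) (hne : cf a m P ≠ 0) :
    ∃ p : K[X], p ≠ 0 ∧ p.natDegree ≤ m ∧ ∀ ν, p.eval ν = phi ν n P := by
  set p : K[X] := ∑ b ∈ Finset.range (m + 1),
    C (if 0 ≤ n + b then cf (n + b).toNat b P else 0) * descPochhammer K b with hp
  have hdeg : ∀ (r : K) (b : ℕ), (C r * descPochhammer K b).natDegree ≤ b := fun r b =>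
    (natDegree_C_mul_le _ _).trans (by rw [descPochhammer_natDegree])
  refine ⟨p, fun h0 => ?_, natDegree_sum_le_of_forall_le _ _ fun b hb =>
    (hdeg _ b).trans (Finset.mem_range_succ_iff.1 hb), fun ν => ?_⟩
  · have hc : p.coeff m = cf a m P := by
      rw [hp, finsetSum_coeff, Finset.sum_range_succ, Finset.sum_eq_zero, zero_add, coeff_C_mul,
        if_pos (by omega)]
      · have := (monic_descPochhammer K m).coeff_natDegree
        rw [descPochhammer_natDegree] at this
        rw [this, mul_one]
        congr 1
        congr 1
        omega
      · intro b hb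
        exact coeff_eq_zero_of_natDegree_lt ((hdeg _ b).trans_lt (Finset.mem_range.1 hb))
    rw [h0, coeff_zero] at hc
    exact hne hc.symm
  · rw [phi_eq_sum ν n P (N := max (ord P) m + 1) (by omega), hp, eval_finsetSum]
    simp only [eval_mul, eval_C, mul_comm (eval ν _)]
    refine Finset.sum_subset (fun b hb => ?_) fun b hb hb' => ?_
    · rw [Finset.mem_range] at hb ⊢; omega
    · rw [Finset.mem_range] at hb'
      split_ifs with h'
      · rw [h _ b (by omega) (by omega), zero_mul]
      · rw [zero_mul]

end Weyl

/-- A nonzero polynomial of degree at most `m₁ + ⋯ + mₜ` that vanishes on all `[eᵢ]_{mᵢ}` has no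
other roots. -/
theorem Exponents.NonIntegralDifferences.mem_of_eval_eq_zero {K : Type*} [Field K] [CharZero K]
    {E : Exponents K} (hE : E.NonIntegralDifferences) {p : K[X]} (hp : p ≠ 0)
    (hdeg : p.natDegree ≤ E.total) (h : ∀ i, ∀ j < E.mult i, p.eval (E.exp i + (j : K)) = 0)
    {z : K} (hz : p.eval z = 0) : ∃ i, ∃ j < E.mult i, z = E.exp i + (j : K) := by
  classical
  by_contra! hz'
  let S : Finset (Σ _ : Fin E.len, ℕ) := Finset.univ.sigma fun i => Finset.range (E.mult i)
  let f : (Σ _ : Fin E.len, ℕ) → K := fun s => E.exp s.1 + (s.2 : K)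
  have hf : Function.Injective f := by
    rintro ⟨i, j⟩ ⟨i', j'⟩ hij
    change E.exp i + (j : K) = E.exp i' + (j' : K) at hij
    by_cases hi : i = i'
    · subst hi
      have : j = j' := by exact_mod_cast add_left_cancel hij
      rw [this]
    · exact absurd (by push_cast; linear_combination hij) (hE i i' hi (j' - j))
  have hcard : (S.image f).card = E.total := by
    rw [Finset.card_image_of_injective _ hf, Finset.card_sigma]
    simp [Exponents.total]
  have hzS : z ∉ S.image f := by
    rw [Finset.mem_image]
    rintro ⟨⟨i, j⟩, hij, rfl⟩
    exact hz' i j (Finset.mem_range.1 (Finset.mem_sigma.1 hij).2) rfl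
  have := card_le_degree_of_subset_roots (p := p) (Z := insert z (S.image f)) (by
    intro w hw
    rw [mem_roots hp]
    rcases Finset.mem_insert.1 hw with rfl | hw
    · exact hz
    · obtain ⟨⟨i, j⟩, hij, rfl⟩ := Finset.mem_image.1 hw
      exact h i j (Finset.mem_range.1 (Finset.mem_sigma.1 hij).2))
  rw [Finset.card_insert_of_notMem hzS, hcard] at this
  omega

namespace Weyl

variable {K : Type*} [Field K]

theorem cf_rootMultiplicity_ne_zero {p : K[X]} (hp : p ≠ 0) :
    p.coeff (rootMultiplicity 0 p) ≠ 0 := by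
  rw [rootMultiplicity_eq_natTrailingDegree']
  exact (trailingCoeff_nonzero_iff_nonzero).2 hp

/-- The leading coefficient of a primitive operator with exponents `{[0]_{m₀}, [e₁]_{m₁}, …}` at
`c` vanishes at `c` exactly to the order `m₁ + ⋯ + mₜ`. A smaller order would make `m₀` a further
root of the indicial polynomial, a larger one would make `x - c` divide all coefficients. -/
theorem rootMultiplicity_eq_total [CharZero K] {Q : Weyl K} (hQ : Q ≠ 0)
    (hprim : ∀ p : K[X], (∀ k, p ∣ coeff Q k) → IsUnit p) {c : K} {E : Exponents K}
    (hE : E.IsGeneric) (htot : E.total ≤ ord Q)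
    (h : HasExponentsAt Q c (E.consZero (ord Q - E.total))) :
    rootMultiplicity c (coeff Q (ord Q)) = E.total := by
  rw [← hasExponentsAt_translate] at h
  set P := translate c Q with hP
  set n := ord Q with hn
  have hPn : ord P = n := ord_translate c Q
  have hP0 : coeff P n ≠ 0 := by
    rw [hP, coeff_translate]
    exact fun h => coeff_ord_ne_zero hQ (comp_X_add_C_eq_zero_iff.1 h)
  have hN : rootMultiplicity c (coeff Q n) = rootMultiplicity 0 (coeff P n) := by
    rw [hP, coeff_translate, rootMultiplicity_eq_rootMultiplicity (t := c)]
  rw [hN]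
  obtain ⟨h1, h2, h3, h4⟩ := (hasExponentsAt_zero_iff rfl).1 h
  rw [hPn] at h1 h2 h4
  set N := rootMultiplicity 0 (coeff P n) with hNdef
  set E' := E.consZero (n - E.total) with hE'
  apply le_antisymm
  · by_contra hlt
    push Not at hlt
    have hdvd : ∀ k, (X - C c) ∣ coeff Q k := by
      intro k
      have hk0 : cf 0 k P = 0 := by
        by_cases hk : k < n - E.total
        · have := h4 (0 : Fin (E.len + 1)) k hk (-k) (by
            change (-(k : ℤ)) + k < (N : ℤ) - n + ((n - E.total : ℕ) : ℤ)
            omega)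
          change phi ((0 : K) + (k : K)) (-k) P = 0 at this
          rw [zero_add, phi_natCast_neg] at this
          exact (mul_eq_zero.1 this).resolve_left (by exact_mod_cast k.factorial_ne_zero)
        · exact cf_eq_zero h1 (by push_cast; omega)
      have := (X_sub_C_pow_dvd_iff (t := c) (n := 1) (p := coeff Q k)).2 (by
        rw [pow_one, X_dvd_iff, ← coeff_translate]; exact hk0)
      rwa [pow_one] at this
    exact not_isUnit_X_sub_C c (hprim _ hdvd)
  · by_contra hlt
    push Not at hlt
    obtain ⟨p, hp0, hpdeg, hp⟩ := exists_polynomial_phi P (a := N) (m := n) (n := (N : ℤ) - n) rfl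
      (fun a b hb _ => by
        rw [cf_apply, coeff_eq_zero_of_ord_lt (by omega), coeff_zero])
      (by rw [cf_apply, hNdef]; exact cf_rootMultiplicity_ne_zero hP0)
    obtain ⟨i, j, hj, hz⟩ := h3.mem_of_eval_eq_zero hp0 (by rw [h2]; exact hpdeg)
      (fun i j hj => by rw [hp]; exact h4 i j hj _ (by omega))
      (z := ((n - E.total : ℕ) : K)) (by rw [hp]; exact phi_natCast_eq_zero P (by omega))
    revert hj hz
    refine Fin.cases ?_ (fun i => ?_) i
    · intro hj hz
      change j < n - E.total at hj
      change ((n - E.total : ℕ) : K) = 0 + (j : K) at hz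
      rw [zero_add] at hz
      have : n - E.total = j := by exact_mod_cast hz
      omega
    · intro _ hz
      change ((n - E.total : ℕ) : K) = E.exp i + (j : K) at hz
      refine hE.2.1 i (((n - E.total : ℕ) : ℤ) - j) ?_
      rw [Int.cast_sub, Int.cast_natCast, Int.cast_natCast, hz]
      ring

/-- An irreducible factor of the leading coefficient of a primitive operator without other finite
singular points than the `cᵢ` is one of the `x - cᵢ`. -/
theorem irreducible_dvd_prod {Q : Weyl K} (hprim : ∀ p : K[X], (∀ k, p ∣ coeff Q k) → IsUnit p)
    {p : ℕ} {c : Fin p → K} (hsing : OnlySingularAt Q c) {π : K[X]} (hπ : Irreducible π)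
    (hd : π ∣ coeff Q (ord Q)) : π ∣ ∏ i, (X - C (c i)) := by
  by_contra hπA
  refine hπ.not_isUnit (hprim π fun k => ?_)
  by_cases hk : k ≤ ord Q
  · exact (hπ.prime.dvd_or_dvd (hd.trans (hsing k hk))).resolve_left
      fun h => hπA (hπ.prime.dvd_of_dvd_pow h)
  · rw [coeff_eq_zero_of_ord_lt (not_le.1 hk)]; exact dvd_zero _

/-- The degree of the leading coefficient of a primitive operator without other finite singular
points than the `cᵢ` is the sum of its orders of vanishing there. -/
theorem natDegree_coeff_ord {Q : Weyl K} (hQ : Q ≠ 0)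
    (hprim : ∀ p : K[X], (∀ k, p ∣ coeff Q k) → IsUnit p) {p : ℕ} {c : Fin p → K}
    (hc : Function.Injective c) (hsing : OnlySingularAt Q c) :
    (coeff Q (ord Q)).natDegree = ∑ i, rootMultiplicity (c i) (coeff Q (ord Q)) := by
  set q := coeff Q (ord Q) with hq
  have hq0 : q ≠ 0 := coeff_ord_ne_zero hQ
  have hcop : Pairwise (Function.onFun IsCoprime fun i => X - C (c i)) := pairwise_coprime_X_sub_C hc
  set B : K[X] := ∏ i, (X - C (c i)) ^ rootMultiplicity (c i) q with hB
  obtain ⟨u, hu⟩ : B ∣ q := Fintype.prod_dvd_of_coprime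
    (fun i j hij => (hcop hij).pow) fun i => pow_rootMultiplicity_dvd q (c i)
  have hu0 : u ≠ 0 := by rintro rfl; rw [mul_zero] at hu; exact hq0 hu
  have hunit : IsUnit u := by
    by_contra hnu
    obtain ⟨π, hπ, hπu⟩ := WfDvdMonoid.exists_irreducible_factor hnu hu0
    by_cases hπA : π ∣ ∏ i, (X - C (c i))
    · obtain ⟨i, -, hi⟩ := (hπ.prime.dvd_finsetProd_iff _).1 hπA
      have hass : (X - C (c i)) ∣ u :=
        (((irreducible_X_sub_C (c i)).dvd_comm hπ).2 hi).trans hπu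
      have : (X - C (c i)) ^ (rootMultiplicity (c i) q + 1) ∣ q := by
        rw [pow_succ]
        nth_rewrite 2 [hu]
        exact mul_dvd_mul (Finset.dvd_prod_of_mem
          (fun i => (X - C (c i)) ^ rootMultiplicity (c i) q) (Finset.mem_univ i)) hass
      have := (le_rootMultiplicity_iff hq0).2 this
      omega
    · exact hπA (irreducible_dvd_prod hprim hsing hπ (hπu.trans (Dvd.intro_left B hu.symm)))
  have hBm : B.natDegree = ∑ i, rootMultiplicity (c i) q := by
    rw [hB, natDegree_prod _ _ fun i _ => pow_ne_zero _ (X_sub_C_ne_zero _)]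
    simp [natDegree_pow]
  have hB0 : B ≠ 0 := by intro h0; rw [h0, zero_mul] at hu; exact hq0 hu
  rw [hu, natDegree_mul hB0 hu0, natDegree_eq_zero_of_isUnit hunit, add_zero, ← hu, hBm]

end Weyl

namespace Exponents

variable {K : Type*} [Field K]

theorem total_consZero (m : ℕ) (E : Exponents K) : (E.consZero m).total = m + E.total := by
  unfold total consZero
  rw [Fin.sum_univ_succ]
  simp

theorem IsGeneric.consZero {E : Exponents K} (hE : E.IsGeneric) (m : ℕ) :
    (E.consZero m).NonIntegralDifferences := by
  intro i j
  refine Fin.cases ?_ (fun i => ?_) i <;> refine Fin.cases ?_ (fun j => ?_) j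
  · intro h; exact absurd rfl h
  · intro _ z hz
    change 0 - E.exp j = z at hz
    exact hE.2.1 j (-z) (by push_cast; linear_combination -hz)
  · intro _ z hz
    change E.exp i - 0 = z at hz
    exact hE.2.1 i z (by linear_combination hz)
  · intro h z hz
    exact hE.2.2 i j (fun h' => h (by rw [h'])) z hz

theorem IsGeneric.map {E : Exponents K} (hE : E.IsGeneric) {f : K → K} (s : ℤ)
    (hf : ∀ e, f e = e + s) : (E.map f).IsGeneric := by
  refine ⟨hE.1, fun i z hz => ?_, fun i j hij z hz => ?_⟩
  · change f (E.exp i) = z at hz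
    rw [hf] at hz
    exact hE.2.1 i (z - s) (by push_cast; linear_combination hz)
  · change f (E.exp i) - f (E.exp j) = z at hz
    rw [hf, hf] at hz
    exact hE.2.2 i j hij z (by linear_combination hz)

end Exponents

namespace Weyl

variable {K : Type*} [Field K]

/-! ### The exchange of finite points and points at infinity -/

theorem rootMultiplicity_zero_eq {p : K[X]} {m : ℕ} (h : ∀ a < m, p.coeff a = 0)
    (hm : p.coeff m ≠ 0) : rootMultiplicity 0 p = m := by
  have hp : p ≠ 0 := by rintro rfl; simp at hm
  apply le_antisymm
  · by_contra hlt
    have := (le_rootMultiplicity_iff hp).1 (not_le.1 hlt : m + 1 ≤ _)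
    rw [C_0, sub_zero, X_pow_dvd_iff] at this
    exact hm (this m (Nat.lt_succ_self m))
  · rw [le_rootMultiplicity_iff hp, C_0, sub_zero, X_pow_dvd_iff]
    exact h

theorem hasExponentsAt_consZero {P : Weyl K} {n : ℕ} (hn : ord P = n) {E : Exponents K}
    (hE : E.IsGeneric) (hm : E.total ≤ n) (h1 : P ∈ filt (-1) 1 (n - E.total))
    (h2 : cf E.total n P ≠ 0) (h3 : ExpCond P (E.total - n) E) :
    rootMultiplicity 0 (coeff P n) = E.total ∧ HasExponentsAt P 0 (E.consZero (n - E.total)) := by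
  have hr : rootMultiplicity 0 (coeff P n) = E.total :=
    rootMultiplicity_zero_eq (fun a ha => cf_eq_zero h1 (by omega)) h2
  refine ⟨hr, (hasExponentsAt_zero_iff (l := (E.total : ℤ) - n) (by rw [hn, hr])).2
    ⟨by rwa [neg_sub], ?_, hE.consZero _, ?_⟩⟩
  · rw [Exponents.total_consZero, hn]; omega
  · intro i
    refine Fin.cases ?_ (fun i => ?_) i
    · intro j _ k hk
      change k + (j : ℤ) < (E.total : ℤ) - n + ((n - E.total : ℕ) : ℤ) at hk
      change phi ((0 : K) + (j : K)) k P = 0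
      rw [zero_add]
      exact phi_natCast_eq_zero P (by omega)
    · exact h3 i

theorem deg_le_iff {P : Weyl K} {D : ℕ} : deg P ≤ D ↔ P ∈ filt 1 0 D := by
  refine ⟨fun h => filt_mono (by exact_mod_cast h) mem_filt_deg, fun h => ?_⟩
  exact Finset.sup_le fun k _ => natDegree_coeff_le_of_filt h (by simp)

theorem deg_ade_linear (β : K) (P : Weyl K) : deg (ade (-(C β * X)) P) = deg P := by
  have key : ∀ (γ : K) (S : Weyl K), deg (ade (C γ * X) S) ≤ deg S := by
    intro γ S
    rw [deg_le_iff]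
    refine ade_mem_filt (by simp) _ (fun a ha => ?_) mem_filt_deg
    rw [derivative_C_mul, derivative_X, mul_one, coeff_C] at ha
    split_ifs at ha with h
    · simp [h]
    · exact absurd rfl ha
  apply le_antisymm
  · have := key (-β) P
    rwa [C_neg, neg_mul] at this
  · have := key β (ade (-(C β * X)) P)
    rwa [ade_ade, add_neg_cancel, ade_zero] at this

/-- The total multiplicity at infinity is at most the degree, because otherwise `0` would be a
further root of the indicial polynomial at infinity. -/
theorem HasExponentsAtInfinity.total_le_deg [CharZero K] {P : Weyl K} {E : Exponents K}
    (h : HasExponentsAtInfinity P E) (hE : E.IsGeneric) : E.total ≤ deg P := by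
  by_contra hlt
  push Not at hlt
  obtain ⟨h1, h2, h3, h4⟩ := (hasExponentsAtInfinity_iff rfl).1 h
  obtain ⟨p, hp0, hpd, hp⟩ := exists_polynomial_phi P (n := (deg P : ℤ) - E.total) rfl
    (fun a b hb hab => cf_eq_zero mem_filt_deg (by omega)) h2
  have hcomp : p.comp (-X) ≠ 0 := by
    intro h0
    apply hp0
    have := congrArg (fun q => q.comp (-X)) h0
    simpa [comp_assoc] using this
  obtain ⟨i, j, _, hz⟩ := h3.mem_of_eval_eq_zero hcomp
    (by rw [natDegree_comp]; simpa using hpd) (z := 0) (fun i j hj => by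
      rw [eval_comp, hp]
      simp only [eval_neg, eval_X, neg_add, ← sub_eq_add_neg]
      exact h4 i j hj _ (by omega)) (by
      rw [eval_comp, hp]
      simp only [eval_neg, eval_X, neg_zero]
      have := phi_natCast_eq_zero P (k := 0) (n := (deg P : ℤ) - E.total) (by omega)
      rwa [Nat.cast_zero] at this)
  exact hE.2.1 i (-j) (by push_cast; linear_combination -hz)

/-- Exponents at infinity, twisted by `e^{βx}`, become exponents of the Fourier-Laplace transform
at the finite point `β`. -/
theorem HasExponentsAtInfinity.laplace [CharZero K] {P : Weyl K} {β : K} {E : Exponents K}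
    (h : HasExponentsAtInfinity (ade (-(C β * X)) P) E) (hE : E.IsGeneric)
    (ho : ord (laplace P) = deg P) :
    E.total ≤ deg P ∧ rootMultiplicity β (coeff (laplace P) (deg P)) = E.total ∧
    HasExponentsAt (laplace P) β ((E.map fun e => e - 1).consZero (deg P - E.total)) := by
  have hle := h.total_le_deg hE
  rw [deg_ade_linear] at hle
  set A := ade (-(C β * X)) P with hA
  have hAd : deg A = deg P := deg_ade_linear β P
  obtain ⟨h1, h2, h3, h4⟩ := (hasExponentsAtInfinity_iff rfl).1 h
  rw [hAd] at h1 h2 h4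
  have htr : translate β (Weyl.laplace P) = Weyl.laplace A := (laplace_ade_linear β P).symm
  have hAo : ord (Weyl.laplace A) = deg P := by rw [← htr, ord_translate, ho]
  have hmap : (E.map fun e => e - 1).total = E.total := rfl
  have hc : cf E.total (deg P) (Weyl.laplace A) ≠ 0 := by
    rw [cf_laplace (u := 1) (v := 0) (t := deg P) (by simp) (by rw [← hAd]; exact mem_filt_deg)
      (by simp)]
    exact mul_ne_zero (by simp) h2
  have h5 : ExpCond (Weyl.laplace A) (-((deg P : ℤ) - E.total)) (E.map fun e => e - 1) :=
    (expCond_laplace hE.2.1).2 h4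
  obtain ⟨k1, k2⟩ := hasExponentsAt_consZero hAo (E := E.map fun e => e - 1)
    (hE.map (-1) fun e => by push_cast; ring) hle (laplace_mem_filt (by simp) h1) hc
    (by rw [neg_sub] at h5; exact h5)
  refine ⟨hle, ?_, ?_⟩
  · rw [rootMultiplicity_eq_rootMultiplicity, ← coeff_translate, htr, k1, hmap]
  · rw [← hasExponentsAt_translate, htr]; exact k2

/-- Exponents at the finite point `c` become exponents at infinity of the Fourier-Laplace
transform, twisted by `e^{-cx}`. -/
theorem HasExponentsAt.laplace {P : Weyl K} {c : K} {E : Exponents K} (hE : E.IsGeneric)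
    (h : HasExponentsAt P c (E.consZero (ord P - E.total)))
    (hr : rootMultiplicity c (coeff P (ord P)) = E.total) (hP : P ≠ 0) :
    cf E.total (ord P) (translate c P) ≠ 0 ∧
    translate c P ∈ filt (-1) 1 (ord P - E.total) ∧
    HasExponentsAtInfinity (Weyl.ade (C c * X) (Weyl.laplace P)) (E.map fun e => e + 1) := by
  rw [ade_laplace]
  rw [← hasExponentsAt_translate] at h
  rw [rootMultiplicity_eq_rootMultiplicity, ← coeff_translate] at hr
  set A := translate c P
  have hAo : ord A = ord P := ord_translate c P
  have hA0 : A ≠ 0 := by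
    intro h0
    have : translate (-c) A = P := by
      change translate (-c) (translate c P) = P
      rw [translate_translate, neg_add_cancel]
      conv_rhs => rw [← AlgHom.id_apply (R := K) P]
      congr 1
      exact algHom_ext (by simp [translate_x]) (by simp [translate_d])
    rw [h0, map_zero] at this
    exact hP this.symm
  have hc : cf E.total (ord P) A ≠ 0 := by
    rw [← hr, cf_apply]
    exact cf_rootMultiplicity_ne_zero (by rw [← hAo]; exact coeff_ord_ne_zero hA0)
  obtain ⟨h1, h2, h3, h4⟩ := (hasExponentsAt_zero_iff rfl).1 h
  rw [hAo, hr] at h1 h4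
  have h5 : ExpCond A ((E.total : ℤ) - ord P) E := fun i => h4 i.succ
  rw [neg_sub] at h1
  refine ⟨hc, h1, ?_⟩
  have hf : Weyl.laplace A ∈ filt 1 0 (ord P) :=
    laplace_mem_filt (by simp) (by rw [← hAo]; exact mem_filt_ord)
  have hc' : cf (ord P) E.total (Weyl.laplace A) ≠ 0 := by
    rw [cf_laplace (u := 0) (v := 1) (t := ord P) (by simp) (by rw [← hAo]; exact mem_filt_ord)
      (by simp)]
    exact mul_ne_zero (by simp) hc
  have hd : deg (Weyl.laplace A) = ord P := deg_eq_of_filt hf hc'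
  have hmap : (E.map fun e => e + 1).total = E.total := rfl
  refine (hasExponentsAtInfinity_iff (t := -((E.total : ℤ) - ord P)) ?_).2
    ⟨?_, ?_, (hE.map 1 fun e => by push_cast; ring).2.2, (infExpCond_laplace hE.2.1).2 h5⟩
  · rw [hd, hmap]; ring
  · rw [neg_sub]; exact laplace_mem_filt (by simp) h1
  · rw [hd, hmap]; exact hc'

end Weyl

open Weyl

section Stationary

variable {K : Type*} [Field K] [Algebra ℂ K]

theorem coAde_quadraticPoly_x (a b : ℂ) : coAde (quadraticPoly K a b) (x : Weyl K)
    = x + algebraMap ℂ K a • d - algebraMap K _ (algebraMap ℂ K b) := by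
  rw [coAde_x, derivative_quadraticPoly, map_add, map_mul, aeval_X, aeval_C, aeval_C, mul_neg,
    Algebra.smul_def]
  abel

theorem coAde_quadraticPoly_mem_filt {u v t : ℤ} (huv : 0 ≤ u + v) (hvu : v ≤ u) (hu : 0 ≤ u)
    (a b : ℂ) {P : Weyl K} (hP : P ∈ filt u v t) : coAde (quadraticPoly K a b) P ∈ filt u v t := by
  refine map_mem_filt huv _ ?_ ?_ hP
  · rw [coAde_quadraticPoly_x]
    exact Submodule.sub_mem _ (Submodule.add_mem _ (x_mem_filt le_rfl)
      (Submodule.smul_mem _ _ (d_mem_filt hvu))) (algebraMap_mem_filt hu _)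
  · rw [coAde_d]; exact d_mem_filt le_rfl

theorem cf_coAde_quadraticPoly {D : ℕ} (a b : ℂ) {P : Weyl K} (hP : P ∈ filt 1 0 D) (k : ℕ) :
    cf D k (coAde (quadraticPoly K a b) P) = cf D k P := by
  refine cf_map_eq (u := 1) (v := 0) (by simp) _ ?_ ?_ hP (by simp)
  · rw [coAde_quadraticPoly_x]
    have e : (x : Weyl K) + algebraMap ℂ K a • d - algebraMap K _ (algebraMap ℂ K b) - x
        = algebraMap ℂ K a • d - algebraMap K _ (algebraMap ℂ K b) := by abel
    rw [e]
    exact Submodule.sub_mem _ (Submodule.smul_mem _ _ (d_mem_filt (by simp)))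
      (algebraMap_mem_filt (by simp) _)
  · rw [coAde_d, sub_self]; exact Submodule.zero_mem _

/-- A twisting by `e^{-αx²/2-βx}` before the Fourier-Laplace transform corresponds to the twisting
by `e^{x²/(2α)-(β/α)x}` after it, up to a dilation and a twisting in the dual variable. -/
theorem ade_laplace_quadraticPoly {α : ℂ} (β : ℂ) {u : Kˣ}
    (hu : (u : K) = algebraMap ℂ K α) (P : Weyl K) :
    ade (-quadraticPoly K (-1 / α) (β / α)) (laplace P)
      = dilate u (coAde (quadraticPoly K (-1 / α) (β / α)) (ade (-quadraticPoly K α β) P)) := by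
  have hα' : algebraMap ℂ K α ≠ 0 := by rw [← hu]; exact u.ne_zero
  have key : ((ade (-quadraticPoly K (-1 / α) (β / α))).comp
      (laplace : Weyl K ≃ₐ[K] Weyl K).toAlgHom).comp (ade (quadraticPoly K α β))
      = (dilate u).comp (coAde (quadraticPoly K (-1 / α) (β / α))) := by
    apply Weyl.algHom_ext
    · change ade _ (laplace (ade _ x)) = dilate u (coAde _ x)
      rw [ade_x, laplace_x, map_neg, ade_d, coAde_quadraticPoly_x, map_sub, map_add, map_smul,
        dilate_x, dilate_d, AlgHom.commutes, derivative_neg, derivative_quadraticPoly, hu, smul_smul,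
        fn, map_neg, map_add, map_mul, aeval_C, aeval_C, aeval_X, ← Algebra.smul_def, map_div₀,
        map_div₀, map_neg, map_one, div_mul_cancel₀ _ hα', neg_one_smul, neg_div, one_div]
      module
    · change ade _ (laplace (ade _ d)) = dilate u (coAde _ d)
      have hl : laplace (fn (C (algebraMap ℂ K α) * X + C (algebraMap ℂ K β)) : Weyl K)
          = -(algebraMap ℂ K α • d) + algebraMap K _ (algebraMap ℂ K β) := by
        rw [fn_add, fn_mul, fn_C, fn_C, fn_X, ← Algebra.smul_def, map_add, map_smul, laplace_x,
          AlgEquiv.commutes, smul_neg]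
      have hb : algebraMap ℂ K α • algebraMap K (Weyl K) (algebraMap ℂ K β / algebraMap ℂ K α)
          = algebraMap K _ (algebraMap ℂ K β) := by
        rw [Algebra.smul_def, ← map_mul, mul_div_cancel₀ _ hα']
      have hx : algebraMap ℂ K α • (-1 / algebraMap ℂ K α) • (x : Weyl K) = -x := by
        rw [smul_smul, mul_div_cancel₀ _ hα', neg_one_smul]
      rw [ade_d, map_sub, laplace_d, derivative_quadraticPoly, hl, map_sub, ade_x, map_add, map_neg,
        map_smul, AlgHom.commutes, ade_d, coAde_d, dilate_d, hu, derivative_neg,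
        derivative_quadraticPoly, fn, map_neg, map_add, map_mul, aeval_C, aeval_C, aeval_X,
        ← Algebra.smul_def, map_div₀, map_div₀, map_neg, map_one, sub_neg_eq_add, smul_add,
        smul_add, hb, hx]
      abel
  have := DFunLike.congr_fun key (ade (-quadraticPoly K α β) P)
  change ade _ (laplace (ade _ (ade _ P))) = _ at this
  rw [ade_ade, add_neg_cancel, ade_zero] at this
  exact this

theorem Weyl.HasExponentsAtInfinity.coAde {P : Weyl K} {E : Exponents K} (hE : E.IsGeneric)
    (h : HasExponentsAtInfinity P E) (a b : ℂ) (u : Kˣ) :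
    HasExponentsAtInfinity (dilate u (Weyl.coAde (quadraticPoly K a b) P)) E := by
  have := charZero_of_complex (K := K)
  obtain ⟨h1, h2, h3, h4⟩ := (hasExponentsAtInfinity_iff rfl).1 h
  have hf : dilate u (Weyl.coAde (quadraticPoly K a b) P) ∈ filt 1 0 (deg P) :=
    dilate_mem_filt (coAde_quadraticPoly_mem_filt (by simp) (by simp) (by simp) _ _ mem_filt_deg)
  have hc : cf (deg P) E.total (dilate u (Weyl.coAde (quadraticPoly K a b) P)) ≠ 0 := by
    rw [cf_dilate_ne_zero, cf_coAde_quadraticPoly _ _ mem_filt_deg]; exact h2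
  have hd := deg_eq_of_filt hf hc
  refine (hasExponentsAtInfinity_iff (t := (deg P : ℤ) - E.total) (by rw [hd])).2
    ⟨?_, by rw [hd]; exact hc, h3, ?_⟩
  · exact dilate_mem_filt (coAde_quadraticPoly_mem_filt (by simp) (by simp) (by simp) _ _ h1)
  · exact (h4.coAde hE.2.1 h1 _).dilate u

end Stationary

section Transform

variable {K : Type*} [Field K] [Algebra ℂ K] {r : ℕ}

/-! ### The table of the Fourier-Laplace transform -/

theorem quadraticPoly_zero_left (β : ℂ) : quadraticPoly K 0 β = C (algebraMap ℂ K β) * X := by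
  simp [quadraticPoly]

theorem neg_quadraticPoly_zero_neg (c : ℂ) :
    -quadraticPoly K 0 (-c) = C (algebraMap ℂ K c) * X := by
  simp [quadraticPoly]

namespace HasTable

variable {Q : Weyl K} {T : LocalTable K r} {i₀ : Fin r}

theorem col_total_le (hT : HasTable Q T) (i : Fin r) : (T.col i).total ≤ ord Q := by
  rw [← hT.inf_total]
  exact Finset.single_le_sum (f := fun i => (T.col i).total) (fun _ _ => Nat.zero_le _)
    (Finset.mem_univ i)

theorem col_total_add_le (hT : HasTable Q T) {i j : Fin r} (hij : i ≠ j) :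
    (T.col i).total + (T.col j).total ≤ ord Q := by
  classical
  rw [← hT.inf_total, ← Finset.sum_pair (f := fun i => (T.col i).total) hij]
  exact Finset.sum_le_sum_of_subset (Finset.subset_univ _)

theorem rootMultiplicity_eq (hT : HasTable Q T)
    (hprim : ∀ p : K[X], (∀ k, p ∣ coeff Q k) → IsUnit p) (i : Fin T.reg.len) :
    rootMultiplicity (algebraMap ℂ K (T.reg.pt i)) (coeff Q (ord Q)) = (T.reg.exps i).total :=
  have := charZero_of_complex (K := K)
  rootMultiplicity_eq_total hT.ne_zero hprim (hT.reg_generic i) (hT.reg_total i) (hT.reg_exps i)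

theorem natDegree_lead (hT : HasTable Q T)
    (hprim : ∀ p : K[X], (∀ k, p ∣ coeff Q k) → IsUnit p) :
    (coeff Q (ord Q)).natDegree = T.reg.total := by
  rw [natDegree_coeff_ord hT.ne_zero hprim
    ((algebraMap ℂ K).injective.comp hT.c_injective) hT.only_singular]
  exact Finset.sum_congr rfl fun i _ => hT.rootMultiplicity_eq hprim i

/-- The corner of the Newton polygon where the slope `2` begins, together with the degree of the
leading coefficient, gives the degree of the reduced representative. -/
theorem deg_eq (hT : HasTable Q T) (hprim : ∀ p : K[X], (∀ k, p ∣ coeff Q k) → IsUnit p)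
    (hα : T.α i₀ = 0) : deg Q = T.reg.total + (ord Q - (T.col i₀).total) ∧
      Q ∈ filt 1 1 (T.reg.total + ord Q) ∧ cf (deg Q) (T.col i₀).total Q ≠ 0 := by
  obtain ⟨a, ha, hs⟩ := hT.normal.1 i₀
  rw [hα, quadraticPoly_zero_left, map_zero, C_0, zero_mul, neg_zero, ade_zero] at hs
  obtain ⟨D, h1, h2, h3, h4, h5, c1, c2, c3⟩ := newtonSlopes_iff.1 hs
  have hle := hT.col_total_le i₀
  have hM := hT.natDegree_lead hprim
  have e1 : a + ((T.col i₀).total - a) = (T.col i₀).total := by omega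
  have e2 : a + ((T.col i₀).total - a) + (ord Q - (T.col i₀).total) = ord Q := by omega
  rw [e1] at c2
  rw [e2] at c3
  have hd := le_natDegree_coeff c3
  have hd' := natDegree_coeff_le_of_filt h5 (b := ord Q) (D := D - (ord Q - (T.col i₀).total))
    (by push_cast [ha, h1, hle]; linarith)
  have hD : deg Q = D := deg_eq_of_filt h2 c2
  refine ⟨by omega, filt_mono ?_ h5, by rw [hD]; exact c2⟩
  push_cast [ha]
  omega

theorem ord_laplace (hT : HasTable Q T) (hprim : ∀ p : K[X], (∀ k, p ∣ coeff Q k) → IsUnit p)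
    (hα : T.α i₀ = 0) : ord (laplace Q) = deg Q ∧ cf (T.col i₀).total (deg Q) (laplace Q) ≠ 0 := by
  have hc : cf (T.col i₀).total (deg Q) (laplace Q) ≠ 0 := by
    rw [cf_laplace (u := 1) (v := 0) (t := deg Q) (by simp) mem_filt_deg (by simp)]
    exact mul_ne_zero (by simp) (hT.deg_eq hprim hα).2.2
  exact ⟨ord_eq_of_filt (laplace_mem_filt (by simp) mem_filt_deg) hc, hc⟩

/-- The finite singular points of the transform are those of the column `i₀`. -/
theorem finite_laplace (hT : HasTable Q T) (hprim : ∀ p : K[X], (∀ k, p ∣ coeff Q k) → IsUnit p)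
    (hα : T.α i₀ = 0) (j : Fin (T.col i₀).len) :
    ((T.col i₀).exps j).total ≤ deg Q ∧
    rootMultiplicity (algebraMap ℂ K ((T.col i₀).pt j)) (coeff (laplace Q) (deg Q))
      = ((T.col i₀).exps j).total ∧
    HasExponentsAt (laplace Q) (algebraMap ℂ K ((T.col i₀).pt j))
      ((((T.col i₀).exps j).map fun e => e - 1).consZero
        (deg Q - ((T.col i₀).exps j).total)) := by
  have := charZero_of_complex (K := K)
  have h := hT.inf_exps i₀ j
  rw [hα, HasTwistedExponents, quadraticPoly_zero_left] at h
  exact h.laplace (hT.inf_generic i₀ j) (hT.ord_laplace hprim hα).1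

theorem onlySingularAt_laplace (hT : HasTable Q T)
    (hprim : ∀ p : K[X], (∀ k, p ∣ coeff Q k) → IsUnit p) (hα : T.α i₀ = 0) :
    OnlySingularAt (laplace Q) fun j => algebraMap ℂ K ((T.col i₀).pt j) := by
  obtain ⟨ho, hc⟩ := hT.ord_laplace hprim hα
  set R := laplace Q
  set s := coeff R (ord R) with hs
  have hs0 : s ≠ 0 := by rw [hs, ho]; exact coeff_ne_zero_of_cf hc
  set b := fun j => algebraMap ℂ K ((T.col i₀).pt j)
  have hinj : Function.Injective b := (algebraMap ℂ K).injective.comp (hT.β_injective i₀)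
  have hcop : Pairwise (Function.onFun IsCoprime fun j => X - C (b j)) :=
    pairwise_coprime_X_sub_C hinj
  have hr : ∀ j, rootMultiplicity (b j) s = ((T.col i₀).exps j).total := by
    intro j
    rw [hs, ho]; exact (hT.finite_laplace hprim hα j).2.1
  set B : K[X] := ∏ j, (X - C (b j)) ^ rootMultiplicity (b j) s with hB
  have hdvd : ∀ q : K[X], (∀ j, (X - C (b j)) ^ rootMultiplicity (b j) s ∣ q) → B ∣ q :=
    fun q hq => Fintype.prod_dvd_of_coprime (fun i j hij => (hcop hij).pow) hq
  have hBdeg : B.natDegree = (T.col i₀).total := by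
    rw [hB, natDegree_prod _ _ fun i _ => pow_ne_zero _ (X_sub_C_ne_zero _)]
    simp only [natDegree_pow, natDegree_X_sub_C, mul_one, hr]
    rfl
  obtain ⟨u, hu⟩ := hdvd s fun j => pow_rootMultiplicity_dvd s (b j)
  -- by degree reasons the leading coefficient is a constant multiple of `B`
  have hsB : s ∣ B := by
    have hu0 : u ≠ 0 := by rintro rfl; rw [mul_zero] at hu; exact hs0 hu
    have hB0 : B ≠ 0 := by intro h0; rw [h0, zero_mul] at hu; exact hs0 hu
    have hdeg : s.natDegree ≤ (T.col i₀).total := by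
      have hf := laplace_mem_filt (by simp) (hT.deg_eq hprim hα).2.1
      refine natDegree_coeff_le_of_filt hf ?_
      have := (hT.deg_eq hprim hα).1
      have := hT.col_total_le i₀
      omega
    rw [hu, natDegree_mul hB0 hu0, hBdeg] at hdeg
    have hunit : IsUnit u := isUnit_iff_degree_eq_zero.2 ((degree_eq_iff_natDegree_eq hu0).2
      (by change u.natDegree = 0; omega))
    rw [hu]
    exact (hunit.mul_right_dvd).2 dvd_rfl
  intro k hk
  refine hsB.trans (hdvd _ fun j => ?_)
  have h1 := (hT.finite_laplace hprim hα j).2.2.1 k hk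
  exact h1.trans (mul_dvd_mul_right (pow_dvd_pow_of_dvd
    (Finset.dvd_prod_of_mem (fun j => X - C (b j)) (Finset.mem_univ j)) _) _)

/-- The column `i₀` of the transform: exponents and Newton polygon at the point `-c`. -/
theorem column_laplace (hT : HasTable Q T)
    (hprim : ∀ p : K[X], (∀ k, p ∣ coeff Q k) → IsUnit p) (hα : T.α i₀ = 0)
    (j : Fin T.reg.len) :
    HasExponentsAtInfinity (Weyl.ade (-quadraticPoly K 0 (-T.reg.pt j)) (laplace Q))
      ((T.reg.exps j).map fun e => e + 1) ∧
    NewtonSlopes (Weyl.ade (-quadraticPoly K 0 (-T.reg.pt j)) (laplace Q))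
      (T.reg.exps j).total (T.reg.total - (T.reg.exps j).total) (deg Q - T.reg.total) := by
  rw [neg_quadraticPoly_zero_neg]
  obtain ⟨h1, h2, h3⟩ := (hT.reg_exps j).laplace (hT.reg_generic j)
    (hT.rootMultiplicity_eq hprim j) hT.ne_zero
  refine ⟨h3, ?_⟩
  rw [ade_laplace]
  obtain ⟨hd, hf, hc⟩ := hT.deg_eq hprim hα
  have hle := hT.col_total_le i₀
  have hmM : (T.reg.exps j).total ≤ T.reg.total :=
    Finset.single_le_sum (f := fun j => (T.reg.exps j).total) (fun _ _ => Nat.zero_le _)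
      (Finset.mem_univ j)
  have hM := hT.natDegree_lead hprim
  set c := algebraMap ℂ K (T.reg.pt j)
  set m := (T.reg.exps j).total
  set M := T.reg.total
  set n := ord Q
  set n₁ := (T.col i₀).total
  have f1 : Weyl.translate c Q ∈ filt 0 1 n := translate_mem_filt (by simp) (by simp) c mem_filt_ord
  have f2 : Weyl.translate c Q ∈ filt 1 0 (deg Q) :=
    translate_mem_filt (by simp) (by simp) c mem_filt_deg
  have f3 : Weyl.translate c Q ∈ filt 1 1 (M + n) := translate_mem_filt (by simp) (by simp) c hf
  have e1 : m + (M - m) = M := by omega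
  have e2 : m + (M - m) + (deg Q - M) = deg Q := by omega
  refine newtonSlopes_iff.2 ⟨n, by omega, laplace_mem_filt (by simp) f1, ?_,
    laplace_mem_filt (by simp) h2, ?_, ?_, ?_, ?_⟩
  · rw [e2]; exact laplace_mem_filt (by simp) f2
  · exact filt_mono (by push_cast [hmM]; linarith) (laplace_mem_filt (by simp) f3)
  · rw [cf_laplace (u := 0) (v := 1) (by simp) f1 (by simp)]
    exact mul_ne_zero (by simp) h1
  · rw [e1, cf_laplace (u := 0) (v := 1) (by simp) f1 (by simp),
      cf_translate (u := 1) (v := 1) (by simp) (by simp) c hf (by simp)]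
    refine mul_ne_zero (by simp) ?_
    rw [cf_apply, ← hM, coeff_natDegree]
    exact leadingCoeff_ne_zero.2 (coeff_ord_ne_zero hT.ne_zero)
  · rw [e2, show n - (deg Q - M) = n₁ by omega,
      cf_laplace (u := 1) (v := 0) (by simp) f2 (by simp),
      cf_translate (u := 1) (v := 0) (by simp) (by simp) c mem_filt_deg (by simp)]
    exact mul_ne_zero (by simp) hc

/-- The untwisted Newton polygon of the transform has slopes `0` and `1` of total length
`∑ᵢ mᵢ`; slope `0` occurs if `0` is one of the `cᵢ`. -/
theorem exists_newtonSlopes_laplace (hT : HasTable Q T)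
    (hprim : ∀ p : K[X], (∀ k, p ∣ coeff Q k) → IsUnit p) (hα : T.α i₀ = 0) :
    ∃ a ≤ T.reg.total, NewtonSlopes (laplace Q) a (T.reg.total - a) (deg Q - T.reg.total) := by
  by_cases h0 : ∃ j, T.reg.pt j = 0
  · obtain ⟨j, hj⟩ := h0
    refine ⟨(T.reg.exps j).total, Finset.single_le_sum (f := fun j => (T.reg.exps j).total)
      (fun _ _ => Nat.zero_le _) (Finset.mem_univ j), ?_⟩
    have := (hT.column_laplace hprim hα j).2
    rwa [neg_quadraticPoly_zero_neg, hj, map_zero, C_0, zero_mul, ade_zero] at this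
  · push Not at h0
    refine ⟨0, Nat.zero_le _, ?_⟩
    obtain ⟨hd, hf, hc⟩ := hT.deg_eq hprim hα
    have hle := hT.col_total_le i₀
    have hM := hT.natDegree_lead hprim
    have hq0 : cf 0 (ord Q) Q ≠ 0 := by
      intro h
      have hX : (X : K[X]) ∣ coeff Q (ord Q) := X_dvd_iff.2 h
      obtain ⟨j, -, hj⟩ := (irreducible_X.prime.dvd_finsetProd_iff _).1
        (irreducible_dvd_prod hprim hT.only_singular irreducible_X hX)
      rw [X_dvd_iff] at hj
      simp at hj
      exact h0 j hj
    have e : 0 + (T.reg.total - 0) + (deg Q - T.reg.total) = deg Q := by omega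
    have hf' := laplace_mem_filt (by simp) (mem_filt_ord (P := Q))
    refine newtonSlopes_iff.2 ⟨ord Q, by omega, hf', ?_, ?_, ?_, ?_, ?_, ?_⟩
    · rw [e]; exact laplace_mem_filt (by simp) mem_filt_deg
    · intro a b hab
      have := hf' a b hab
      push_cast
      omega
    · exact filt_mono (by rw [Nat.sub_zero]; push_cast; linarith)
        (laplace_mem_filt (by simp) hf)
    · rw [cf_laplace (u := 0) (v := 1) (by simp) mem_filt_ord (by simp)]
      exact mul_ne_zero (by simp) hq0
    · rw [zero_add, Nat.sub_zero, cf_laplace (u := 0) (v := 1) (by simp) mem_filt_ord (by simp)]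
      refine mul_ne_zero (by simp) ?_
      rw [cf_apply, ← hM, coeff_natDegree]
      exact leadingCoeff_ne_zero.2 (coeff_ord_ne_zero hT.ne_zero)
    · rw [e, show ord Q - (deg Q - T.reg.total) = (T.col i₀).total by omega]
      exact (hT.ord_laplace hprim hα).2

/-- For a column `i ≠ i₀` the Newton polygons of `Q` and of its transform differ only in the length
of the slope `2`. -/
theorem newtonSlopes_laplace_of_ne (hT : HasTable Q T)
    (hprim : ∀ p : K[X], (∀ k, p ∣ coeff Q k) → IsUnit p) (hα : T.α i₀ = 0) {i : Fin r}
    (hi : i ≠ i₀) (β : ℂ) {a : ℕ} (ha : a ≤ (T.col i).total)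
    (h : NewtonSlopes (Weyl.ade (-quadraticPoly K (T.α i) β) Q) a ((T.col i).total - a)
      (ord Q - (T.col i).total)) :
    NewtonSlopes (Weyl.ade (-quadraticPoly K (-1 / T.α i) (β / T.α i)) (laplace Q)) a
      ((T.col i).total - a) (deg Q - (T.col i).total) := by
  have hαi : T.α i ≠ 0 := fun h => hi (hT.α_injective (h.trans hα.symm))
  have hu0 : algebraMap ℂ K (T.α i) ≠ 0 := (_root_.map_ne_zero _).2 hαi
  obtain ⟨hd, hf, hc⟩ := hT.deg_eq hprim hα
  obtain ⟨ho, hc'⟩ := hT.ord_laplace hprim hα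
  have hle := hT.col_total_add_le hi
  have hM := hT.natDegree_lead hprim
  have hL := ade_laplace_quadraticPoly β (Units.val_mk0 hu0) Q
  set A := Weyl.ade (-quadraticPoly K (T.α i) β) Q
  set R' := Weyl.ade (-quadraticPoly K (-1 / T.α i) (β / T.α i)) (laplace Q) with hR'
  obtain ⟨D, h1, h2, h3, h4, h5, c1, c2, c3⟩ := newtonSlopes_iff.1 h
  have e1 : a + ((T.col i).total - a) = (T.col i).total := by omega
  have e2 : (T.col i).total + (ord Q - (T.col i).total) = ord Q := by omega
  have e3 : (T.col i).total + (deg Q - (T.col i).total) = deg Q := by omega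
  rw [e1] at c2
  rw [e1, e2] at c3
  -- the leading coefficient is not changed by twisting, which determines `D`
  have hlead : coeff A (ord Q) = coeff Q (ord Q) := coeff_ade_ord _ _
  have hd1 := le_natDegree_coeff c3
  have hd2 := natDegree_coeff_le_of_filt h5 (b := ord Q) (D := D - (ord Q - (T.col i).total))
    (by push_cast [ha, h1, (by omega : (T.col i).total ≤ ord Q)]; linarith)
  rw [hlead, hM] at hd1 hd2
  have hR'o : R' ∈ filt 0 1 (deg Q) := by
    rw [← ho, ← ord_ade (-quadraticPoly K (-1 / T.α i) (β / T.α i)) (laplace Q)]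
    exact mem_filt_ord
  refine newtonSlopes_iff.2 ⟨D, by omega, ?_, ?_, ?_, ?_, ?_, ?_, ?_⟩
  · rw [hL]
    exact dilate_mem_filt (coAde_quadraticPoly_mem_filt (by simp) (by simp) (by simp) _ _ h2)
  · rw [e1, e3]; exact hR'o
  · rw [hL]
    exact dilate_mem_filt (coAde_quadraticPoly_mem_filt (by simp) (by simp) (by simp) _ _ h4)
  · rw [hL]
    exact dilate_mem_filt (coAde_quadraticPoly_mem_filt (by simp) (by simp) (by simp) _ _ h5)
  · rw [hL, cf_dilate_ne_zero, cf_coAde_quadraticPoly _ _ h2]; exact c1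
  · rw [e1, hL, cf_dilate_ne_zero, cf_coAde_quadraticPoly _ _ h2]; exact c2
  · rw [e1, e3, show D - (deg Q - (T.col i).total) = (T.col i₀).total by omega, cf_apply, hR',
      ← ho, coeff_ade_ord, ho]
    exact hc'

/-- The table of the Fourier-Laplace transform of a primitive operator. -/
theorem laplace (hT : HasTable Q T) (hprim : ∀ p : K[X], (∀ k, p ∣ coeff Q k) → IsUnit p)
    (hα : T.α i₀ = 0) : HasTable (Weyl.laplace Q) (T.laplace i₀) := by
  obtain ⟨hd, hf, hc⟩ := hT.deg_eq hprim hα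
  obtain ⟨ho, hc'⟩ := hT.ord_laplace hprim hα
  have hle := hT.col_total_le i₀
  have hα0 : ∀ i, i ≠ i₀ → T.α i ≠ 0 := fun i hi h => hi (hT.α_injective (h.trans hα.symm))
  have hα1 : (T.laplace i₀).α i₀ = 0 := if_pos rfl
  have hα2 : ∀ i, i ≠ i₀ → (T.laplace i₀).α i = -1 / T.α i := fun i hi => if_neg hi
  have hcol1 : (T.laplace i₀).col i₀ = T.reg.map (fun c => -c) (fun μ => μ + 1) := if_pos rfl
  have hcol2 : ∀ i, i ≠ i₀ → (T.laplace i₀).col i = (T.col i).map (fun β => β / T.α i) id :=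
    fun i hi => if_neg hi
  have htot1 : ((T.laplace i₀).col i₀).total = T.reg.total := by rw [hcol1]; rfl
  have htot2 : ∀ i, i ≠ i₀ → ((T.laplace i₀).col i).total = (T.col i).total := by
    intro i hi; rw [hcol2 i hi]; rfl
  refine ⟨ne_zero_of_cf hc', hT.β_injective i₀, ?_, ?_, hT.onlySingularAt_laplace hprim hα, ?_,
    ⟨?_, ?_⟩, ?_, ?_, ?_, ?_, ?_, ?_⟩
  · intro i j hij
    by_cases hi : i = i₀ <;> by_cases hj : j = i₀
    · rw [hi, hj]
    · rw [hi, hα1, hα2 j hj] at hij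
      exact absurd hij.symm (div_ne_zero (by simp) (hα0 j hj))
    · rw [hj, hα1, hα2 i hi] at hij
      exact absurd hij (div_ne_zero (by simp) (hα0 i hi))
    · rw [hα2 i hi, hα2 j hj, neg_div, neg_div, neg_inj, one_div, one_div, inv_inj] at hij
      exact hT.α_injective hij
  · intro i
    by_cases hi : i = i₀
    · rw [hi, hcol1]
      exact neg_injective.comp hT.c_injective
    · rw [hcol2 i hi]
      intro j k hjk
      exact hT.β_injective i ((div_left_inj' (hα0 i hi)).1 hjk)
  · rw [irregularRankLeTwo_iff, ho]
    refine filt_mono ?_ (laplace_mem_filt (by simp) hf)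
    have := le_natDegree_coeff hc'
    omega
  · intro i
    by_cases hi : i = i₀
    · obtain ⟨a, ha, hs⟩ := hT.exists_newtonSlopes_laplace hprim hα
      rw [hi, htot1, hα1, quadraticPoly_zero_left, map_zero, C_0, zero_mul, neg_zero, ade_zero, ho]
      exact ⟨a, ha, hs⟩
    · obtain ⟨a, ha, hs⟩ := hT.normal.1 i
      rw [htot2 i hi, hα2 i hi, ho]
      have := hT.newtonSlopes_laplace_of_ne hprim hα hi 0 ha hs
      rw [zero_div] at this
      exact ⟨a, ha, this⟩
  · intro i
    by_cases hi : i = i₀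
    · rw [hi, hα1, ho, hcol1]
      exact fun j => (hT.column_laplace hprim hα j).2
    · rw [hα2 i hi, ho, hcol2 i hi]
      intro j
      exact hT.newtonSlopes_laplace_of_ne hprim hα hi _
        (Finset.single_le_sum (f := fun j => ((T.col i).exps j).total) (fun _ _ => Nat.zero_le _)
          (Finset.mem_univ j)) (hT.normal.2 i j)
  · intro j
    exact (hT.inf_generic i₀ j).map (-1) fun e => by push_cast; ring
  · intro j
    rw [ho]; exact (hT.finite_laplace hprim hα j).1
  · intro j
    rw [ho]; exact (hT.finite_laplace hprim hα j).2.2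
  · intro i
    by_cases hi : i = i₀
    · rw [hi, hcol1]
      exact fun j => (hT.reg_generic j).map 1 fun e => by push_cast; ring
    · rw [hcol2 i hi]
      exact fun j => hT.inf_generic i j
  · intro i
    by_cases hi : i = i₀
    · rw [hi, hα1, hcol1]
      exact fun j => (hT.column_laplace hprim hα j).1
    · rw [hα2 i hi, hcol2 i hi]
      intro j
      have hu0 : algebraMap ℂ K (T.α i) ≠ 0 := (_root_.map_ne_zero _).2 (hα0 i hi)
      have := HasExponentsAtInfinity.coAde (hT.inf_generic i j) (hT.inf_exps i j) (-1 / T.α i)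
        ((T.col i).pt j / T.α i) (Units.mk0 _ hu0)
      rw [← ade_laplace_quadraticPoly _ (Units.val_mk0 hu0)] at this
      exact this
  · classical
    rw [ho, hd, ← Finset.add_sum_erase _ _ (Finset.mem_univ i₀), htot1,
      Finset.sum_congr rfl fun i hi => htot2 i (Finset.ne_of_mem_erase hi)]
    have := Finset.add_sum_erase Finset.univ (fun i => (T.col i).total) (Finset.mem_univ i₀)
    rw [hT.inf_total] at this
    omega

end HasTable

end Transform

theorem mainTheorem4 {K : Type*} [Field K] [Algebra ℂ K] {r : ℕ}
    (P : Weyl K) (T : LocalTable K r) (hT : HasTable P T) (i₀ : Fin r) :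
    HasTable (Weyl.ade (-quadraticPoly K (T.α i₀) 0) P) (T.subAlpha (T.α i₀)) ∧
    (T.α i₀ = 0 → ∀ Q : Weyl K, Weyl.IsReduced P Q →
      (Weyl.ord (Weyl.laplace Q) : ℤ)
        = ∑ i, ∑ j, ((T.reg.exps i).mult j : ℤ) + ((Weyl.ord P : ℤ) - (T.col i₀).total) ∧
      HasTable (Weyl.laplace Q) (T.laplace i₀)) := by
  refine ⟨hT.ade _, fun hα Q hQ => ?_⟩
  have hprim : ∀ p : K[X], (∀ k, p ∣ Weyl.coeff Q k) → IsUnit p := fun p hp => hQ.isUnit_of_dvd hp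
  obtain ⟨-, ⟨g, h, hg, hh, e⟩, -⟩ := hQ
  have hTQ : HasTable Q T := by
    rw [← hasTable_fn_mul hg, e, hasTable_fn_mul hh]; exact hT
  have hord : Weyl.ord Q = Weyl.ord P := by
    rw [← ord_fn_mul hg, e, ord_fn_mul hh]
  refine ⟨?_, hTQ.laplace hprim hα⟩
  rw [(hTQ.ord_laplace hprim hα).1, (hTQ.deg_eq hprim hα).1, hord, Nat.cast_add,
    Nat.cast_sub (hT.col_total_le i₀)]
  congr 1
  simp [Rows.total, Exponents.total]
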